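/- Let $\alpha>\frac12$, let $f\in L^\infty(\mathbf R)$ be real-valued with $\operatorname{supp} f\subset[0,1]$, and let $\{\omega(j)\}_{j\ge1}$ be i.i.d. real random variables with $|\omega(j)|\le1$, $\mathbf E[\omega(j)]=0$ and $\mathbf E[\omega(j)^2]>0$. Put $V(t)=\sum_{j\ge1}\omega(j)\,j^{-\alpha}f(t-j)$ for $t\ge0$. For $\kappa>0$ let $\psi$ be the solution of $-\psi''+V\psi=\kappa^2\psi$ on $[0,\infty)$ with $\psi(0)=0$, $\psi'(0)=\kappa$, let $\theta_t(\kappa)$ be its Prüfer phase, i.e. the continuous function of $t$ with $\theta_0(\kappa)=0$ and $(\psi(t),\psi'(t)/\kappa)=r_t(\kappa)\,(\sin\theta_t(\kappa),\cos\theta_t(\kappa))$, $r_t(\kappa)>0$, and put $$J^{(m,t)}(\kappa)=\int_m^t e^{2i\theta_s(\kappa)}V(s)\,ds .$$ Let $0<\eta<\alpha-\frac12$ with $\eta\le1$, let $p\ge2$ be real, and let $\kappa_*>0$. Then there is a constant $C>0$ such that for all integers $0\le m\le N$ and all $\kappa_1,\kappa_2\ge\kappa_*$, $$\mathbf E\Bigl[\sup_{m\le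 t\le N}\bigl|J^{(m,t)}(\kappa_1)-J^{(m,t)}(\kappa_2)\bigr|^p\Bigr]\le C\,|\kappa_1-\kappa_2|^{p\eta},$$ where the supremum is over real $t$ and is a measurable function on the probability space (up to null sets), and where $C$ does not depend on $m$, $N$, $\kappa_1$, $\kappa_2$. -/

import Mathlib

open MeasureTheory ProbabilityTheory Set

namespace ClockStatistics

/-- The alloy-type decaying potential on the half-line for one realisation `w` of the amplitudes:
`V(t) = ∑_{j ≥ 1} w(j) j^{-α} f(t - j)`. For `f` supported in `[0, 1]` at most two terms are
non-zero at any given `t`. -/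
noncomputable def potential (α : ℝ) (f : ℝ → ℝ) (w : ℕ+ → ℝ) (t : ℝ) : ℝ :=
  ∑' j : ℕ+, w j / (j : ℝ) ^ α * f (t - (j : ℝ))

/-- `ψ`, with derivative `φ`, solves `-ψ'' + V ψ = κ² ψ` on `[0, ∞)` with the Dirichlet condition
`ψ(0) = 0` and the normalisation `ψ'(0) = κ`. As `V` is only bounded and measurable on bounded
intervals, the equation is meant in the usual sense: `ψ` is continuously differentiable, `ψ'` is
absolutely continuous and the equation holds almost everywhere; this is the integrated form. -/
structure IsDirichletSolution (V : ℝ → ℝ) (κ : ℝ) (ψ φ : ℝ → ℝ) : Prop where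
  continuousOn_fst : ContinuousOn ψ (Ici 0)
  continuousOn_snd : ContinuousOn φ (Ici 0)
  fst_eq : ∀ t, 0 ≤ t → ψ t = ∫ s in (0 : ℝ)..t, φ s
  snd_eq : ∀ t, 0 ≤ t → φ t = κ + ∫ s in (0 : ℝ)..t, (V s - κ ^ 2) * ψ s

/-- `θ` is the Prüfer phase on `[0, ∞)` at energy `κ²`: the continuous function with `θ(0) = 0` and
`(ψ, ψ'/κ) = r (sin θ, cos θ)`, `r > 0`, for the Dirichlet solution `ψ`. -/
def IsPruferPhase (V : ℝ → ℝ) (κ : ℝ) (θ : ℝ → ℝ) : Prop :=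
  ContinuousOn θ (Ici 0) ∧ θ 0 = 0 ∧
    ∃ ψ φ r : ℝ → ℝ, IsDirichletSolution V κ ψ φ ∧
      ∀ t, 0 ≤ t → 0 < r t ∧ ψ t = r t * Real.sin (θ t) ∧ φ t / κ = r t * Real.cos (θ t)

/-- The Prüfer phase `t ↦ θ_t(κ)`. For `κ > 0` and `V` bounded and measurable on bounded intervals
a phase exists, and it is unique on `[0, ∞)`. -/
noncomputable def pruferPhase (V : ℝ → ℝ) (κ : ℝ) : ℝ → ℝ :=
  Classical.epsilon (IsPruferPhase V κ)

/-- `J^{(a,t)}(κ) = ∫_a^t e^{2 i θ_s(κ)} V(s) ds`. -/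
noncomputable def J (V : ℝ → ℝ) (a t κ : ℝ) : ℂ :=
  ∫ s in a..t, Complex.exp (2 * Complex.I * (pruferPhase V κ s : ℂ)) * (V s : ℂ)

end ClockStatistics

namespace ClockStatistics

/-! Write `X_t` for the difference of `J^{(0,t)}` at the two energies and `δ = |κ₁ - κ₂|^η`. The
proof is a Gronwall argument for the `p`-th moments of `X_n` along the integers.

The Prüfer phase solves `θ' = κ - (V/κ) sin² θ`, and `sin² θ = (1 - Re e^{2iθ})/2`. The integral of
`V/2` does not depend on the energy, so the difference of the two phases at time `t` is at most a
constant times `t |κ₁ - κ₂| + |X_t|` (`abs_phase_sub_le`). Since `e^{2iθ}` is bounded, interpolation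
with `min 1 x ≤ x^η` bounds the difference of `e^{2iθ}` on `[j, j+1]` by a multiple of `(j+1)^η (δ +
|X_j|)` (`exists_norm_circlePhase_sub_le`).

On `[j, j+1]` the potential is `ω(j) j^{-α} f(· - j)`. Expanding `e^{2iθ}` around free evolution,
the increment of `X` is `ω(j) j^{-α}` times a coefficient determined by `ω(1), …, ω(j-1)`, plus a
remainder of second order in `j^{-α}` (`norm_J_unit_sub_unitCoefficient_le`). Both inherit the
factor `(j+1)^η (δ + |X_j|)`. With `d_j = (j+1)^{-(α-η)}`, the martingale coefficients are thus
`O(d_j (δ + |X_j|))` and the remainders `O(d_j² (δ + |X_j|))` (`exists_increment_bounds`). The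
condition `η < α - 1/2` says exactly that `∑ d_j²` converges, which makes all constants uniform in
`N`.

A second-order expansion of `|x|^p` kills the linear martingale term in expectation, so the sum
`W_n` of `δ^p` and the `p`-th powers of the martingale parts and of the accumulated remainder
satisfies `E W_{n+1} ≤ (1 + L d_n²) E W_n`. Hence `E W_n ≤ e^{LD} δ^p`, and Doob's inequality passes
to the running maximum (`IsCenteredNoise.exists_integral_max_le`). Between integers the
deterministic increment bound suffices, because `d_j^p ≤ d_j²` is summable; the starting point `m`
costs one more triangle inequality.

The rest is foundational: existence and uniqueness of the phase, and continuity of all quantities in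
the amplitude sequence, which gives measurability. For this the potential is replaced by an a.e.
equal one, built from a bounded measurable representative of `f` and amplitudes truncated to `[-1,
1]`, so that all bounds hold at every sample point. -/

/-! ### Gronwall's inequality and the exponential of an indefinite integral. -/

theorem le_mul_exp_of_le_add_integral {D : ℝ → ℝ} (hD : Continuous D) {a T A b : ℝ} (hb : 0 ≤ b)
    (h : ∀ t ∈ Icc a T, D t ≤ A + b * ∫ s in a..t, D s) :
    ∀ t ∈ Icc a T, D t ≤ A * Real.exp (b * (t - a)) := by
  intro t ht
  have hderiv : ∀ x, HasDerivAt (fun t => (A + b * ∫ s in a..t, D s) * Real.exp (-(b * (t - a))))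
      ((b * D x) * Real.exp (-(b * (x - a)))
        + (A + b * ∫ s in a..x, D s) * (Real.exp (-(b * (x - a))) * (-b))) x := by
    intro x
    have h1 : HasDerivAt (fun t => ∫ s in a..t, D s) (D x) x :=
      intervalIntegral.integral_hasDerivAt_right (hD.intervalIntegrable _ _)
        hD.aestronglyMeasurable.stronglyMeasurableAtFilter hD.continuousAt
    have h2 : HasDerivAt (fun t => -(b * (t - a))) (-b) x := by
      simpa using (((hasDerivAt_id x).sub_const a).const_mul b).fun_neg
    exact ((h1.const_mul b).const_add A).mul h2.exp
  -- Integrating factor: the hypothesis at `x` is the sign of this derivative.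
  have hanti := antitoneOn_of_deriv_nonpos (convex_Icc a T)
    (f := fun t => (A + b * ∫ s in a..t, D s) * Real.exp (-(b * (t - a))))
    (fun x _ => (hderiv x).continuousAt.continuousWithinAt)
    (fun x _ => (hderiv x).differentiableAt.differentiableWithinAt)
    (by
      intro x hx
      rw [(hderiv x).deriv]
      have hx' := interior_subset hx
      have h3 := mul_le_mul_of_nonneg_left (h x hx') hb
      have h4 := Real.exp_pos (-(b * (x - a)))
      nlinarith)
  have h5 := hanti (left_mem_Icc.2 (ht.1.trans ht.2)) ht ht.1
  simp only [intervalIntegral.integral_same, mul_zero, add_zero, sub_self, neg_zero,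
    Real.exp_zero, mul_one] at h5
  refine (h t ht).trans ?_
  have h6 : (A + b * ∫ s in a..t, D s) =
      (A + b * ∫ s in a..t, D s) * Real.exp (-(b * (t - a))) * Real.exp (b * (t - a)) := by
    rw [mul_assoc, ← Real.exp_add]; simp
  rw [h6]
  exact mul_le_mul_of_nonneg_right h5 (Real.exp_pos _).le

theorem intervalIntegrable_of_bound {E : Type*} [NormedAddCommGroup E] {g : ℝ → E} {B : ℝ}
    (hg : AEStronglyMeasurable g volume) (hB : ∀ s, ‖g s‖ ≤ B) (a b : ℝ) :
    IntervalIntegrable g volume a b := by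
  rw [intervalIntegrable_iff]
  exact Measure.integrableOn_of_bounded (M := B) (by simp) hg
    (Filter.Eventually.of_forall hB)

/-- The integrand is only bounded and measurable, so neither side need be differentiable everywhere.
Their difference `H` is: the first-order terms cancel, leaving `|H y - H x| = O(|y - x|²)` at every
`x`, so `H` has derivative zero and is constant. -/
theorem cexp_integral_eq {g : ℝ → ℂ} {B : ℝ} (hg : Measurable g) (hB : ∀ s, ‖g s‖ ≤ B) (t : ℝ) :
    Complex.exp (∫ s in (0 : ℝ)..t, g s)
      = 1 + ∫ s in (0 : ℝ)..t, g s * Complex.exp (∫ u in (0 : ℝ)..s, g u) := by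
  have hB0 : 0 ≤ B := (norm_nonneg _).trans (hB 0)
  have hgi := intervalIntegrable_of_bound hg.aestronglyMeasurable hB
  set G : ℝ → ℂ := fun t => ∫ s in (0 : ℝ)..t, g s with hG
  have hGc : Continuous G := intervalIntegral.continuous_primitive hgi 0
  have hGsub : ∀ x y, G y - G x = ∫ s in x..y, g s := fun x y =>
    intervalIntegral.integral_interval_sub_left (hgi _ _) (hgi _ _)
  have hGlip : ∀ x y, ‖G y - G x‖ ≤ B * |y - x| := fun x y => by
    rw [hGsub]; exact intervalIntegral.norm_integral_le_of_norm_le_const (fun s _ => hB s)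
  have hgF : ∀ a b, IntervalIntegrable (fun s => g s * Complex.exp (G s)) volume a b := fun a b =>
    (hgi a b).mul_continuousOn (Complex.continuous_exp.comp hGc).continuousOn
  set H : ℝ → ℂ := fun t => Complex.exp (G t) - ∫ s in (0 : ℝ)..t, g s * Complex.exp (G s) with hH
  have key : ∀ x, HasDerivAt H 0 x := by
    intro x
    rw [hasDerivAt_iff_isLittleO]
    simp only [smul_zero, sub_zero]
    set E := ‖Complex.exp (G x)‖ with hE
    have hbig : (fun y => H y - H x) =O[nhds x] fun y => |y - x| ^ 2 := by
      refine Asymptotics.IsBigO.of_bound (E * (B ^ 2 + B * (2 * B))) ?_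
      have hev : ∀ᶠ y in nhds x, B * |y - x| < 1 := by
        have : ContinuousAt (fun y : ℝ => B * |y - x|) x := by fun_prop
        exact this.eventually_lt continuousAt_const (by simp)
      filter_upwards [hev] with y hy
      have hfac : ∀ s, Complex.exp (G s) = Complex.exp (G x) * Complex.exp (G s - G x) := fun s => by
        rw [← Complex.exp_add]; congr 1; ring
      have hint : (∫ s in (0 : ℝ)..y, g s * Complex.exp (G s))
          - (∫ s in (0 : ℝ)..x, g s * Complex.exp (G s))
          = ∫ s in x..y, g s * Complex.exp (G s) :=
        intervalIntegral.integral_interval_sub_left (hgF _ _) (hgF _ _)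
      have hdec : H y - H x = Complex.exp (G x) * (Complex.exp (G y - G x) - 1 - (G y - G x))
          - ∫ s in x..y, g s * (Complex.exp (G s) - Complex.exp (G x)) := by
        have h1 : ∫ s in x..y, g s * (Complex.exp (G s) - Complex.exp (G x))
            = (∫ s in x..y, g s * Complex.exp (G s)) - (G y - G x) * Complex.exp (G x) := by
          rw [hGsub, ← intervalIntegral.integral_mul_const, ← intervalIntegral.integral_sub
            (hgF _ _) ((hgi _ _).mul_const _)]
          congr 1; ext s; ring
        rw [h1, hH]
        simp only
        rw [hfac y, ← hint]
        ring
      rw [hdec]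
      have hle : ∀ s ∈ uIoc x y, |s - x| ≤ |y - x| := by
        intro s hs
        rcases le_total x y with hxy | hxy
        · rw [uIoc_of_le hxy] at hs
          rw [abs_of_nonneg (by linarith [hs.1]), abs_of_nonneg (by linarith)]; linarith [hs.2]
        · rw [uIoc_of_ge hxy] at hs
          rw [abs_of_nonpos (by linarith [hs.2]), abs_of_nonpos (by linarith)]; linarith [hs.1]
      have h2 : ‖Complex.exp (G x) * (Complex.exp (G y - G x) - 1 - (G y - G x))‖
          ≤ E * (B * |y - x|) ^ 2 := by
        rw [norm_mul]
        refine mul_le_mul_of_nonneg_left ?_ (norm_nonneg _)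
        refine (Complex.norm_exp_sub_one_sub_id_le ((hGlip x y).trans hy.le)).trans ?_
        gcongr; exact hGlip x y
      have h3 : ‖∫ s in x..y, g s * (Complex.exp (G s) - Complex.exp (G x))‖
          ≤ (B * (E * (2 * (B * |y - x|)))) * |y - x| := by
        refine intervalIntegral.norm_integral_le_of_norm_le_const fun s hs => ?_
        rw [norm_mul]
        have h4 : Complex.exp (G s) - Complex.exp (G x)
            = Complex.exp (G x) * (Complex.exp (G s - G x) - 1) := by
          rw [hfac s]; ring
        have h5 : ‖G s - G x‖ ≤ B * |y - x| :=
          (hGlip x s).trans (mul_le_mul_of_nonneg_left (hle s hs) hB0)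
        rw [h4, norm_mul]
        have h6 : ‖Complex.exp (G s - G x) - 1‖ ≤ 2 * (B * |y - x|) :=
          (Complex.norm_exp_sub_one_le (h5.trans hy.le)).trans (by linarith)
        gcongr
        exact hB s
      refine (norm_sub_le _ _).trans ((add_le_add h2 h3).trans (le_of_eq ?_))
      rw [Real.norm_of_nonneg (by positivity)]
      ring
    refine hbig.trans_isLittleO ?_
    have h7 : (fun y : ℝ => |y - x| ^ 2) = fun y => (y - x) * (y - x) := by
      ext y; rw [sq_abs]; ring
    rw [h7]
    have h8 : (fun y : ℝ => y - x) =o[nhds x] fun _ => (1 : ℝ) := by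
      rw [Asymptotics.isLittleO_one_iff]
      have : ContinuousAt (fun y : ℝ => y - x) x := by fun_prop
      simpa [ContinuousAt] using this
    simpa using h8.mul_isBigO (Asymptotics.isBigO_refl (fun y : ℝ => y - x) (nhds x))
  have hconst := is_const_of_deriv_eq_zero (f := H) (fun x => (key x).differentiableAt)
    (fun x => (key x).deriv) t 0
  simp only [hH, hG, intervalIntegral.integral_same, Complex.exp_zero, sub_zero] at hconst
  rw [sub_eq_iff_eq_add] at hconst
  exact hconst

/-! ### The Prüfer equation: existence, uniqueness and stability of the phase. -/

theorem abs_sin_sq_sub_sin_sq_le (x y : ℝ) :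
    |Real.sin x ^ 2 - Real.sin y ^ 2| ≤ |x - y| := by
  have h : Real.sin x ^ 2 - Real.sin y ^ 2 = Real.sin (x - y) * Real.sin (x + y) := by
    rw [Real.sin_sub, Real.sin_add]
    nlinarith [Real.sin_sq_add_cos_sq x, Real.sin_sq_add_cos_sq y]
  rw [h, abs_mul]
  calc |Real.sin (x - y)| * |Real.sin (x + y)| ≤ |x - y| * 1 :=
        mul_le_mul Real.abs_sin_le_abs (Real.abs_sin_le_one _) (abs_nonneg _) (abs_nonneg _)
    _ = _ := mul_one _

/-- The integrated Prüfer equation `θ' = κ - (V / κ) sin² θ`, `θ(0) = 0`. -/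
def SolvesPhaseEquation (V : ℝ → ℝ) (κ : ℝ) (θ : ℝ → ℝ) : Prop :=
  Continuous θ ∧
    ∀ t, 0 ≤ t → θ t = κ * t - (1 / κ) * ∫ s in (0 : ℝ)..t, V s * Real.sin (θ s) ^ 2

theorem sin_sq_le_one' (x : ℝ) : |Real.sin x ^ 2| ≤ 1 := by
  rw [abs_of_nonneg (sq_nonneg _)]; exact Real.sin_sq_le_one x

theorem norm_mul_sin_sq_le {V : ℝ → ℝ} {B : ℝ} (hB : ∀ s, |V s| ≤ B) (θ : ℝ → ℝ) (s : ℝ) :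
    ‖V s * Real.sin (θ s) ^ 2‖ ≤ B := by
  rw [Real.norm_eq_abs, abs_mul]
  calc |V s| * |Real.sin (θ s) ^ 2| ≤ B * 1 :=
        mul_le_mul (hB s) (sin_sq_le_one' _) (abs_nonneg _) ((abs_nonneg _).trans (hB s))
    _ = B := mul_one B

theorem intervalIntegrable_mul_sin_sq {V : ℝ → ℝ} {B : ℝ} (hV : Measurable V)
    (hB : ∀ s, |V s| ≤ B) {θ : ℝ → ℝ} (hθ : Measurable θ) (a b : ℝ) :
    IntervalIntegrable (fun s => V s * Real.sin (θ s) ^ 2) volume a b :=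
  intervalIntegrable_of_bound
    (hV.mul ((Real.measurable_sin.comp hθ).pow_const 2)).aestronglyMeasurable
    (norm_mul_sin_sq_le hB θ) a b

/-- Picard iterates of the Prüfer equation. -/
noncomputable def phaseIterate (V : ℝ → ℝ) (κ : ℝ) : ℕ → ℝ → ℝ
  | 0 => fun _ => 0
  | n + 1 => fun t =>
      κ * t - (1 / κ) * ∫ s in (0 : ℝ)..t, V s * Real.sin (phaseIterate V κ n s) ^ 2

theorem continuous_phaseIterate {V : ℝ → ℝ} {B : ℝ} (hV : Measurable V)
    (hB : ∀ s, |V s| ≤ B) (κ : ℝ) (n : ℕ) : Continuous (phaseIterate V κ n) := by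
  induction n with
  | zero => exact continuous_const
  | succ n ih =>
    exact (continuous_const.mul continuous_id).sub (continuous_const.mul
      (intervalIntegral.continuous_primitive (intervalIntegrable_mul_sin_sq hV hB ih.measurable) 0))

/-- `sin²` is 1-Lipschitz, so each Picard step integrates the previous bound against `B / κ`; the
repeated integration produces the factorial, hence convergence for all `t ≥ 0`. -/
theorem abs_phaseIterate_sub_le {V : ℝ → ℝ} {B : ℝ} (hV : Measurable V)
    (hB : ∀ s, |V s| ≤ B) {κ : ℝ} (hκ : 0 < κ) (n : ℕ) {t : ℝ} (ht : 0 ≤ t) :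
    |phaseIterate V κ (n + 1) t - phaseIterate V κ n t|
      ≤ κ * t * ((B / κ * t) ^ n / n.factorial) := by
  have hB0 : 0 ≤ B := (abs_nonneg _).trans (hB 0)
  induction n generalizing t with
  | zero => simp [phaseIterate, abs_of_nonneg ht, abs_of_pos hκ]
  | succ n ih =>
    have hi := fun n => intervalIntegrable_mul_sin_sq hV hB
      (continuous_phaseIterate hV hB κ n).measurable
    have h1 : phaseIterate V κ (n + 1 + 1) t - phaseIterate V κ (n + 1) t
        = -((1 / κ) * ∫ s in (0 : ℝ)..t, V s * (Real.sin (phaseIterate V κ (n + 1) s) ^ 2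
            - Real.sin (phaseIterate V κ n s) ^ 2)) := by
      have : ∀ s, V s * (Real.sin (phaseIterate V κ (n + 1) s) ^ 2
            - Real.sin (phaseIterate V κ n s) ^ 2)
          = V s * Real.sin (phaseIterate V κ (n + 1) s) ^ 2
            - V s * Real.sin (phaseIterate V κ n s) ^ 2 := fun s => mul_sub _ _ _
      simp only [this]
      rw [intervalIntegral.integral_sub (hi _ _ _) (hi _ _ _)]
      rw [phaseIterate, phaseIterate]
      ring
    rw [h1, abs_neg, abs_mul, abs_of_pos (by positivity : 0 < 1 / κ)]
    have h2 : |∫ s in (0 : ℝ)..t, V s * (Real.sin (phaseIterate V κ (n + 1) s) ^ 2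
            - Real.sin (phaseIterate V κ n s) ^ 2)|
        ≤ ∫ s in (0 : ℝ)..t, (B * (κ * t * ((B / κ) ^ n / n.factorial))) * s ^ n := by
      rw [← Real.norm_eq_abs]
      refine intervalIntegral.norm_integral_le_of_norm_le ht ?_
        ((continuous_const.mul (continuous_id.pow n)).intervalIntegrable _ _)
      refine Filter.Eventually.of_forall fun s hs => ?_
      rw [Real.norm_eq_abs, abs_mul]
      have h3 := (abs_sin_sq_sub_sin_sq_le (phaseIterate V κ (n + 1) s)
        (phaseIterate V κ n s)).trans (ih hs.1.le)
      have h4 : κ * s * ((B / κ * s) ^ n / n.factorial)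
          ≤ κ * t * ((B / κ * s) ^ n / n.factorial) := by
        have : 0 ≤ s := hs.1.le
        gcongr
        exact hs.2
      refine (mul_le_mul (hB s) (h3.trans h4) (abs_nonneg _) hB0).trans (le_of_eq ?_)
      rw [mul_pow]; ring
    rw [intervalIntegral.integral_const_mul, integral_pow] at h2
    refine (mul_le_mul_of_nonneg_left h2 (by positivity)).trans (le_of_eq ?_)
    rw [Nat.factorial_succ]
    push_cast
    have : (n.factorial : ℝ) ≠ 0 := by positivity
    have h5 := hκ.ne'
    rw [zero_pow (Nat.succ_ne_zero n), sub_zero]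
    simp only [div_pow, mul_pow]
    field_simp
    ring

theorem exists_solvesPhaseEquation {V : ℝ → ℝ} {B : ℝ} (hV : Measurable V)
    (hB : ∀ s, |V s| ≤ B) {κ : ℝ} (hκ : 0 < κ) : ∃ θ, SolvesPhaseEquation V κ θ := by
  have hcau : ∀ t, 0 ≤ t → CauchySeq fun n => phaseIterate V κ n t := by
    intro t ht
    refine cauchySeq_of_dist_le_of_summable
      (fun n => κ * t * ((B / κ * t) ^ n / n.factorial)) (fun n => ?_)
      ((Real.summable_pow_div_factorial _).mul_left _)
    rw [dist_comm, Real.dist_eq]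
    exact abs_phaseIterate_sub_le hV hB hκ n ht
  -- The iterates are controlled only for `t ≥ 0`; freezing the argument at `0` makes the limit a
  -- continuous function on the whole line.
  have hlim : ∀ t : ℝ, ∃ l, Filter.Tendsto (fun n => phaseIterate V κ n (max t 0)) Filter.atTop
      (nhds l) := fun t => cauchySeq_tendsto_of_complete (hcau _ (le_max_right _ _))
  choose θ hθ using hlim
  have hmeas : Measurable θ := measurable_of_tendsto_metrizable
    (fun n => (continuous_phaseIterate hV hB κ n).measurable.comp
      (measurable_id.max measurable_const)) (tendsto_pi_nhds.2 hθ)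
  have hi := intervalIntegrable_mul_sin_sq hV hB hmeas
  have heq : ∀ t, θ t
      = κ * max t 0 - (1 / κ) * ∫ s in (0 : ℝ)..max t 0, V s * Real.sin (θ s) ^ 2 := by
    intro t
    refine tendsto_nhds_unique ((hθ t).comp (Filter.tendsto_add_atTop_nat 1)) ?_
    have ht : 0 ≤ max t 0 := le_max_right _ _
    refine Filter.Tendsto.sub tendsto_const_nhds (Filter.Tendsto.mul tendsto_const_nhds ?_)
    refine intervalIntegral.tendsto_integral_filter_of_dominated_convergence (fun _ => B)
      (Filter.Eventually.of_forall fun n => ?_) (Filter.Eventually.of_forall fun n => ?_)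
      intervalIntegrable_const ?_
    · exact (hV.mul ((Real.measurable_sin.comp
        (continuous_phaseIterate hV hB κ n).measurable).pow_const 2)).aestronglyMeasurable
    · exact Filter.Eventually.of_forall fun s _ => norm_mul_sin_sq_le hB _ s
    · refine Filter.Eventually.of_forall fun s hs => ?_
      rw [uIoc_of_le ht] at hs
      have h := hθ s
      rw [max_eq_left hs.1.le] at h
      exact ((Real.continuous_sin.continuousAt.tendsto.comp h).pow 2).const_mul _
  refine ⟨θ, ?_, fun t ht => ?_⟩
  · have : θ = fun t => κ * max t 0
        - (1 / κ) * ∫ s in (0 : ℝ)..max t 0, V s * Real.sin (θ s) ^ 2 := funext heq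
    rw [this]
    have hm : Continuous fun t : ℝ => max t 0 := continuous_id.max continuous_const
    exact (continuous_const.mul hm).sub (continuous_const.mul
      ((intervalIntegral.continuous_primitive hi 0).comp hm))
  · have := heq t
    rwa [max_eq_left ht] at this

/-- The radius is forced: `r = e^ρ` with `ρ' = (V/κ) sin θ cos θ`. Then `z = e^{ρ + iθ}` is the
exponential of an indefinite integral, and its imaginary part and `κ` times its real part are the
Dirichlet solution and its derivative. -/
theorem SolvesPhaseEquation.isPruferPhase {V : ℝ → ℝ} {B : ℝ} (hV : Measurable V)
    (hB : ∀ s, |V s| ≤ B) {κ : ℝ} (hκ : 0 < κ) {θ : ℝ → ℝ} (h : SolvesPhaseEquation V κ θ) :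
    IsPruferPhase V κ θ := by
  have hB0 : 0 ≤ B := (abs_nonneg _).trans (hB 0)
  obtain ⟨hc, heq⟩ := h
  have hm := hc.measurable
  set g₁ : ℝ → ℝ := fun s => V s / κ * (Real.sin (θ s) * Real.cos (θ s)) with hg₁
  set g₂ : ℝ → ℝ := fun s => κ - (1 / κ) * (V s * Real.sin (θ s) ^ 2) with hg₂
  have hVm : Measurable fun s => V s / κ := hV.div_const κ
  have hg₁m : Measurable g₁ :=
    hVm.mul ((Real.measurable_sin.comp hm).mul (Real.measurable_cos.comp hm))
  have hg₂m : Measurable g₂ :=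
    measurable_const.sub (measurable_const.mul (hV.mul ((Real.measurable_sin.comp hm).pow_const 2)))
  have hg₁b : ∀ s, ‖g₁ s‖ ≤ B / κ := by
    intro s
    rw [hg₁, Real.norm_eq_abs, abs_mul, abs_div, abs_of_pos hκ, abs_mul]
    have h1 := hB s
    have h2 := Real.abs_sin_le_one (θ s)
    have h3 := Real.abs_cos_le_one (θ s)
    calc |V s| / κ * (|Real.sin (θ s)| * |Real.cos (θ s)|) ≤ B / κ * (1 * 1) := by gcongr
      _ = B / κ := by ring
  have hg₂b : ∀ s, ‖g₂ s‖ ≤ κ + 1 / κ * B := by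
    intro s
    refine (norm_sub_le _ _).trans ?_
    rw [norm_mul, Real.norm_of_nonneg hκ.le, Real.norm_of_nonneg (by positivity : 0 ≤ 1 / κ)]
    gcongr
    exact norm_mul_sin_sq_le hB θ s
  set g : ℝ → ℂ := fun s => (g₁ s : ℂ) + (g₂ s : ℂ) * Complex.I with hg
  have hgm : Measurable g :=
    (Complex.measurable_ofReal.comp hg₁m).add
      ((Complex.measurable_ofReal.comp hg₂m).mul_const _)
  have hgb : ∀ s, ‖g s‖ ≤ B / κ + (κ + 1 / κ * B) := by
    intro s
    refine (norm_add_le _ _).trans ?_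
    rw [norm_mul, Complex.norm_I, mul_one, Complex.norm_real, Complex.norm_real]
    exact add_le_add (hg₁b s) (hg₂b s)
  have hi₁ := intervalIntegrable_of_bound hg₁m.aestronglyMeasurable hg₁b
  have hi₂ := intervalIntegrable_of_bound hg₂m.aestronglyMeasurable hg₂b
  have hi := intervalIntegrable_of_bound hgm.aestronglyMeasurable hgb
  set ρ : ℝ → ℝ := fun t => ∫ s in (0 : ℝ)..t, g₁ s with hρ
  set G : ℝ → ℂ := fun t => ∫ s in (0 : ℝ)..t, g s with hG
  have hGc : Continuous G := intervalIntegral.continuous_primitive hi 0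
  have hθ : ∀ t, 0 ≤ t → ∫ s in (0 : ℝ)..t, g₂ s = θ t := by
    intro t ht
    rw [heq t ht, hg₂, intervalIntegral.integral_sub intervalIntegrable_const
      ((intervalIntegrable_mul_sin_sq hV hB hm _ _).const_mul _),
      intervalIntegral.integral_const_mul]
    simp [mul_comm]
  have hGeq : ∀ t, 0 ≤ t → G t = (ρ t : ℂ) + (θ t : ℂ) * Complex.I := by
    intro t ht
    have h1 : IntervalIntegrable (fun s => (g₁ s : ℂ)) volume 0 t :=
      ⟨(hi₁ 0 t).1.ofReal, (hi₁ 0 t).2.ofReal⟩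
    have h2 : IntervalIntegrable (fun s => (g₂ s : ℂ) * Complex.I) volume 0 t :=
      IntervalIntegrable.mul_const ⟨(hi₂ 0 t).1.ofReal, (hi₂ 0 t).2.ofReal⟩ _
    simp only [hG, hg]
    rw [intervalIntegral.integral_add h1 h2, intervalIntegral.integral_mul_const,
      intervalIntegral.integral_ofReal, intervalIntegral.integral_ofReal, hθ t ht]
  set z : ℝ → ℂ := fun t => Complex.exp (G t) with hz
  have hzc : Continuous z := Complex.continuous_exp.comp hGc
  have hzre : ∀ t, 0 ≤ t → (z t).re = Real.exp (ρ t) * Real.cos (θ t) := by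
    intro t ht
    simp only [hz]
    rw [hGeq t ht, Complex.exp_re]
    simp
  have hzim : ∀ t, 0 ≤ t → (z t).im = Real.exp (ρ t) * Real.sin (θ t) := by
    intro t ht
    simp only [hz]
    rw [hGeq t ht, Complex.exp_im]
    simp
  have hzeq : ∀ t, z t = 1 + ∫ s in (0 : ℝ)..t, g s * z s := fun t => cexp_integral_eq hgm hgb t
  have hgz : ∀ t, IntervalIntegrable (fun s => g s * z s) volume 0 t := fun t =>
    (hi 0 t).mul_continuousOn hzc.continuousOn
  have hz_im : ∀ t, (z t).im = ∫ s in (0 : ℝ)..t, (g s * z s).im := by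
    intro t
    have h := Complex.imCLM.intervalIntegral_comp_comm (hgz t)
    simp only [Complex.imCLM_apply] at h
    rw [h]
    have := congrArg Complex.im (hzeq t)
    simpa using this
  have hz_re : ∀ t, (z t).re = 1 + ∫ s in (0 : ℝ)..t, (g s * z s).re := by
    intro t
    have h := Complex.reCLM.intervalIntegral_comp_comm (hgz t)
    simp only [Complex.reCLM_apply] at h
    rw [h]
    have := congrArg Complex.re (hzeq t)
    simpa using this
  have h0 : θ 0 = 0 := by simpa using heq 0 le_rfl
  refine ⟨hc.continuousOn, h0, fun t => (z t).im, fun t => κ * (z t).re,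
    fun t => Real.exp (ρ t), ⟨?_, ?_, ?_, ?_⟩, fun t ht => ⟨Real.exp_pos _, hzim t ht, ?_⟩⟩
  · exact (Complex.continuous_im.comp hzc).continuousOn
  · exact (continuous_const.mul (Complex.continuous_re.comp hzc)).continuousOn
  · intro t ht
    rw [hz_im t]
    refine intervalIntegral.integral_congr fun s hs => ?_
    rw [uIcc_of_le ht] at hs
    have h1 := Real.sin_sq_add_cos_sq (θ s)
    simp only [Complex.mul_im]
    rw [hzre s hs.1, hzim s hs.1]
    simp only [hg, hg₁, hg₂, Complex.add_re, Complex.add_im, Complex.mul_re, Complex.mul_im,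
      Complex.ofReal_re, Complex.ofReal_im, Complex.I_re, Complex.I_im]
    field_simp
    ring
  · intro t ht
    rw [hz_re t, mul_add, mul_one, ← intervalIntegral.integral_const_mul]
    congr 1
    refine intervalIntegral.integral_congr fun s hs => ?_
    rw [uIcc_of_le ht] at hs
    have h1 := Real.cos_sq' (θ s)
    simp only [Complex.mul_re]
    rw [hzre s hs.1, hzim s hs.1]
    simp only [hg, hg₁, hg₂, Complex.add_re, Complex.add_im, Complex.mul_re, Complex.mul_im,
      Complex.ofReal_re, Complex.ofReal_im, Complex.I_re, Complex.I_im]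
    field_simp
    ring_nf
    rw [h1]
    ring
  · change κ * (z t).re / κ = Real.exp (ρ t) * Real.cos (θ t)
    rw [hzre t ht]
    field_simp

theorem IsDirichletSolution.unique {V : ℝ → ℝ} {B : ℝ} (hV : Measurable V)
    (hB : ∀ s, |V s| ≤ B) {κ : ℝ} {ψ₁ φ₁ ψ₂ φ₂ : ℝ → ℝ} (h₁ : IsDirichletSolution V κ ψ₁ φ₁)
    (h₂ : IsDirichletSolution V κ ψ₂ φ₂) {t : ℝ} (ht : 0 ≤ t) : ψ₁ t = ψ₂ t ∧ φ₁ t = φ₂ t := by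
  have hB0 : 0 ≤ B := (abs_nonneg _).trans (hB 0)
  have hm : Continuous fun t : ℝ => max t 0 := continuous_id.max continuous_const
  have hmm : ∀ t : ℝ, max t 0 ∈ Ici (0 : ℝ) := fun t => mem_Ici.2 (le_max_right _ _)
  have hcont : ∀ {f : ℝ → ℝ}, ContinuousOn f (Ici 0) → Continuous fun t => f (max t 0) :=
    fun hf => hf.comp_continuous hm hmm
  have hint : ∀ {f : ℝ → ℝ}, ContinuousOn f (Ici 0) → ∀ t, 0 ≤ t →
      IntervalIntegrable f volume 0 t := fun hf t ht =>
    (hf.mono fun s hs => by rw [uIcc_of_le ht] at hs; exact hs.1).intervalIntegrable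
  have hVi : ∀ t, IntervalIntegrable (fun s => V s - κ ^ 2) volume 0 t := fun t =>
    (intervalIntegrable_of_bound hV.aestronglyMeasurable hB 0 t).sub intervalIntegrable_const
  have hVint : ∀ {f : ℝ → ℝ}, ContinuousOn f (Ici 0) → ∀ t, 0 ≤ t →
      IntervalIntegrable (fun s => (V s - κ ^ 2) * f s) volume 0 t := fun hf t ht =>
    (hVi t).mul_continuousOn
      (hf.mono fun s hs => by rw [uIcc_of_le ht] at hs; exact hs.1)
  set D : ℝ → ℝ := fun t => |ψ₁ (max t 0) - ψ₂ (max t 0)| + |φ₁ (max t 0) - φ₂ (max t 0)| with hD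
  have hDc : Continuous D :=
    ((hcont h₁.continuousOn_fst).sub (hcont h₂.continuousOn_fst)).abs.add
      ((hcont h₁.continuousOn_snd).sub (hcont h₂.continuousOn_snd)).abs
  have hbd : ∀ T, ∀ t ∈ Icc 0 T, D t ≤ 0 + (1 + (B + κ ^ 2)) * ∫ s in (0 : ℝ)..t, D s := by
    intro T t ht
    have h0 := ht.1
    have e1 : |ψ₁ t - ψ₂ t| ≤ ∫ s in (0 : ℝ)..t, D s := by
      rw [h₁.fst_eq t h0, h₂.fst_eq t h0, ← intervalIntegral.integral_sub
        (hint h₁.continuousOn_snd t h0) (hint h₂.continuousOn_snd t h0), ← Real.norm_eq_abs]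
      refine intervalIntegral.norm_integral_le_of_norm_le h0
        (Filter.Eventually.of_forall fun s hs => ?_) (hDc.intervalIntegrable _ _)
      simp only [hD, Real.norm_eq_abs, max_eq_left hs.1.le]
      linarith [abs_nonneg (ψ₁ s - ψ₂ s)]
    have e2 : |φ₁ t - φ₂ t| ≤ (B + κ ^ 2) * ∫ s in (0 : ℝ)..t, D s := by
      rw [h₁.snd_eq t h0, h₂.snd_eq t h0, add_sub_add_left_eq_sub, ← intervalIntegral.integral_sub
        (hVint h₁.continuousOn_fst t h0) (hVint h₂.continuousOn_fst t h0), ← Real.norm_eq_abs,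
        ← intervalIntegral.integral_const_mul]
      refine intervalIntegral.norm_integral_le_of_norm_le h0
        (Filter.Eventually.of_forall fun s hs => ?_)
        ((continuous_const.mul hDc).intervalIntegrable _ _)
      simp only [hD, Real.norm_eq_abs, max_eq_left hs.1.le]
      rw [← mul_sub, abs_mul]
      refine mul_le_mul ?_ (by linarith [abs_nonneg (φ₁ s - φ₂ s)]) (abs_nonneg _) (by positivity)
      calc |V s - κ ^ 2| ≤ |V s| + |κ ^ 2| := abs_sub _ _
        _ ≤ B + κ ^ 2 := by rw [abs_of_nonneg (sq_nonneg κ)]; linarith [hB s]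
    have e3 : D t = |ψ₁ t - ψ₂ t| + |φ₁ t - φ₂ t| := by simp only [hD, max_eq_left h0]
    rw [e3]
    linarith
  have h := le_mul_exp_of_le_add_integral hDc (by positivity) (hbd t) t ⟨ht, le_rfl⟩
  have e3 : D t = |ψ₁ t - ψ₂ t| + |φ₁ t - φ₂ t| := by simp only [hD, max_eq_left ht]
  rw [zero_mul, e3] at h
  have a1 := abs_nonneg (ψ₁ t - ψ₂ t)
  have a2 := abs_nonneg (φ₁ t - φ₂ t)
  exact ⟨sub_eq_zero.1 (abs_eq_zero.1 (by linarith)), sub_eq_zero.1 (abs_eq_zero.1 (by linarith))⟩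

/-- Uniqueness of the Dirichlet solution makes the two phases agree modulo `2π`, that is `cos |θ₁ -
θ₂| = 1`. If they differed somewhere, `|θ₁ - θ₂|`, which is continuous and vanishes at `0`, would
take the value `π`, where the cosine is `-1`. -/
theorem IsPruferPhase.unique {V : ℝ → ℝ} {B : ℝ} (hV : Measurable V)
    (hB : ∀ s, |V s| ≤ B) {κ : ℝ} {θ₁ θ₂ : ℝ → ℝ} (h₁ : IsPruferPhase V κ θ₁)
    (h₂ : IsPruferPhase V κ θ₂) {t : ℝ} (ht : 0 ≤ t) : θ₁ t = θ₂ t := by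
  obtain ⟨hc₁, hz₁, ψ₁, φ₁, r₁, hs₁, hr₁⟩ := h₁
  obtain ⟨hc₂, hz₂, ψ₂, φ₂, r₂, hs₂, hr₂⟩ := h₂
  have hcos : ∀ s, 0 ≤ s → Real.cos |θ₁ s - θ₂ s| = 1 := by
    intro s hs
    obtain ⟨p₁, a₁, b₁⟩ := hr₁ s hs
    obtain ⟨p₂, a₂, b₂⟩ := hr₂ s hs
    obtain ⟨e₁, e₂⟩ := hs₁.unique hV hB hs₂ hs
    rw [e₁, a₂] at a₁
    rw [e₂, b₂] at b₁
    rw [Real.cos_abs, Real.cos_sub]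
    have q₁ := Real.sin_sq_add_cos_sq (θ₁ s)
    have q₂ := Real.sin_sq_add_cos_sq (θ₂ s)
    have hrr : r₁ s = r₂ s := by
      have : r₁ s ^ 2 = r₂ s ^ 2 := by
        calc r₁ s ^ 2 = (r₁ s * Real.sin (θ₁ s)) ^ 2 + (r₁ s * Real.cos (θ₁ s)) ^ 2 := by
              linear_combination -(r₁ s) ^ 2 * q₁
          _ = (r₂ s * Real.sin (θ₂ s)) ^ 2 + (r₂ s * Real.cos (θ₂ s)) ^ 2 := by rw [a₁, b₁]
          _ = r₂ s ^ 2 := by linear_combination (r₂ s) ^ 2 * q₂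
      exact (pow_left_inj₀ p₁.le p₂.le two_ne_zero).1 this
    rw [hrr] at a₁ b₁
    have a := mul_left_cancel₀ p₂.ne' a₁
    have b := mul_left_cancel₀ p₂.ne' b₁
    rw [← a, ← b]
    linarith
  by_contra hne
  have hpos : 0 < |θ₁ t - θ₂ t| := abs_pos.2 (sub_ne_zero.2 hne)
  have hpi : Real.pi ≤ |θ₁ t - θ₂ t| := by
    by_contra! hlt
    have := (Real.cos_eq_one_iff_of_lt_of_lt (by linarith [Real.pi_pos])
      (by linarith [Real.pi_pos])).1 (hcos t ht)
    exact hpos.ne' this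
  have hcont : ContinuousOn (fun s => |θ₁ s - θ₂ s|) (Icc 0 t) :=
    ((hc₁.sub hc₂).abs).mono fun s hs => hs.1
  obtain ⟨s, hs, hsπ⟩ := intermediate_value_Icc ht hcont
    (show Real.pi ∈ _ from ⟨by simp [hz₁, hz₂, Real.pi_pos.le], hpi⟩)
  have := hcos s hs.1
  simp only at hsπ
  rw [hsπ, Real.cos_pi] at this
  linarith

/-- The Prüfer phase, extended to a continuous function on the whole line. -/
noncomputable def phase (V : ℝ → ℝ) (κ t : ℝ) : ℝ := pruferPhase V κ (max t 0)

theorem phase_of_nonneg (V : ℝ → ℝ) (κ : ℝ) {t : ℝ} (ht : 0 ≤ t) :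
    phase V κ t = pruferPhase V κ t := by rw [phase, max_eq_left ht]

/-- The passage from the abstractly chosen phase to a concrete integral equation: the constructed
solution shows that the choice is a genuine phase, and uniqueness identifies the two. -/
theorem solvesPhaseEquation_phase {V : ℝ → ℝ} {B : ℝ} (hV : Measurable V)
    (hB : ∀ s, |V s| ≤ B) {κ : ℝ} (hκ : 0 < κ) : SolvesPhaseEquation V κ (phase V κ) := by
  obtain ⟨θ, hθ⟩ := exists_solvesPhaseEquation hV hB hκ
  have h1 := hθ.isPruferPhase hV hB hκ
  have h2 : IsPruferPhase V κ (pruferPhase V κ) := Classical.epsilon_spec (p := IsPruferPhase V κ)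
    ⟨θ, h1⟩
  have heq : ∀ t, 0 ≤ t → phase V κ t = θ t := fun t ht => by
    rw [phase_of_nonneg V κ ht]; exact h2.unique hV hB h1 ht
  refine ⟨h2.1.comp_continuous (continuous_id.max continuous_const) fun t => mem_Ici.2 (le_max_right _ _),
    fun t ht => ?_⟩
  rw [heq t ht, hθ.2 t ht]
  congr 2
  refine intervalIntegral.integral_congr fun s hs => ?_
  rw [uIcc_of_le ht] at hs
  simp only [heq s hs.1]

/-- Stated as an equality of predicates, so that `Classical.epsilon` selects the same phase for both
potentials. -/
theorem isPruferPhase_congr {V₁ V₂ : ℝ → ℝ}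
    (h : ∀ᵐ s ∂(volume : Measure ℝ), 0 ≤ s → V₁ s = V₂ s) (κ : ℝ) :
    IsPruferPhase V₁ κ = IsPruferPhase V₂ κ := by
  have hint : ∀ (ψ : ℝ → ℝ) (t : ℝ), 0 ≤ t →
      ∫ s in (0 : ℝ)..t, (V₁ s - κ ^ 2) * ψ s = ∫ s in (0 : ℝ)..t, (V₂ s - κ ^ 2) * ψ s := by
    intro ψ t ht
    refine intervalIntegral.integral_congr_ae ?_
    filter_upwards [h] with s hs hst
    rw [uIoc_of_le ht] at hst
    rw [hs hst.1.le]
  have hsol : ∀ ψ φ, IsDirichletSolution V₁ κ ψ φ ↔ IsDirichletSolution V₂ κ ψ φ := fun ψ φ =>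
    ⟨fun ⟨a, b, c, d⟩ => ⟨a, b, c, fun t ht => by rw [d t ht, hint ψ t ht]⟩,
      fun ⟨a, b, c, d⟩ => ⟨a, b, c, fun t ht => by rw [d t ht, hint ψ t ht]⟩⟩
  funext θ
  simp only [IsPruferPhase, hsol]

theorem J_congr {V₁ V₂ : ℝ → ℝ}
    (h : ∀ᵐ s ∂(volume : Measure ℝ), 0 ≤ s → V₁ s = V₂ s) (κ : ℝ) {a t : ℝ} (ha : 0 ≤ a)
    (hat : a ≤ t) : J V₁ a t κ = J V₂ a t κ := by
  have hp : pruferPhase V₁ κ = pruferPhase V₂ κ := by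
    rw [pruferPhase, pruferPhase, isPruferPhase_congr h]
  rw [J, J, hp]
  refine intervalIntegral.integral_congr_ae ?_
  filter_upwards [h] with s hs hst
  rw [uIoc_of_le hat] at hst
  rw [hs (ha.trans hst.1.le)]

theorem SolvesPhaseEquation.sub_eq {V : ℝ → ℝ} {B : ℝ} (hV : Measurable V)
    (hB : ∀ s, |V s| ≤ B) {κ : ℝ} {θ : ℝ → ℝ} (h : SolvesPhaseEquation V κ θ) {a t : ℝ}
    (ha : 0 ≤ a) (hat : a ≤ t) :
    θ t - θ a = κ * (t - a) - (1 / κ) * ∫ s in a..t, V s * Real.sin (θ s) ^ 2 := by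
  have hi := intervalIntegrable_mul_sin_sq hV hB h.1.measurable
  rw [h.2 t (ha.trans hat), h.2 a ha, ← intervalIntegral.integral_interval_sub_left (hi 0 t)
    (hi 0 a)]
  ring

/-- Gronwall stability with potential, energy and initial value all varying. It serves three ends:
the phase does not anticipate the potential, it is continuous in the amplitudes, and two energies
can be compared within a unit interval. -/
theorem SolvesPhaseEquation.abs_sub_le {V₁ V₂ : ℝ → ℝ} {B : ℝ} (hV₁ : Measurable V₁)
    (hV₂ : Measurable V₂) (hB₁ : ∀ s, |V₁ s| ≤ B) (hB₂ : ∀ s, |V₂ s| ≤ B) {κ₁ κ₂ : ℝ}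
    (hκ₂ : 0 < κ₂) {θ₁ θ₂ : ℝ → ℝ} (h₁ : SolvesPhaseEquation V₁ κ₁ θ₁)
    (h₂ : SolvesPhaseEquation V₂ κ₂ θ₂) {a t T : ℝ} (ha : 0 ≤ a) (hat : a ≤ t) (htT : t ≤ T) :
    |θ₁ t - θ₂ t| ≤ (|θ₁ a - θ₂ a| + |κ₁ - κ₂| * (T - a)
      + ∫ s in a..T, |V₁ s / κ₁ - V₂ s / κ₂|) * Real.exp (B / κ₂ * (T - a)) := by
  have hB0 : 0 ≤ B := (abs_nonneg _).trans (hB₁ 0)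
  have hD : Continuous fun t => |θ₁ t - θ₂ t| := (h₁.1.sub h₂.1).abs
  have hi₁ := intervalIntegrable_mul_sin_sq hV₁ hB₁ h₁.1.measurable
  have hi₂ := intervalIntegrable_mul_sin_sq hV₂ hB₂ h₂.1.measurable
  have hdi : ∀ a b, IntervalIntegrable (fun s => |V₁ s / κ₁ - V₂ s / κ₂|) volume a b :=
    fun a b => (((intervalIntegrable_of_bound hV₁.aestronglyMeasurable hB₁ a b).div_const _).sub
      ((intervalIntegrable_of_bound hV₂.aestronglyMeasurable hB₂ a b).div_const _)).abs
  have hmain : ∀ t ∈ Icc a T, |θ₁ t - θ₂ t| ≤ (|θ₁ a - θ₂ a| + |κ₁ - κ₂| * (T - a)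
      + ∫ s in a..T, |V₁ s / κ₁ - V₂ s / κ₂|) + B / κ₂ * ∫ s in a..t, |θ₁ s - θ₂ s| := by
    intro t ht
    have e1 := h₁.sub_eq hV₁ hB₁ ha ht.1
    have e2 := h₂.sub_eq hV₂ hB₂ ha ht.1
    have e3 : θ₁ t - θ₂ t = (θ₁ a - θ₂ a) + (κ₁ - κ₂) * (t - a)
        - ∫ s in a..t, (1 / κ₁ * (V₁ s * Real.sin (θ₁ s) ^ 2)
          - 1 / κ₂ * (V₂ s * Real.sin (θ₂ s) ^ 2)) := by
      rw [intervalIntegral.integral_sub ((hi₁ _ _).const_mul _) ((hi₂ _ _).const_mul _),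
        intervalIntegral.integral_const_mul, intervalIntegral.integral_const_mul]
      linarith
    have e4 : |∫ s in a..t, (1 / κ₁ * (V₁ s * Real.sin (θ₁ s) ^ 2)
          - 1 / κ₂ * (V₂ s * Real.sin (θ₂ s) ^ 2))|
        ≤ ∫ s in a..t, (|V₁ s / κ₁ - V₂ s / κ₂| + B / κ₂ * |θ₁ s - θ₂ s|) := by
      rw [← Real.norm_eq_abs]
      refine intervalIntegral.norm_integral_le_of_norm_le ht.1
        (Filter.Eventually.of_forall fun s _ => ?_)
        ((hdi _ _).add ((hD.intervalIntegrable _ _).const_mul _))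
      have : 1 / κ₁ * (V₁ s * Real.sin (θ₁ s) ^ 2) - 1 / κ₂ * (V₂ s * Real.sin (θ₂ s) ^ 2)
          = (V₁ s / κ₁ - V₂ s / κ₂) * Real.sin (θ₁ s) ^ 2
            + V₂ s / κ₂ * (Real.sin (θ₁ s) ^ 2 - Real.sin (θ₂ s) ^ 2) := by ring
      rw [this, Real.norm_eq_abs]
      refine (abs_add_le _ _).trans (add_le_add ?_ ?_)
      · rw [abs_mul]
        exact mul_le_of_le_one_right (abs_nonneg _) (sin_sq_le_one' _)
      · rw [abs_mul, abs_div, abs_of_pos hκ₂]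
        have := hB₂ s
        have := abs_sin_sq_sub_sin_sq_le (θ₁ s) (θ₂ s)
        gcongr
    rw [intervalIntegral.integral_add (hdi _ _) ((hD.intervalIntegrable _ _).const_mul _),
      intervalIntegral.integral_const_mul] at e4
    have e5 : ∫ s in a..t, |V₁ s / κ₁ - V₂ s / κ₂| ≤ ∫ s in a..T, |V₁ s / κ₁ - V₂ s / κ₂| :=
      intervalIntegral.integral_mono_interval le_rfl ht.1 ht.2
        (Filter.Eventually.of_forall fun s => abs_nonneg _) (hdi _ _)
    have e6 : |(κ₁ - κ₂) * (t - a)| ≤ |κ₁ - κ₂| * (T - a) := by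
      rw [abs_mul, abs_of_nonneg (by linarith [ht.1] : 0 ≤ t - a)]
      exact mul_le_mul_of_nonneg_left (by linarith [ht.2]) (abs_nonneg _)
    rw [e3]
    have e7 := abs_sub ((θ₁ a - θ₂ a) + (κ₁ - κ₂) * (t - a)) (∫ s in a..t,
      (1 / κ₁ * (V₁ s * Real.sin (θ₁ s) ^ 2) - 1 / κ₂ * (V₂ s * Real.sin (θ₂ s) ^ 2)))
    have e8 := abs_add_le (θ₁ a - θ₂ a) ((κ₁ - κ₂) * (t - a))
    linarith
  have hpos : 0 ≤ |θ₁ a - θ₂ a| + |κ₁ - κ₂| * (T - a)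
      + ∫ s in a..T, |V₁ s / κ₁ - V₂ s / κ₂| := by
    have : 0 ≤ ∫ s in a..T, |V₁ s / κ₁ - V₂ s / κ₂| :=
      intervalIntegral.integral_nonneg (hat.trans htT) fun s _ => abs_nonneg _
    have : 0 ≤ |κ₁ - κ₂| * (T - a) := mul_nonneg (abs_nonneg _) (by linarith)
    positivity
  refine (le_mul_exp_of_le_add_integral hD (by positivity) hmain t ⟨hat, htT⟩).trans ?_
  refine mul_le_mul_of_nonneg_left (Real.exp_le_exp.2 ?_) hpos
  exact mul_le_mul_of_nonneg_left (by linarith) (by positivity)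

/-! ### The circle-valued phase: non-anticipation and continuity in the potential. -/

/-- The unimodular function `e^{2 i θ_t(κ)}`. -/
noncomputable def circlePhase (V : ℝ → ℝ) (κ t : ℝ) : ℂ :=
  Complex.exp (2 * Complex.I * (phase V κ t : ℂ))

theorem norm_cexp_two_I_mul (x : ℝ) : ‖Complex.exp (2 * Complex.I * (x : ℂ))‖ = 1 := by
  have : 2 * Complex.I * (x : ℂ) = ((2 * x : ℝ) : ℂ) * Complex.I := by push_cast; ring
  rw [this, Complex.norm_exp_ofReal_mul_I]

theorem norm_circlePhase (V : ℝ → ℝ) (κ t : ℝ) : ‖circlePhase V κ t‖ = 1 :=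
  norm_cexp_two_I_mul _

theorem J_eq_integral_circlePhase (V : ℝ → ℝ) (κ : ℝ) {a t : ℝ} (ha : 0 ≤ a) (hat : a ≤ t) :
    J V a t κ = ∫ s in a..t, circlePhase V κ s * (V s : ℂ) := by
  rw [J]
  refine intervalIntegral.integral_congr fun s hs => ?_
  rw [uIcc_of_le hat] at hs
  simp only [circlePhase, phase_of_nonneg V κ (ha.trans hs.1)]

/-- Non-anticipation, the source of adaptedness: with half-open `[0, n)` the phase at the integer
`n` sees only amplitudes of index below `n`. -/
theorem phase_congr {V₁ V₂ : ℝ → ℝ} {B : ℝ} (hV₁ : Measurable V₁) (hV₂ : Measurable V₂)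
    (hB₁ : ∀ s, |V₁ s| ≤ B) (hB₂ : ∀ s, |V₂ s| ≤ B) {κ : ℝ} (hκ : 0 < κ) {t : ℝ} (ht : 0 ≤ t)
    (h : ∀ s ∈ Ico 0 t, V₁ s = V₂ s) : phase V₁ κ t = phase V₂ κ t := by
  have h₁ := solvesPhaseEquation_phase hV₁ hB₁ hκ
  have h₂ := solvesPhaseEquation_phase hV₂ hB₂ hκ
  have h0 : ∀ s ∈ Icc 0 t, |phase V₁ κ s - phase V₂ κ s| = 0 := by
    intro s hs
    have hle := h₁.abs_sub_le hV₁ hV₂ hB₁ hB₂ hκ h₂ le_rfl hs.1 le_rfl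
    have e : ∫ u in (0 : ℝ)..s, |V₁ u / κ - V₂ u / κ| = 0 := by
      have hne : ∀ᵐ u ∂(volume : Measure ℝ), u ≠ t := by
        simp [ae_iff]
      rw [intervalIntegral.integral_congr_ae (g := fun _ => (0 : ℝ))]
      · simp
      · filter_upwards [hne] with u hu hus
        rw [uIoc_of_le hs.1] at hus
        rw [h u ⟨hus.1.le, lt_of_le_of_ne (hus.2.trans hs.2) hu⟩]
        simp
    rw [e, h₁.2 0 le_rfl, h₂.2 0 le_rfl] at hle
    simp only [intervalIntegral.integral_same, sub_self, abs_zero, zero_mul, mul_zero,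
      add_zero] at hle
    exact le_antisymm hle (abs_nonneg _)
  exact sub_eq_zero.1 (abs_eq_zero.1 (h0 t ⟨ht, le_rfl⟩))

section Continuity

variable {X : Type*} [TopologicalSpace X] [FirstCountableTopology X]

/-- Stability bounds the change of phase by an `L¹` distance of potentials, which tends to zero by
dominated convergence. The parameter will be the amplitude sequence, and continuity is the route to
measurability in the randomness. -/
theorem continuous_phase_family {V : X → ℝ → ℝ} {B : ℝ} (hV : ∀ x, Measurable (V x))
    (hB : ∀ x s, |V x s| ≤ B) (hc : ∀ s, Continuous fun x => V x s) {κ : ℝ} (hκ : 0 < κ)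
    {t : ℝ} (ht : 0 ≤ t) : Continuous fun x => phase (V x) κ t := by
  rw [continuous_iff_continuousAt]
  intro x₀
  have hsol := fun x => solvesPhaseEquation_phase (hV x) (hB x) hκ
  have hint : Continuous fun x => ∫ s in (0 : ℝ)..t, |V x s / κ - V x₀ s / κ| := by
    refine intervalIntegral.continuous_of_dominated_interval (bound := fun _ => B / κ + B / κ)
      (fun x => ?_) (fun x => Filter.Eventually.of_forall fun s _ => ?_)
      intervalIntegrable_const (Filter.Eventually.of_forall fun s _ => ?_)
    · exact (((hV x).div_const κ).sub ((hV x₀).div_const κ)).norm.aestronglyMeasurable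
    · rw [Real.norm_eq_abs, abs_abs]
      refine (abs_sub _ _).trans (add_le_add ?_ ?_) <;>
      · rw [abs_div, abs_of_pos hκ]
        gcongr
        exact hB _ _
    · exact (((hc s).div_const κ).sub continuous_const).abs
  have hbd : ∀ x, dist (phase (V x) κ t) (phase (V x₀) κ t)
      ≤ (∫ s in (0 : ℝ)..t, |V x s / κ - V x₀ s / κ|) * Real.exp (B / κ * t) := by
    intro x
    have h := (hsol x).abs_sub_le (hV x) (hV x₀) (hB x) (hB x₀) hκ (hsol x₀) le_rfl ht le_rfl
    rw [(hsol x).2 0 le_rfl, (hsol x₀).2 0 le_rfl] at h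
    simpa [Real.dist_eq] using h
  refine tendsto_iff_dist_tendsto_zero.2 (squeeze_zero (fun _ => dist_nonneg) hbd ?_)
  have h := (hint.mul_const (Real.exp (B / κ * t))).tendsto x₀
  simpa using h

theorem continuous_circlePhase_family {V : X → ℝ → ℝ} {B : ℝ} (hV : ∀ x, Measurable (V x))
    (hB : ∀ x s, |V x s| ≤ B) (hc : ∀ s, Continuous fun x => V x s) {κ : ℝ} (hκ : 0 < κ)
    {t : ℝ} (ht : 0 ≤ t) : Continuous fun x => circlePhase (V x) κ t :=
  Complex.continuous_exp.comp (continuous_const.mul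
    (Complex.continuous_ofReal.comp (continuous_phase_family hV hB hc hκ ht)))

theorem continuous_circlePhase {V : ℝ → ℝ} {B : ℝ} (hV : Measurable V)
    (hB : ∀ s, |V s| ≤ B) {κ : ℝ} (hκ : 0 < κ) : Continuous (circlePhase V κ) :=
  Complex.continuous_exp.comp (continuous_const.mul
    (Complex.continuous_ofReal.comp (solvesPhaseEquation_phase hV hB hκ).1))

theorem norm_circlePhase_mul_le {V : ℝ → ℝ} {B : ℝ} (hB : ∀ s, |V s| ≤ B) (κ s : ℝ) :
    ‖circlePhase V κ s * (V s : ℂ)‖ ≤ B := by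
  rw [norm_mul, norm_circlePhase, one_mul, Complex.norm_real]
  exact hB s

theorem intervalIntegrable_circlePhase_mul {V : ℝ → ℝ} {B : ℝ} (hV : Measurable V)
    (hB : ∀ s, |V s| ≤ B) {κ : ℝ} (hκ : 0 < κ) (a b : ℝ) :
    IntervalIntegrable (fun s => circlePhase V κ s * (V s : ℂ)) volume a b :=
  intervalIntegrable_of_bound ((continuous_circlePhase hV hB hκ).measurable.mul
    (Complex.measurable_ofReal.comp hV)).aestronglyMeasurable (norm_circlePhase_mul_le hB κ) a b

theorem continuous_J_family {V : X → ℝ → ℝ} {B : ℝ} (hV : ∀ x, Measurable (V x))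
    (hB : ∀ x s, |V x s| ≤ B) (hc : ∀ s, Continuous fun x => V x s) {κ : ℝ} (hκ : 0 < κ)
    {a t : ℝ} (ha : 0 ≤ a) (hat : a ≤ t) : Continuous fun x => J (V x) a t κ := by
  simp only [J_eq_integral_circlePhase _ κ ha hat]
  refine intervalIntegral.continuous_of_dominated_interval (bound := fun _ => B)
    (fun x => ?_) (fun x => Filter.Eventually.of_forall fun s _ => norm_circlePhase_mul_le (hB x) κ s)
    intervalIntegrable_const (Filter.Eventually.of_forall fun s hs => ?_)
  · exact ((continuous_circlePhase (hV x) (hB x) hκ).measurable.mul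
      (Complex.measurable_ofReal.comp (hV x))).aestronglyMeasurable
  · rw [uIoc_of_le hat] at hs
    exact (continuous_circlePhase_family hV hB hc hκ (ha.trans hs.1.le)).mul
      (Complex.continuous_ofReal.comp (hc s))

end Continuity

theorem J_sub_J {V : ℝ → ℝ} {B : ℝ} (hV : Measurable V)
    (hB : ∀ s, |V s| ≤ B) {κ : ℝ} (hκ : 0 < κ) {a b t : ℝ} (ha : 0 ≤ a) (hab : a ≤ b)
    (hbt : b ≤ t) : J V a t κ = J V a b κ + J V b t κ := by
  have hi := intervalIntegrable_circlePhase_mul hV hB hκ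
  rw [J_eq_integral_circlePhase V κ ha (hab.trans hbt), J_eq_integral_circlePhase V κ ha hab,
    J_eq_integral_circlePhase V κ (ha.trans hab) hbt,
    intervalIntegral.integral_add_adjacent_intervals (hi _ _) (hi _ _)]

/-! ### Replacing the potential by an everywhere bounded measurable representative. -/

/-- The potential equal to `A n * f (s - n)` on `[n, n + 1)`. -/
noncomputable def stepPotential (f : ℝ → ℝ) (A : ℕ → ℝ) (s : ℝ) : ℝ :=
  A ⌊s⌋₊ * f (s - ⌊s⌋₊)

theorem measurable_stepPotential {f : ℝ → ℝ} (hf : Measurable f) (A : ℕ → ℝ) :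
    Measurable (stepPotential f A) :=
  ((measurable_from_nat (f := A)).comp Nat.measurable_floor).mul
    (hf.comp (measurable_id.sub ((measurable_from_nat (f := fun n : ℕ => (n : ℝ))).comp
      Nat.measurable_floor)))

theorem abs_stepPotential_le {f : ℝ → ℝ} {K : ℝ} (hf : ∀ s, |f s| ≤ K) {A : ℕ → ℝ}
    (hA : ∀ n, |A n| ≤ 1) (s : ℝ) : |stepPotential f A s| ≤ K := by
  rw [stepPotential, abs_mul]
  calc |A ⌊s⌋₊| * |f (s - ⌊s⌋₊)| ≤ 1 * K :=
        mul_le_mul (hA _) (hf _) (abs_nonneg _) zero_le_one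
    _ = K := one_mul K

theorem stepPotential_of_mem_Ico {f : ℝ → ℝ} {A : ℕ → ℝ} {n : ℕ} {s : ℝ}
    (hs : s ∈ Ico (n : ℝ) (n + 1)) : stepPotential f A s = A n * f (s - n) := by
  have : ⌊s⌋₊ = n := (Nat.floor_eq_iff ((Nat.cast_nonneg n).trans hs.1)).2 hs
  rw [stepPotential, this]

/-- The amplitudes `w(n) n^{-α}`, with value `0` at `n = 0`. -/
noncomputable def amplitude (α : ℝ) (w : ℕ+ → ℝ) (n : ℕ) : ℝ :=
  if h : 0 < n then w ⟨n, h⟩ / (n : ℝ) ^ α else 0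

theorem continuous_amplitude (α : ℝ) (n : ℕ) : Continuous fun w => amplitude α w n := by
  unfold amplitude
  split_ifs with h
  · exact (continuous_apply _).div_const _
  · exact continuous_const

/-- Off the integers only the term `j = ⌊s⌋` of the series survives, and none on `(0, 1)`; two terms
can overlap only at integers. Countably many translates of the null set where `f ≠ g` are discarded
as well. -/
theorem potential_ae_eq_stepPotential (α : ℝ) {f g : ℝ → ℝ}
    (hsupp : Function.support f ⊆ Icc 0 1) (hfg : f =ᵐ[volume] g) (w : ℕ+ → ℝ) :
    ∀ᵐ s ∂(volume : Measure ℝ), 0 ≤ s → potential α f w s = stepPotential g (amplitude α w) s := by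
  have h1 : ∀ᵐ s ∂(volume : Measure ℝ), ∀ n : ℕ, s ≠ (n : ℝ) := by
    rw [ae_all_iff]; intro n; simp [ae_iff]
  have h2 : ∀ᵐ s ∂(volume : Measure ℝ), ∀ n : ℕ, f (s - n) = g (s - n) := by
    rw [ae_all_iff]; intro n
    exact (measurePreserving_sub_right volume (n : ℝ)).quasiMeasurePreserving.ae hfg
  filter_upwards [h1, h2] with s hs1 hs2 hs
  have hfl : (⌊s⌋₊ : ℝ) < s := lt_of_le_of_ne (Nat.floor_le hs) (Ne.symm (hs1 _))
  have hfl' := Nat.lt_floor_add_one s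
  have hzero : ∀ j : ℕ+, (j : ℕ) ≠ ⌊s⌋₊ → f (s - ((j : ℕ) : ℝ)) = 0 := by
    intro j hj
    by_contra hne
    have hmem := hsupp (Function.mem_support.2 hne)
    apply hj
    have ha : ((j : ℕ) : ℝ) < (⌊s⌋₊ : ℝ) + 1 := by linarith [hmem.1]
    have hb : (⌊s⌋₊ : ℝ) < (j : ℕ) + 1 := by linarith [hmem.2]
    have ha' : (j : ℕ) < ⌊s⌋₊ + 1 := by exact_mod_cast ha
    have hb' : ⌊s⌋₊ < (j : ℕ) + 1 := by exact_mod_cast hb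
    omega
  rw [potential, stepPotential, amplitude]
  split_ifs with h
  · rw [tsum_eq_single ⟨⌊s⌋₊, h⟩]
    · simp [hs2]
    · intro j hj
      rw [hzero j (fun hj' => hj (PNat.eq hj')), mul_zero]
  · rw [zero_mul]
    have : ∀ j : ℕ+, w j / (j : ℝ) ^ α * f (s - (j : ℝ)) = 0 := by
      intro j
      rw [hzero j (by have := j.pos; omega), mul_zero]
    simp [this]

theorem exists_measurable_bounded_ae_eq {f : ℝ → ℝ} (hf : MemLp f ⊤ (volume : Measure ℝ)) :
    ∃ g : ℝ → ℝ, ∃ K : ℝ, 0 < K ∧ Measurable g ∧ (∀ s, |g s| ≤ K) ∧ f =ᵐ[volume] g := by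
  set K := (eLpNormEssSup f (volume : Measure ℝ)).toReal + 1 with hK
  have hK0 : 0 < K := by positivity
  have hm := hf.1.aemeasurable
  have hbd : ∀ᵐ s ∂(volume : Measure ℝ), |f s| ≤ K := by
    have hne : eLpNormEssSup f (volume : Measure ℝ) ≠ ⊤ := by
      have := hf.2.ne
      rwa [eLpNorm_exponent_top] at this
    filter_upwards [ae_le_eLpNormEssSup (f := f) (μ := (volume : Measure ℝ))] with s hs
    have := ENNReal.toReal_mono hne hs
    rw [toReal_enorm, Real.norm_eq_abs] at this
    linarith
  refine ⟨fun s => max (-K) (min K (hm.mk f s)), K, hK0,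
    measurable_const.max (measurable_const.min hm.measurable_mk), fun s => ?_, ?_⟩
  · rw [abs_le]
    exact ⟨le_max_left _ _, max_le (by linarith) (min_le_left _ _)⟩
  · filter_upwards [hm.ae_eq_mk, hbd] with s h1 h2
    rw [← h1, min_eq_right (abs_le.1 h2).2, max_eq_right (abs_le.1 h2).1]

/-! ### Comparison of the phases at two energies. -/

/-- The interpolation that trades the linear growth `t |κ₁ - κ₂|` for `t^η |κ₁ - κ₂|^η`, leaving a
power of `t` that the decay can absorb. -/
theorem min_one_le_rpow {x η : ℝ} (hx : 0 ≤ x) (hη : 0 < η) (hη1 : η ≤ 1) : min 1 x ≤ x ^ η := by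
  rcases le_total 1 x with h | h
  · rw [min_eq_left h]; exact Real.one_le_rpow h hη.le
  · rw [min_eq_right h]
    rcases hx.eq_or_lt with rfl | hx0
    · rw [Real.zero_rpow hη.ne']
    · calc x = x ^ (1 : ℝ) := (Real.rpow_one x).symm
        _ ≤ x ^ η := Real.rpow_le_rpow_of_exponent_ge hx0 h hη1

theorem norm_cexp_sub_cexp_le (x y : ℝ) :
    ‖Complex.exp (2 * Complex.I * (x : ℂ)) - Complex.exp (2 * Complex.I * (y : ℂ))‖
      ≤ 2 * |x - y| := by
  have h : Complex.exp (2 * Complex.I * (x : ℂ)) - Complex.exp (2 * Complex.I * (y : ℂ))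
      = Complex.exp (2 * Complex.I * (y : ℂ))
        * (Complex.exp (Complex.I * ((2 * (x - y) : ℝ) : ℂ)) - 1) := by
    rw [mul_sub, ← Complex.exp_add, mul_one]
    congr 2
    push_cast; ring
  rw [h, norm_mul, norm_cexp_two_I_mul, one_mul]
  refine Real.norm_exp_I_mul_ofReal_sub_one_le.trans ?_
  rw [Real.norm_eq_abs, abs_mul, abs_of_pos (by norm_num : (0 : ℝ) < 2)]

theorem norm_cexp_sub_cexp_le_min (x y : ℝ) :
    ‖Complex.exp (2 * Complex.I * (x : ℂ)) - Complex.exp (2 * Complex.I * (y : ℂ))‖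
      ≤ 2 * min 1 |x - y| := by
  rcases le_total 1 |x - y| with h | h
  · rw [min_eq_left h]
    refine (norm_sub_le _ _).trans ?_
    rw [norm_cexp_two_I_mul, norm_cexp_two_I_mul]; norm_num
  · rw [min_eq_right h]; exact norm_cexp_sub_cexp_le x y

theorem sin_sq_eq_re (x : ℝ) :
    Real.sin x ^ 2 = 1 / 2 - (Complex.exp (2 * Complex.I * (x : ℂ))).re / 2 := by
  have : 2 * Complex.I * (x : ℂ) = ((2 * x : ℝ) : ℂ) * Complex.I := by push_cast; ring
  rw [this, Complex.exp_ofReal_mul_I_re, Real.sin_sq_eq_half_sub]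

theorem abs_one_div_sub_le {κ₁ κ₂ κmin : ℝ} (h0 : 0 < κmin) (h₁ : κmin ≤ κ₁) (h₂ : κmin ≤ κ₂) :
    |1 / κ₁ - 1 / κ₂| ≤ |κ₁ - κ₂| / κmin ^ 2 := by
  have p₁ := h0.trans_le h₁
  have p₂ := h0.trans_le h₂
  have : 1 / κ₁ - 1 / κ₂ = (κ₂ - κ₁) / (κ₁ * κ₂) := by field_simp
  rw [this, abs_div, abs_sub_comm, abs_of_pos (by positivity : 0 < κ₁ * κ₂), sq]
  gcongr

theorem abs_one_div_sub_le' {κ₁ κ₂ κmin : ℝ} (h0 : 0 < κmin) (h₁ : κmin ≤ κ₁) (h₂ : κmin ≤ κ₂) :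
    |1 / κ₁ - 1 / κ₂| ≤ 1 / κmin := by
  have p₁ := h0.trans_le h₁
  have p₂ := h0.trans_le h₂
  have a₁ : 1 / κ₁ ≤ 1 / κmin := by gcongr
  have a₂ : 1 / κ₂ ≤ 1 / κmin := by gcongr
  have b₁ : 0 < 1 / κ₁ := by positivity
  have b₂ : 0 < 1 / κ₂ := by positivity
  rw [abs_le]; constructor <;> linarith

theorem abs_one_div_sub_le_rpow {κ₁ κ₂ κmin η : ℝ} (h0 : 0 < κmin) (h₁ : κmin ≤ κ₁)
    (h₂ : κmin ≤ κ₂) (hη : 0 < η) (hη1 : η ≤ 1) :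
    |1 / κ₁ - 1 / κ₂| ≤ (1 / κmin + 1 / κmin ^ 2) * |κ₁ - κ₂| ^ η := by
  refine le_trans ?_ (mul_le_mul_of_nonneg_left (min_one_le_rpow (abs_nonneg (κ₁ - κ₂)) hη hη1)
    (by positivity))
  have e1 : 0 < 1 / κmin := by positivity
  have e2 : 0 < 1 / κmin ^ 2 := by positivity
  have e3 := abs_nonneg (κ₁ - κ₂)
  rcases le_total 1 |κ₁ - κ₂| with h | h
  · rw [min_eq_left h]
    have := abs_one_div_sub_le' h0 h₁ h₂
    linarith
  · rw [min_eq_right h]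
    refine (abs_one_div_sub_le h0 h₁ h₂).trans ?_
    rw [div_eq_mul_one_div]
    nlinarith

/-- From `sin² θ = (1 - Re e^{2iθ})/2`. The first term on the right is independent of the energy and
drops out when two energies are compared. -/
theorem integral_mul_sin_sq_eq {V : ℝ → ℝ} {B : ℝ} (hV : Measurable V)
    (hB : ∀ s, |V s| ≤ B) {κ : ℝ} (hκ : 0 < κ) {t : ℝ} (ht : 0 ≤ t) :
    ∫ s in (0 : ℝ)..t, V s * Real.sin (phase V κ s) ^ 2
      = (∫ s in (0 : ℝ)..t, V s) / 2 - (J V 0 t κ).re / 2 := by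
  have hi := intervalIntegrable_circlePhase_mul hV hB hκ 0 t
  have hVi := intervalIntegrable_of_bound hV.aestronglyMeasurable hB 0 t
  have h := Complex.reCLM.intervalIntegral_comp_comm hi
  simp only [Complex.reCLM_apply] at h
  rw [J_eq_integral_circlePhase V κ le_rfl ht, ← h, ← sub_div, ← intervalIntegral.integral_sub hVi
    (Complex.reCLM.integrable_comp hi.1 |>.congr ?_ |> fun h1 => ⟨h1, ?_⟩),
    ← intervalIntegral.integral_div]
  · refine intervalIntegral.integral_congr fun s _ => ?_
    simp only [circlePhase, Complex.mul_re, Complex.ofReal_re, Complex.ofReal_im, mul_zero,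
      sub_zero]
    rw [sin_sq_eq_re]; ring
  · exact Filter.EventuallyEq.rfl
  · exact (Complex.reCLM.integrable_comp hi.2).congr Filter.EventuallyEq.rfl

theorem abs_integral_mul_sin_sq_le {V : ℝ → ℝ} {B : ℝ} (hB : ∀ s, |V s| ≤ B) (θ : ℝ → ℝ) {t : ℝ}
    (ht : 0 ≤ t) : |∫ s in (0 : ℝ)..t, V s * Real.sin (θ s) ^ 2| ≤ B * t := by
  have := intervalIntegral.norm_integral_le_of_norm_le_const (a := 0) (b := t)
    (fun s _ => norm_mul_sin_sq_le hB θ s)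
  rwa [sub_zero, abs_of_nonneg ht, Real.norm_eq_abs] at this

/-- This closes the loop: the phase difference is controlled by the difference of `J` itself. The
crude bound `B t` on one integral is harmless, because it is multiplied by `1/κ₁ - 1/κ₂` and so has
the size of the free term. -/
theorem abs_phase_sub_le {V : ℝ → ℝ} {B : ℝ} (hV : Measurable V)
    (hB : ∀ s, |V s| ≤ B) {κ₁ κ₂ κmin : ℝ} (h0 : 0 < κmin) (h₁ : κmin ≤ κ₁) (h₂ : κmin ≤ κ₂)
    {t : ℝ} (ht : 0 ≤ t) :
    |phase V κ₁ t - phase V κ₂ t| ≤ (1 + B / κmin ^ 2) * (t * |κ₁ - κ₂|)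
      + 1 / κmin * ‖J V 0 t κ₁ - J V 0 t κ₂‖ := by
  have p₁ := h0.trans_le h₁
  have p₂ := h0.trans_le h₂
  have hB0 : 0 ≤ B := (abs_nonneg _).trans (hB 0)
  have e₁ := (solvesPhaseEquation_phase hV hB p₁).2 t ht
  have e₂ := (solvesPhaseEquation_phase hV hB p₂).2 t ht
  have i₁ := integral_mul_sin_sq_eq hV hB p₁ ht
  have i₂ := integral_mul_sin_sq_eq hV hB p₂ ht
  have b₁ := abs_integral_mul_sin_sq_le hB (phase V κ₁) ht
  set S₁ := ∫ s in (0 : ℝ)..t, V s * Real.sin (phase V κ₁ s) ^ 2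
  set S₂ := ∫ s in (0 : ℝ)..t, V s * Real.sin (phase V κ₂ s) ^ 2
  have e : phase V κ₁ t - phase V κ₂ t = (κ₁ - κ₂) * t - (1 / κ₁ - 1 / κ₂) * S₁
      + 1 / κ₂ * (S₂ - S₁) := by rw [e₁, e₂]; ring
  have hS : S₂ - S₁ = (J V 0 t κ₁ - J V 0 t κ₂).re / 2 := by
    rw [i₁, i₂, Complex.sub_re]; ring
  have hS' : |S₂ - S₁| ≤ ‖J V 0 t κ₁ - J V 0 t κ₂‖ := by
    rw [hS, abs_div, abs_of_pos (by norm_num : (0 : ℝ) < 2)]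
    have := Complex.abs_re_le_norm (J V 0 t κ₁ - J V 0 t κ₂)
    have := norm_nonneg (J V 0 t κ₁ - J V 0 t κ₂)
    linarith
  have t1 : |(κ₁ - κ₂) * t| = t * |κ₁ - κ₂| := by rw [abs_mul, abs_of_nonneg ht, mul_comm]
  have t2 : |(1 / κ₁ - 1 / κ₂) * S₁| ≤ |κ₁ - κ₂| / κmin ^ 2 * (B * t) := by
    rw [abs_mul]
    exact mul_le_mul (abs_one_div_sub_le h0 h₁ h₂) b₁ (abs_nonneg _) (by positivity)
  have t3 : |1 / κ₂ * (S₂ - S₁)| ≤ 1 / κmin * ‖J V 0 t κ₁ - J V 0 t κ₂‖ := by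
    rw [abs_mul, abs_of_pos (by positivity : 0 < 1 / κ₂)]
    gcongr
  rw [e]
  refine (abs_add_le _ _).trans (add_le_add ((abs_sub _ _).trans ?_) t3)
  rw [t1]
  refine (add_le_add_right t2 _).trans (le_of_eq ?_)
  ring

/-- Local control of the difference of `e^{2 i θ}` at two energies by its value at the left end of
a unit interval. -/
theorem exists_norm_circlePhase_sub_le (B κmin : ℝ) (hB0 : 0 ≤ B) (h0 : 0 < κmin) :
    ∃ C : ℝ, 1 ≤ C ∧ ∀ V : ℝ → ℝ, Measurable V → (∀ s, |V s| ≤ B) →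
      ∀ κ₁ κ₂ : ℝ, κmin ≤ κ₁ → κmin ≤ κ₂ → ∀ η : ℝ, 0 < η → η ≤ 1 → ∀ j : ℕ,
        ∀ s ∈ Icc (j : ℝ) (j + 1), ‖circlePhase V κ₁ s - circlePhase V κ₂ s‖
          ≤ C * (((j : ℝ) + 1) ^ η * (|κ₁ - κ₂| ^ η + ‖J V 0 j κ₁ - J V 0 j κ₂‖)) := by
  set c₁ : ℝ := (1 + B / κmin ^ 2) with hc₁
  set c₂ : ℝ := Real.exp (B / κmin) with hc₂
  have p1 : 0 < c₁ := by positivity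
  have p2 : 0 < c₂ := Real.exp_pos _
  have p3 : 0 < 1 / κmin := by positivity
  set C₀ : ℝ := 1 + (c₁ + 1 / κmin) * c₂ with hC₀
  have hC₀1 : 1 ≤ C₀ := by
    have : 0 < (c₁ + 1 / κmin) * c₂ := by positivity
    linarith
  refine ⟨2 * C₀, by linarith, ?_⟩
  intro V hV hB κ₁ κ₂ h₁ h₂ η hη hη1 j s hs
  have q₁ := h0.trans_le h₁
  have q₂ := h0.trans_le h₂
  have hj : (0 : ℝ) ≤ j := Nat.cast_nonneg j
  set Y := ‖J V 0 j κ₁ - J V 0 j κ₂‖ with hY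
  have hY0 : 0 ≤ Y := norm_nonneg _
  set d := |κ₁ - κ₂| with hd
  have hd0 : 0 ≤ d := abs_nonneg _
  have hloc := (solvesPhaseEquation_phase hV hB q₁).abs_sub_le hV hV hB hB q₂
    (solvesPhaseEquation_phase hV hB q₂) hj hs.1 hs.2
  have hint : ∫ s in (j : ℝ)..(j + 1), |V s / κ₁ - V s / κ₂| ≤ B / κmin ^ 2 * d := by
    have h := intervalIntegral.norm_integral_le_of_norm_le_const (a := (j : ℝ)) (b := j + 1)
      (f := fun s => |V s / κ₁ - V s / κ₂|) (C := B / κmin ^ 2 * d) fun s _ => by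
        rw [Real.norm_eq_abs, abs_abs]
        have : V s / κ₁ - V s / κ₂ = V s * (1 / κ₁ - 1 / κ₂) := by ring
        rw [this, abs_mul]
        refine (mul_le_mul (hB s) (abs_one_div_sub_le h0 h₁ h₂) (abs_nonneg _) hB0).trans
          (le_of_eq ?_)
        ring
    have h' := (le_abs_self _).trans h
    simpa using h'
  have hstart := abs_phase_sub_le hV hB h0 h₁ h₂ hj
  have hexp : Real.exp (B / κ₂ * ((j : ℝ) + 1 - j)) ≤ c₂ := by
    rw [hc₂, add_sub_cancel_left, mul_one]
    exact Real.exp_le_exp.2 (by gcongr)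
  have hphase : |phase V κ₁ s - phase V κ₂ s| ≤ C₀ * ((j + 1) * d + Y) := by
    have a1 : |phase V κ₁ j - phase V κ₂ j| + d * ((j : ℝ) + 1 - j)
        + ∫ s in (j : ℝ)..(j + 1), |V s / κ₁ - V s / κ₂| ≤ (c₁ + 1 / κmin) * ((j + 1) * d + Y) := by
      have : 0 ≤ 1 / κmin * ((j + 1) * d) := by positivity
      have : 0 ≤ c₁ * Y := by positivity
      have e : (c₁ + 1 / κmin) * ((j + 1) * d + Y) = c₁ * (j * d) + (d + B / κmin ^ 2 * d)
          + 1 / κmin * Y + 1 / κmin * ((j + 1) * d) + c₁ * Y := by rw [hc₁]; ring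
      rw [e]
      have e' : d * ((j : ℝ) + 1 - j) = d := by ring
      rw [e']
      linarith
    refine hloc.trans ?_
    calc _ ≤ (c₁ + 1 / κmin) * ((j + 1) * d + Y) * c₂ :=
          mul_le_mul a1 hexp (Real.exp_pos _).le (by positivity)
      _ = ((c₁ + 1 / κmin) * c₂) * ((j + 1) * d + Y) := by ring
      _ ≤ C₀ * ((j + 1) * d + Y) := by
          refine mul_le_mul_of_nonneg_right (by rw [hC₀]; linarith) (by positivity)
  -- Only the energy term is interpolated; `Y` stays linear, as the moment recursion requires.
  have hmin : min 1 |phase V κ₁ s - phase V κ₂ s| ≤ C₀ * (((j + 1) * d) ^ η + Y) := by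
    have hx : 0 ≤ (j + 1) * d := by positivity
    have hx' := min_one_le_rpow hx hη hη1
    have hr : 0 ≤ ((j + 1) * d) ^ η := Real.rpow_nonneg hx _
    rcases le_total 1 ((j + 1) * d) with h | h
    · rw [min_eq_left h] at hx'
      refine (min_le_left _ _).trans ?_
      nlinarith
    · rw [min_eq_right h] at hx'
      refine (min_le_right _ _).trans (hphase.trans ?_)
      gcongr
  refine (norm_cexp_sub_cexp_le_min _ _).trans ?_
  rw [mul_assoc 2 C₀]
  refine mul_le_mul_of_nonneg_left (hmin.trans ?_) (by norm_num)
  refine mul_le_mul_of_nonneg_left ?_ (by linarith)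
  rw [Real.mul_rpow (by positivity) hd0, mul_add]
  have : 1 ≤ ((j : ℝ) + 1) ^ η := Real.one_le_rpow (by linarith) hη.le
  gcongr
  exact le_mul_of_one_le_left hY0 this

/-! ### Expansion of `J` over one unit interval. -/

/-- The coefficient of the amplitude in the first-order expansion of `J` over a unit interval. -/
noncomputable def unitCoefficient (g : ℝ → ℝ) (V : ℝ → ℝ) (κ : ℝ) (j : ℕ) : ℂ :=
  circlePhase V κ j * ∫ s in (0 : ℝ)..1, Complex.exp (2 * Complex.I * ((κ * s : ℝ) : ℂ)) * (g s : ℂ)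

theorem ae_abs_stepPotential_le {g : ℝ → ℝ} {K : ℝ} (hg : ∀ s, |g s| ≤ K) (A : ℕ → ℝ) (j : ℕ)
    {t : ℝ} (hjt : (j : ℝ) ≤ t) (ht : t ≤ j + 1) :
    ∀ᵐ s ∂(volume : Measure ℝ), s ∈ uIoc (j : ℝ) t → stepPotential g A s = A j * g (s - j)
      ∧ |stepPotential g A s| ≤ |A j| * K := by
  have hne : ∀ᵐ u ∂(volume : Measure ℝ), u ≠ (j : ℝ) + 1 := by simp [ae_iff]
  filter_upwards [hne] with s hs hst
  rw [uIoc_of_le hjt] at hst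
  have := stepPotential_of_mem_Ico (f := g) (A := A)
    ⟨hst.1.le, lt_of_le_of_ne (hst.2.trans ht) hs⟩
  refine ⟨this, ?_⟩
  rw [this, abs_mul]
  exact mul_le_mul_of_nonneg_left (hg _) (abs_nonneg _)

section Increment

variable {g : ℝ → ℝ} {K : ℝ} (hgm : Measurable g) (hg : ∀ s, |g s| ≤ K) {A : ℕ → ℝ}
  (hA : ∀ n, |A n| ≤ 1) {κ₁ κ₂ κmin η : ℝ} (h0 : 0 < κmin) (h₁ : κmin ≤ κ₁) (h₂ : κmin ≤ κ₂)
  (hη : 0 < η) (hη1 : η ≤ 1) {j : ℕ} {G : ℝ}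
  (hG : ∀ s ∈ Icc (j : ℝ) (j + 1), ‖circlePhase (stepPotential g A) κ₁ s
    - circlePhase (stepPotential g A) κ₂ s‖ ≤ G) (hδ : |κ₁ - κ₂| ^ η ≤ G)

include hgm hg hA h0 h₁ h₂ hG in
-- A zeroth-order bound without cancellation. It is needed for the last, incomplete interval when
-- the supremum runs over real times.
theorem norm_J_unit_sub_le {t : ℝ} (hjt : (j : ℝ) ≤ t) (ht : t ≤ j + 1) :
    ‖J (stepPotential g A) j t κ₁ - J (stepPotential g A) j t κ₂‖ ≤ |A j| * K * G := by
  have hV := measurable_stepPotential hgm A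
  have hB := abs_stepPotential_le hg hA
  have hj : (0 : ℝ) ≤ j := Nat.cast_nonneg j
  rw [J_eq_integral_circlePhase _ _ hj hjt, J_eq_integral_circlePhase _ _ hj hjt,
    ← intervalIntegral.integral_sub
      (intervalIntegrable_circlePhase_mul hV hB (h0.trans_le h₁) _ _)
      (intervalIntegrable_circlePhase_mul hV hB (h0.trans_le h₂) _ _)]
  have hG0 : 0 ≤ G := (norm_nonneg _).trans (hG j ⟨le_rfl, by linarith⟩)
  have hK0 : 0 ≤ K := (abs_nonneg _).trans (hg 0)
  refine (intervalIntegral.norm_integral_le_of_norm_le_const_ae (C := |A j| * K * G) ?_).trans ?_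
  · filter_upwards [ae_abs_stepPotential_le hg A j hjt ht] with s hs hst
    have h3 := (hs hst).2
    rw [uIoc_of_le hjt] at hst
    rw [← sub_mul, norm_mul, Complex.norm_real, Real.norm_eq_abs, mul_comm]
    exact mul_le_mul h3 (hG s ⟨hst.1.le, hst.2.trans ht⟩) (norm_nonneg _) (by positivity)
  · rw [abs_of_nonneg (by linarith : 0 ≤ t - j)]
    exact mul_le_of_le_one_right (by positivity) (by linarith)

theorem norm_cexp_energy_sub_le {κ₁ κ₂ η : ℝ} (hη : 0 < η) (hη1 : η ≤ 1) {s : ℝ}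
    (hs : s ∈ Icc (0 : ℝ) 1) :
    ‖Complex.exp (2 * Complex.I * ((κ₁ * s : ℝ) : ℂ))
      - Complex.exp (2 * Complex.I * ((κ₂ * s : ℝ) : ℂ))‖ ≤ 2 * |κ₁ - κ₂| ^ η := by
  refine (norm_cexp_sub_cexp_le_min _ _).trans (mul_le_mul_of_nonneg_left ?_ (by norm_num))
  refine le_trans ?_ (min_one_le_rpow (abs_nonneg _) hη hη1)
  refine min_le_min_left _ ?_
  rw [← sub_mul, abs_mul, abs_of_nonneg hs.1]
  exact mul_le_of_le_one_right (abs_nonneg _) hs.2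

theorem intervalIntegrable_cexp_mul {g : ℝ → ℝ} {K : ℝ} (hgm : Measurable g)
    (hg : ∀ s, |g s| ≤ K) (κ a b : ℝ) : IntervalIntegrable
      (fun s => Complex.exp (2 * Complex.I * ((κ * s : ℝ) : ℂ)) * (g s : ℂ)) volume a b :=
  intervalIntegrable_of_bound (B := K) (by fun_prop) (fun s => by
    rw [norm_mul, norm_cexp_two_I_mul, one_mul, Complex.norm_real]; exact hg s) a b

include hgm hg hη hη1 hG hδ in
theorem norm_unitCoefficient_sub_le :
    ‖unitCoefficient g (stepPotential g A) κ₁ j - unitCoefficient g (stepPotential g A) κ₂ j‖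
      ≤ 3 * K * G := by
  have hG0 : 0 ≤ G := (norm_nonneg _).trans (hG j ⟨le_rfl, by linarith⟩)
  have hK0 : 0 ≤ K := (abs_nonneg _).trans (hg 0)
  have hi := intervalIntegrable_cexp_mul hgm hg
  set I : ℝ → ℂ := fun κ =>
    ∫ s in (0 : ℝ)..1, Complex.exp (2 * Complex.I * ((κ * s : ℝ) : ℂ)) * (g s : ℂ) with hI
  have e : unitCoefficient g (stepPotential g A) κ₁ j - unitCoefficient g (stepPotential g A) κ₂ j
      = (circlePhase (stepPotential g A) κ₁ j - circlePhase (stepPotential g A) κ₂ j) * I κ₁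
        + circlePhase (stepPotential g A) κ₂ j * (I κ₁ - I κ₂) := by
    simp only [unitCoefficient, hI]; ring
  have b1 : ‖I κ₁‖ ≤ K := by
    have := intervalIntegral.norm_integral_le_of_norm_le_const (a := 0) (b := 1) (C := K)
      (f := fun s => Complex.exp (2 * Complex.I * ((κ₁ * s : ℝ) : ℂ)) * (g s : ℂ)) fun s _ => by
        rw [norm_mul, norm_cexp_two_I_mul, one_mul, Complex.norm_real]; exact hg s
    simpa [hI] using this
  have b2 : ‖I κ₁ - I κ₂‖ ≤ 2 * G * K := by
    simp only [hI]
    rw [← intervalIntegral.integral_sub (hi _ _ _) (hi _ _ _)]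
    have := intervalIntegral.norm_integral_le_of_norm_le_const (a := 0) (b := 1) (C := 2 * G * K)
      (f := fun s => Complex.exp (2 * Complex.I * ((κ₁ * s : ℝ) : ℂ)) * (g s : ℂ)
        - Complex.exp (2 * Complex.I * ((κ₂ * s : ℝ) : ℂ)) * (g s : ℂ)) fun s hs => by
        rw [uIoc_of_le zero_le_one] at hs
        rw [← sub_mul, norm_mul, Complex.norm_real]
        refine mul_le_mul ?_ (hg s) (norm_nonneg _) (by positivity)
        exact (norm_cexp_energy_sub_le hη hη1 ⟨hs.1.le, hs.2⟩).trans (by linarith)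
    simpa using this
  rw [e]
  refine (norm_add_le _ _).trans ?_
  rw [norm_mul, norm_mul, norm_circlePhase, one_mul]
  have := mul_le_mul (hG j ⟨le_rfl, by linarith⟩) b1 (norm_nonneg _) hG0
  linarith

include hgm hg hA h0 h₁ h₂ hη hη1 hG hδ in
-- One factor `A j` comes from `V` in the integrand, the second from the deviation of the phase from
-- free evolution, and `G` from comparing the two energies. Having all three at once is what makes
-- the remainders summable without using randomness.
theorem norm_J_unit_sub_unitCoefficient_le :
    ‖(J (stepPotential g A) j (j + 1) κ₁ - J (stepPotential g A) j (j + 1) κ₂)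
      - (A j : ℂ) * (unitCoefficient g (stepPotential g A) κ₁ j
        - unitCoefficient g (stepPotential g A) κ₂ j)‖
      ≤ (6 / κmin + 2 * (1 / κmin + 1 / κmin ^ 2) + 2 / κmin) * K ^ 2 * (|A j| ^ 2 * G) := by
  set V := stepPotential g A with hVdef
  have hV : Measurable V := measurable_stepPotential hgm A
  have hB : ∀ s, |V s| ≤ K := abs_stepPotential_le hg hA
  have hj : (0 : ℝ) ≤ j := Nat.cast_nonneg j
  have hj1 : (j : ℝ) ≤ j + 1 := by linarith
  have hG0 : 0 ≤ G := (norm_nonneg _).trans (hG j ⟨le_rfl, by linarith⟩)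
  have hK0 : 0 ≤ K := (abs_nonneg _).trans (hg 0)
  have q₁ := h0.trans_le h₁
  have q₂ := h0.trans_le h₂
  set b := |A j| * K with hb
  have hb0 : 0 ≤ b := by positivity
  -- the main term as an integral over the unit interval
  have hmain : ∀ κ : ℝ, (A j : ℂ) * unitCoefficient g V κ j
      = ∫ s in (j : ℝ)..(j + 1), circlePhase V κ j
        * Complex.exp (2 * Complex.I * ((κ * (s - j) : ℝ) : ℂ)) * (V s : ℂ) := by
    intro κ
    have h1 : ∫ s in (j : ℝ)..(j + 1), circlePhase V κ j
        * Complex.exp (2 * Complex.I * ((κ * (s - j) : ℝ) : ℂ)) * (V s : ℂ)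
        = ∫ s in (j : ℝ)..(j + 1), (A j : ℂ) * (circlePhase V κ j
          * (Complex.exp (2 * Complex.I * ((κ * (s - j) : ℝ) : ℂ)) * (g (s - j) : ℂ))) := by
      refine intervalIntegral.integral_congr_ae ?_
      filter_upwards [ae_abs_stepPotential_le hg A j hj1 le_rfl] with s hs hst
      rw [hVdef, (hs hst).1]; push_cast; ring
    rw [h1, intervalIntegral.integral_const_mul, intervalIntegral.integral_const_mul,
      unitCoefficient, intervalIntegral.integral_comp_sub_right
        (fun s => Complex.exp (2 * Complex.I * ((κ * s : ℝ) : ℂ)) * (g s : ℂ)) (j : ℝ)]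
    simp
  have hmi : ∀ κ : ℝ, IntervalIntegrable (fun s => circlePhase V κ j
        * Complex.exp (2 * Complex.I * ((κ * (s - j) : ℝ) : ℂ)) * (V s : ℂ)) volume j (j + 1) :=
    fun κ => intervalIntegrable_of_bound (B := K) (by fun_prop) (fun s => by
      rw [norm_mul, norm_mul, norm_circlePhase, norm_cexp_two_I_mul, one_mul, one_mul,
        Complex.norm_real]; exact hB s) _ _
  have hJi := fun κ (hκ : 0 < κ) => intervalIntegrable_circlePhase_mul hV hB hκ j (j + 1)
  rw [mul_sub, hmain, hmain, J_eq_integral_circlePhase _ _ hj hj1,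
    J_eq_integral_circlePhase _ _ hj hj1, sub_sub_sub_comm,
    ← intervalIntegral.integral_sub (hJi κ₁ q₁) (hmi κ₁),
    ← intervalIntegral.integral_sub (hJi κ₂ q₂) (hmi κ₂),
    ← intervalIntegral.integral_sub ((hJi κ₁ q₁).sub (hmi κ₁)) ((hJi κ₂ q₂).sub (hmi κ₂))]
  -- the phase increment beyond free evolution
  set φ : ℝ → ℝ → ℝ := fun κ s =>
    -(1 / κ * ∫ u in (j : ℝ)..s, V u * Real.sin (phase V κ u) ^ 2) with hφ
  have hu : ∀ κ, 0 < κ → ∀ s, (j : ℝ) ≤ s → circlePhase V κ s = circlePhase V κ j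
      * Complex.exp (2 * Complex.I * ((κ * (s - j) : ℝ) : ℂ))
      * Complex.exp (2 * Complex.I * (φ κ s : ℂ)) := by
    intro κ hκ s hs
    have h := (solvesPhaseEquation_phase hV hB hκ).sub_eq hV hB hj hs
    have h' : phase V κ s = phase V κ j + κ * (s - j) + φ κ s := by simp only [hφ]; linarith
    rw [circlePhase, circlePhase, h', ← Complex.exp_add, ← Complex.exp_add]
    congr 1; push_cast; ring
  have hS : ∀ κ, ∀ s ∈ Icc (j : ℝ) (j + 1),
      |∫ u in (j : ℝ)..s, V u * Real.sin (phase V κ u) ^ 2| ≤ b := by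
    intro κ s hs
    rw [← Real.norm_eq_abs]
    refine (intervalIntegral.norm_integral_le_of_norm_le_const_ae (C := b) ?_).trans ?_
    · filter_upwards [ae_abs_stepPotential_le hg A j hs.1 hs.2] with u hu hus
      rw [Real.norm_eq_abs, abs_mul]
      calc |V u| * |Real.sin (phase V κ u) ^ 2| ≤ b * 1 :=
            mul_le_mul (hu hus).2 (sin_sq_le_one' _) (abs_nonneg _) hb0
        _ = b := mul_one b
    · rw [abs_of_nonneg (by linarith [hs.1])]
      exact mul_le_of_le_one_right hb0 (by linarith [hs.2])
  have hφ₁ : ∀ s ∈ Icc (j : ℝ) (j + 1), |φ κ₁ s| ≤ 1 / κmin * b := by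
    intro s hs
    simp only [hφ]
    rw [abs_neg, abs_mul, abs_of_pos (by positivity : 0 < 1 / κ₁)]
    have := hS κ₁ s hs
    gcongr
  have hφd : ∀ s ∈ Icc (j : ℝ) (j + 1), |φ κ₁ s - φ κ₂ s|
      ≤ ((1 / κmin + 1 / κmin ^ 2) + 1 / κmin) * (b * G) := by
    intro s hs
    have hi := fun κ (hκ : 0 < κ) => intervalIntegrable_mul_sin_sq hV hB
      (solvesPhaseEquation_phase hV hB hκ).1.measurable j s
    set S₁ := ∫ u in (j : ℝ)..s, V u * Real.sin (phase V κ₁ u) ^ 2 with hS₁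
    set S₂ := ∫ u in (j : ℝ)..s, V u * Real.sin (phase V κ₂ u) ^ 2 with hS₂
    have e : φ κ₁ s - φ κ₂ s = -((1 / κ₁ - 1 / κ₂) * S₁) - 1 / κ₂ * (S₁ - S₂) := by
      simp only [hφ, ← hS₁, ← hS₂]; ring
    have hSd : |S₁ - S₂| ≤ b * G := by
      rw [hS₁, hS₂, ← intervalIntegral.integral_sub (hi κ₁ q₁) (hi κ₂ q₂), ← Real.norm_eq_abs]
      refine (intervalIntegral.norm_integral_le_of_norm_le_const_ae (C := b * G) ?_).trans ?_
      · filter_upwards [ae_abs_stepPotential_le hg A j hs.1 hs.2] with u hu hus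
        have h3 := (hu hus).2
        rw [uIoc_of_le hs.1] at hus
        rw [Real.norm_eq_abs, ← mul_sub, abs_mul]
        refine mul_le_mul h3 ?_ (abs_nonneg _) hb0
        -- `sin²` depends on the phase only through `e^{2iθ}`, so `G` applies; the difference of the
        -- phases themselves has no such bound.
        refine le_trans ?_ (hG u ⟨hus.1.le, hus.2.trans hs.2⟩)
        have e1 : Real.sin (phase V κ₁ u) ^ 2 - Real.sin (phase V κ₂ u) ^ 2
            = -((circlePhase V κ₁ u - circlePhase V κ₂ u).re / 2) := by
          rw [sin_sq_eq_re, sin_sq_eq_re, Complex.sub_re, circlePhase, circlePhase]; ring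
        rw [e1, abs_neg, abs_div, abs_of_pos (by norm_num : (0 : ℝ) < 2)]
        have := Complex.abs_re_le_norm (circlePhase V κ₁ u - circlePhase V κ₂ u)
        have := norm_nonneg (circlePhase V κ₁ u - circlePhase V κ₂ u)
        linarith
      · rw [abs_of_nonneg (by linarith [hs.1])]
        exact mul_le_of_le_one_right (by positivity) (by linarith [hs.2])
    have t1 : |(1 / κ₁ - 1 / κ₂) * S₁| ≤ (1 / κmin + 1 / κmin ^ 2) * G * b := by
      rw [abs_mul]
      have h4 := (abs_one_div_sub_le_rpow h0 h₁ h₂ hη hη1).trans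
        (mul_le_mul_of_nonneg_left hδ (by positivity))
      exact mul_le_mul h4 (hS κ₁ s hs) (abs_nonneg _) (by positivity)
    have t2 : |1 / κ₂ * (S₁ - S₂)| ≤ 1 / κmin * (b * G) := by
      rw [abs_mul, abs_of_pos (by positivity : 0 < 1 / κ₂)]
      gcongr
    rw [e]
    refine (abs_sub _ _).trans ?_
    rw [abs_neg]
    refine (add_le_add t1 t2).trans (le_of_eq ?_)
    ring
  refine (intervalIntegral.norm_integral_le_of_norm_le_const_ae
    (C := ((6 / κmin + 2 * (1 / κmin + 1 / κmin ^ 2) + 2 / κmin) * (b * G)) * b) ?_).trans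
      (le_of_eq ?_)
  swap
  · rw [hb, add_sub_cancel_left, abs_one]; ring
  filter_upwards [ae_abs_stepPotential_le hg A j hj1 le_rfl] with s hs hst
  have hVs := (hs hst).2
  rw [uIoc_of_le hj1] at hst
  have hsI : s ∈ Icc (j : ℝ) (j + 1) := ⟨hst.1.le, hst.2⟩
  rw [← sub_mul, ← sub_mul, ← sub_mul, norm_mul, Complex.norm_real, Real.norm_eq_abs]
  refine mul_le_mul ?_ hVs (abs_nonneg _) (by positivity)
  rw [hu κ₁ q₁ s hsI.1, hu κ₂ q₂ s hsI.1]
  set x₁ := Complex.exp (2 * Complex.I * ((κ₁ * (s - j) : ℝ) : ℂ)) with hx₁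
  set x₂ := Complex.exp (2 * Complex.I * ((κ₂ * (s - j) : ℝ) : ℂ)) with hx₂
  set y₁ := Complex.exp (2 * Complex.I * (φ κ₁ s : ℂ)) with hy₁
  set y₂ := Complex.exp (2 * Complex.I * (φ κ₂ s : ℂ)) with hy₂
  have n1 : ‖x₁‖ = 1 := norm_cexp_two_I_mul _
  have n2 : ‖x₂‖ = 1 := norm_cexp_two_I_mul _
  have hxd : ‖x₁ - x₂‖ ≤ 2 * G :=
    (norm_cexp_energy_sub_le hη hη1 ⟨by linarith [hsI.1], by linarith [hsI.2]⟩).trans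
      (by linarith)
  have hyd : ‖y₁ - y₂‖ ≤ 2 * (((1 / κmin + 1 / κmin ^ 2) + 1 / κmin) * (b * G)) :=
    (norm_cexp_sub_cexp_le _ _).trans (by linarith [hφd s hsI])
  have hy1 : ‖y₁ - 1‖ ≤ 2 * (1 / κmin * b) := by
    have := norm_cexp_sub_cexp_le (φ κ₁ s) 0
    simp only [Complex.ofReal_zero, mul_zero, Complex.exp_zero, sub_zero] at this
    exact this.trans (by linarith [hφ₁ s hsI])
  have hGj := hG j ⟨le_rfl, hj1⟩
  set v₁ := circlePhase V κ₁ j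
  set v₂ := circlePhase V κ₂ j
  have m1 : ‖v₁‖ = 1 := norm_circlePhase _ _ _
  have m2 : ‖v₂‖ = 1 := norm_circlePhase _ _ _
  -- Here `v`, `x`, `y` are the initial phase, the free rotation and the correction due to `V`. In
  -- the first product `y₁ - 1` is `O(b)` and its cofactor `O(G)`; in the second `y₁ - y₂` is
  -- already `O(b G)`.
  have e : v₁ * x₁ * y₁ - v₁ * x₁ - (v₂ * x₂ * y₂ - v₂ * x₂)
      = ((v₁ - v₂) * x₁ + v₂ * (x₁ - x₂)) * (y₁ - 1) + v₂ * x₂ * (y₁ - y₂) := by ring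
  rw [e]
  refine (norm_add_le _ _).trans ?_
  rw [norm_mul, norm_mul, norm_mul, n2, m2, one_mul, one_mul]
  have z1 : ‖(v₁ - v₂) * x₁ + v₂ * (x₁ - x₂)‖ ≤ 3 * G := by
    refine (norm_add_le _ _).trans ?_
    rw [norm_mul, norm_mul, n1, m2, one_mul, mul_one]
    linarith
  have z2 := mul_le_mul z1 hy1 (norm_nonneg _) (by positivity)
  refine (add_le_add z2 hyd).trans (le_of_eq ?_)
  ring

end Increment

/-! ### Elementary inequalities for real powers. -/

section PowerInequalities

variable {p : ℝ}

/-- Bernoulli bounds a power from below; applied to `(1 + t)⁻¹ = 1 - t/(1 + t)` and inverted, it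
gives `(1 + t)^p ≤ (1 + t)/(1 + t - p t)`. The restriction on `t` keeps the denominator away from
zero, and no derivatives are needed. -/
theorem rpow_one_add_le_quadratic (hp : 1 ≤ p) {t : ℝ} (ht : |t| ≤ 1 / (4 * p)) :
    (1 + t) ^ p ≤ 1 + p * t + 8 * p ^ 2 * t ^ 2 := by
  have hp0 : 0 < p := by linarith
  have hy : |p * t| ≤ 1 / 4 := by
    rw [abs_mul, abs_of_pos hp0]
    calc p * |t| ≤ p * (1 / (4 * p)) := by gcongr
      _ = 1 / 4 := by field_simp
  have ht4 : |t| ≤ 1 / 4 := ht.trans (by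
    rw [div_le_div_iff₀ (by positivity) (by norm_num)]; linarith)
  obtain ⟨t1, t2⟩ := abs_le.1 ht4
  obtain ⟨y1, y2⟩ := abs_le.1 hy
  have h1t : 0 < 1 + t := by linarith
  have hs : -1 ≤ -t / (1 + t) := by rw [le_div_iff₀ h1t]; linarith
  have hb := one_add_mul_self_le_rpow_one_add hs hp
  have e : 1 + -t / (1 + t) = (1 + t)⁻¹ := by field_simp; ring
  rw [e, Real.inv_rpow h1t.le] at hb
  have hpos : 0 < (1 + t) ^ p := Real.rpow_pos_of_pos h1t p
  have h2 : (1 + p * (-t / (1 + t))) * (1 + t) ^ p ≤ 1 := by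
    calc _ ≤ ((1 + t) ^ p)⁻¹ * (1 + t) ^ p := mul_le_mul_of_nonneg_right hb hpos.le
      _ = 1 := inv_mul_cancel₀ hpos.ne'
  have h3 : (1 + t - p * t) * (1 + t) ^ p ≤ 1 + t := by
    have e2 : (1 + t - p * t) = (1 + p * (-t / (1 + t))) * (1 + t) := by field_simp; ring
    rw [e2]
    calc _ = (1 + p * (-t / (1 + t))) * (1 + t) ^ p * (1 + t) := by ring
      _ ≤ 1 * (1 + t) := mul_le_mul_of_nonneg_right h2 h1t.le
      _ = 1 + t := one_mul _
  have h4 : 1 + t ≤ (1 + t - p * t) * (1 + p * t + 8 * p ^ 2 * t ^ 2) := by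
    have e3 : (1 + t - p * t) * (1 + p * t + 8 * p ^ 2 * t ^ 2)
        = (1 + t) + p * t ^ 2 + (p * t) ^ 2 * (7 + 8 * t - 8 * (p * t)) := by ring
    rw [e3]
    have : 0 ≤ (p * t) ^ 2 * (7 + 8 * t - 8 * (p * t)) :=
      mul_nonneg (sq_nonneg _) (by linarith)
    have : 0 ≤ p * t ^ 2 := by positivity
    linarith
  exact le_of_mul_le_mul_left (h3.trans h4) (by linarith)

theorem rpow_sub_two_mul_sq {x : ℝ} (hp : 2 ≤ p) (hx : 0 ≤ x) : x ^ (p - 2) * x ^ 2 = x ^ p := by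
  have h := Real.rpow_add_of_nonneg hx (by linarith : 0 ≤ p - 2) (by norm_num : (0 : ℝ) ≤ 2)
  rw [sub_add_cancel, Real.rpow_two] at h
  exact h.symm

theorem rpow_sub_one_mul {x : ℝ} (hp : 1 ≤ p) (hx : 0 ≤ x) : x ^ (p - 1) * x = x ^ p := by
  have h := Real.rpow_add_of_nonneg hx (by linarith : 0 ≤ p - 1) zero_le_one
  rw [sub_add_cancel, Real.rpow_one] at h
  exact h.symm

theorem rpow_sub_two_mul_sq_le {x y : ℝ} (hp : 2 ≤ p) (hx : 0 ≤ x) (hy : 0 ≤ y) :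
    x ^ (p - 2) * y ^ 2 ≤ x ^ p + y ^ p := by
  have hx' := Real.rpow_nonneg hx p
  have hy' := Real.rpow_nonneg hy p
  rcases le_total x y with h | h
  · calc x ^ (p - 2) * y ^ 2 ≤ y ^ (p - 2) * y ^ 2 := by
          gcongr
      _ = y ^ p := rpow_sub_two_mul_sq hp hy
      _ ≤ _ := by linarith
  · calc x ^ (p - 2) * y ^ 2 ≤ x ^ (p - 2) * x ^ 2 := by gcongr
      _ = x ^ p := rpow_sub_two_mul_sq hp hx
      _ ≤ _ := by linarith

theorem rpow_sub_one_mul_le {x y : ℝ} (hp : 1 ≤ p) (hx : 0 ≤ x) (hy : 0 ≤ y) :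
    x ^ (p - 1) * y ≤ x ^ p + y ^ p := by
  have hx' := Real.rpow_nonneg hx p
  have hy' := Real.rpow_nonneg hy p
  rcases le_total x y with h | h
  · calc x ^ (p - 1) * y ≤ y ^ (p - 1) * y := by
          gcongr
      _ = y ^ p := rpow_sub_one_mul hp hy
      _ ≤ _ := by linarith
  · calc x ^ (p - 1) * y ≤ x ^ (p - 1) * x := by gcongr
      _ = x ^ p := rpow_sub_one_mul hp hx
      _ ≤ _ := by linarith

/-- A second-order Taylor bound for `|x|^p`. When `|x| ≤ 4p|h|` all terms are dominated by `|h|^p`;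
otherwise `h/x` is small and the quadratic bound scales by `|x|^p`. The constant adds up the costs
of both cases. -/
theorem exists_abs_add_rpow_le (hp : 2 ≤ p) : ∃ C : ℝ, 0 < C ∧ ∀ x h : ℝ,
    |x + h| ^ p ≤ |x| ^ p + p * (|x| ^ (p - 2) * x) * h
      + C * (|x| ^ (p - 2) * h ^ 2 + |h| ^ p) := by
  have hp0 : 0 < p := by linarith
  refine ⟨(4 * p + 1) ^ p + p * (4 * p) ^ p + 8 * p ^ 2, by positivity, fun x h => ?_⟩
  have hxp : 0 ≤ |x| ^ p := Real.rpow_nonneg (abs_nonneg _) _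
  have hhp : 0 ≤ |h| ^ p := Real.rpow_nonneg (abs_nonneg _) _
  have hx2 : 0 ≤ |x| ^ (p - 2) := Real.rpow_nonneg (abs_nonneg _) _
  have k1 : 0 ≤ (4 * p + 1) ^ p := by positivity
  have k2 : 0 ≤ p * (4 * p) ^ p := by positivity
  rcases le_or_gt |x| (4 * p * |h|) with hc | hc
  · have a1 : |x + h| ^ p ≤ (4 * p + 1) ^ p * |h| ^ p := by
      rw [← Real.mul_rpow (by positivity) (abs_nonneg _)]
      refine Real.rpow_le_rpow (abs_nonneg _) ?_ hp0.le
      linarith [abs_add_le x h]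
    have a2 : -(p * (4 * p) ^ p * |h| ^ p) ≤ p * (|x| ^ (p - 2) * x) * h := by
      have : |p * (|x| ^ (p - 2) * x) * h| ≤ p * (4 * p) ^ p * |h| ^ p := by
        rw [abs_mul, abs_mul, abs_mul, abs_of_pos hp0, abs_of_nonneg hx2, mul_assoc p, mul_assoc p]
        refine mul_le_mul_of_nonneg_left ?_ hp0.le
        have hm : |h| ≤ 4 * p * |h| := le_mul_of_one_le_left (abs_nonneg _) (by linarith)
        calc |x| ^ (p - 2) * |x| * |h|
            ≤ (4 * p * |h|) ^ (p - 2) * (4 * p * |h|) * (4 * p * |h|) := by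
              gcongr
          _ = (4 * p * |h|) ^ (p - 2) * (4 * p * |h|) ^ 2 := by ring
          _ = (4 * p * |h|) ^ p := rpow_sub_two_mul_sq hp (by positivity)
          _ = _ := Real.mul_rpow (by positivity) (abs_nonneg _)
      exact (abs_le.1 this).1
    have a3 : 0 ≤ 8 * p ^ 2 * |h| ^ p := by positivity
    have a4 : 0 ≤ ((4 * p + 1) ^ p + p * (4 * p) ^ p + 8 * p ^ 2) * (|x| ^ (p - 2) * h ^ 2) := by
      positivity
    nlinarith
  · have hx0 : x ≠ 0 := by
      rintro rfl
      rw [abs_zero] at hc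
      have : 0 ≤ 4 * p * |h| := by positivity
      linarith
    have hxa : 0 < |x| := abs_pos.2 hx0
    have ht : |h / x| ≤ 1 / (4 * p) := by
      rw [abs_div, div_le_div_iff₀ hxa (by positivity)]; linarith
    have htl : |h / x| ≤ 1 := ht.trans (by
      rw [div_le_one (by positivity)]; linarith)
    have h1 := rpow_one_add_le_quadratic (by linarith : 1 ≤ p) ht
    have e1 : |x + h| = |x| * (1 + h / x) := by
      rw [← abs_of_nonneg (by linarith [(abs_le.1 htl).1] : 0 ≤ 1 + h / x), ← abs_mul]
      congr 1; field_simp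
    rw [e1, Real.mul_rpow hxa.le (by linarith [(abs_le.1 htl).1])]
    have h2 := mul_le_mul_of_nonneg_left h1 hxp
    have e2 : |x| ^ p = |x| ^ (p - 2) * x ^ 2 := by
      rw [← sq_abs x, rpow_sub_two_mul_sq hp hxa.le]
    have e3 : |x| ^ p * (1 + p * (h / x) + 8 * p ^ 2 * (h / x) ^ 2)
        = |x| ^ p + p * (|x| ^ (p - 2) * x) * h + 8 * p ^ 2 * (|x| ^ (p - 2) * h ^ 2) := by
      rw [mul_add, mul_add, mul_one]
      congr 1
      · rw [e2]; field_simp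
      · rw [e2]; field_simp
    rw [e3] at h2
    have a5 : 0 ≤ |x| ^ (p - 2) * h ^ 2 := by positivity
    nlinarith [mul_nonneg k1 a5, mul_nonneg k2 a5, mul_nonneg k1 hhp, mul_nonneg k2 hhp,
      mul_nonneg (sq_nonneg p) hhp]

/-- Young's inequality, as convexity of `y ↦ y^p` above its tangent at `s`: Bernoulli at `y/s - 1`.
-/
theorem mul_rpow_sub_one_mul_le (hp : 1 ≤ p) {s y : ℝ} (hs : 0 ≤ s) (hy : 0 ≤ y) :
    p * s ^ (p - 1) * y ≤ y ^ p + (p - 1) * s ^ p := by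
  rcases hs.eq_or_lt with rfl | hs0
  · rcases hp.eq_or_lt with rfl | hp1
    · simp
    · rw [Real.zero_rpow (by linarith), Real.zero_rpow (by linarith)]
      have := Real.rpow_nonneg hy p
      simpa using this
  · have h := one_add_mul_self_le_rpow_one_add (s := y / s - 1)
      (by have : 0 ≤ y / s := by positivity
          linarith) hp
    rw [add_sub_cancel, Real.div_rpow hy hs] at h
    have hsp : 0 < s ^ p := Real.rpow_pos_of_pos hs0 p
    have h' := mul_le_mul_of_nonneg_right h hsp.le
    rw [div_mul_cancel₀ _ hsp.ne'] at h'
    have e : s ^ (p - 1) * s = s ^ p := rpow_sub_one_mul hp hs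
    have e' : (1 + p * (y / s - 1)) * s ^ p = p * s ^ (p - 1) * y - (p - 1) * s ^ p := by
      rw [← e]; field_simp; ring
    linarith

theorem add_four_rpow_le (hp : 0 ≤ p) {w x y z : ℝ} (hw : 0 ≤ w) (hx : 0 ≤ x) (hy : 0 ≤ y)
    (hz : 0 ≤ z) : (w + x + y + z) ^ p ≤ 4 ^ p * (w ^ p + x ^ p + y ^ p + z ^ p) := by
  have hw' := Real.rpow_nonneg hw p
  have hx' := Real.rpow_nonneg hx p
  have hy' := Real.rpow_nonneg hy p
  have hz' := Real.rpow_nonneg hz p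
  have key : ∀ m, 0 ≤ m → w ≤ m → x ≤ m → y ≤ m → z ≤ m →
      m ^ p ≤ w ^ p + x ^ p + y ^ p + z ^ p →
      (w + x + y + z) ^ p ≤ 4 ^ p * (w ^ p + x ^ p + y ^ p + z ^ p) := by
    intro m hm h1 h2 h3 h4 h5
    calc (w + x + y + z) ^ p ≤ (4 * m) ^ p :=
          Real.rpow_le_rpow (by positivity) (by linarith) hp
      _ = 4 ^ p * m ^ p := Real.mul_rpow (by norm_num) hm
      _ ≤ _ := by gcongr
  have hm4 : max (max w x) (max y z) = w ∨ max (max w x) (max y z) = x ∨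
      max (max w x) (max y z) = y ∨ max (max w x) (max y z) = z := by
    rcases max_choice (max w x) (max y z) with h | h <;> rw [h]
    · rcases max_choice w x with h | h <;> simp [h]
    · rcases max_choice y z with h | h <;> simp [h]
  refine key (max (max w x) (max y z)) (hw.trans (by simp)) (by simp) (by simp) (by simp)
    (by simp) ?_
  rcases hm4 with h | h | h | h <;> rw [h] <;> linarith

end PowerInequalities

/-! ### Calculus of bounded measurable functions. -/

section BoundedMeasurable

variable {Ω : Type*}

/-- A bounded function measurable with respect to `m`. -/
def BoundedMeasurable (m : MeasurableSpace Ω) (h : Ω → ℝ) : Prop :=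
  Measurable[m] h ∧ ∃ C, ∀ x, |h x| ≤ C

namespace BoundedMeasurable

variable {m m' : MeasurableSpace Ω} {g h : Ω → ℝ}

theorem mono (hh : BoundedMeasurable m h) (hm : m ≤ m') : BoundedMeasurable m' h :=
  ⟨hh.1.mono hm le_rfl, hh.2⟩

theorem const (c : ℝ) : BoundedMeasurable m fun _ => c := ⟨measurable_const, |c|, fun _ => le_rfl⟩

theorem add (hg : BoundedMeasurable m g) (hh : BoundedMeasurable m h) :
    BoundedMeasurable m fun x => g x + h x := by
  obtain ⟨C, hC⟩ := hg.2
  obtain ⟨D, hD⟩ := hh.2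
  exact ⟨hg.1.add hh.1, C + D, fun x => (abs_add_le _ _).trans (add_le_add (hC x) (hD x))⟩

theorem mul (hg : BoundedMeasurable m g) (hh : BoundedMeasurable m h) :
    BoundedMeasurable m fun x => g x * h x := by
  obtain ⟨C, hC⟩ := hg.2
  obtain ⟨D, hD⟩ := hh.2
  refine ⟨hg.1.mul hh.1, C * D, fun x => ?_⟩
  rw [abs_mul]
  exact mul_le_mul (hC x) (hD x) (abs_nonneg _) ((abs_nonneg _).trans (hC x))

theorem const_mul (c : ℝ) (hh : BoundedMeasurable m h) : BoundedMeasurable m fun x => c * h x :=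
  (const c).mul hh

theorem sub (hg : BoundedMeasurable m g) (hh : BoundedMeasurable m h) :
    BoundedMeasurable m fun x => g x - h x := by
  have := hg.add (hh.const_mul (-1))
  simpa [sub_eq_add_neg] using this

theorem abs (hh : BoundedMeasurable m h) : BoundedMeasurable m fun x => |h x| := by
  obtain ⟨D, hD⟩ := hh.2
  exact ⟨hh.1.abs, D, fun x => by rw [abs_abs]; exact hD x⟩

theorem max (hg : BoundedMeasurable m g) (hh : BoundedMeasurable m h) :
    BoundedMeasurable m fun x => max (g x) (h x) := by
  obtain ⟨C, hC⟩ := hg.2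
  obtain ⟨D, hD⟩ := hh.2
  exact ⟨hg.1.max hh.1, _, fun x => abs_max_le_max_abs_abs.trans (max_le_max (hC x) (hD x))⟩

theorem rpow (hh : BoundedMeasurable m h) (h0 : ∀ x, 0 ≤ h x) {p : ℝ} (hp : 0 ≤ p) :
    BoundedMeasurable m fun x => h x ^ p := by
  obtain ⟨D, hD⟩ := hh.2
  refine ⟨hh.1.pow_const p, D ^ p, fun x => ?_⟩
  rw [abs_of_nonneg (Real.rpow_nonneg (h0 x) p)]
  exact Real.rpow_le_rpow (h0 x) ((le_abs_self _).trans (hD x)) hp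

theorem sq (hh : BoundedMeasurable m h) : BoundedMeasurable m fun x => h x ^ 2 := by
  have := hh.mul hh
  simpa [pow_two] using this

theorem sign (hh : Measurable[m] h) : BoundedMeasurable m fun x => SignType.sign (h x) := by
  refine ⟨?_, 1, fun x => ?_⟩
  · have e : (fun x => ((SignType.sign (h x) : SignType) : ℝ)) = fun x =>
        if 0 < h x then 1 else if h x < 0 then -1 else 0 := by
      funext x; rw [sign_apply]; split_ifs <;> simp
    rw [e]
    exact Measurable.ite (measurableSet_lt measurable_const hh) measurable_const
      (Measurable.ite (measurableSet_lt hh measurable_const) measurable_const measurable_const)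
  · simp only [sign_apply]; split_ifs <;> simp

theorem sum {ι : Type*} (s : Finset ι) {h : ι → Ω → ℝ} (hh : ∀ i ∈ s, BoundedMeasurable m (h i)) :
    BoundedMeasurable m fun x => ∑ i ∈ s, h i x := by
  classical
  induction s using Finset.induction_on with
  | empty => simpa using const 0
  | insert i s hi ih =>
    simp only [Finset.sum_insert hi]
    exact (hh i (by simp)).add (ih fun j hj => hh j (by simp [hj]))

theorem integrable {mΩ : MeasurableSpace Ω} (hh : BoundedMeasurable mΩ h) (P : Measure Ω)
    [IsFiniteMeasure P] : Integrable h P := by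
  obtain ⟨D, hD⟩ := hh.2
  exact Integrable.of_bound hh.1.aestronglyMeasurable D (Filter.Eventually.of_forall hD)

end BoundedMeasurable

end BoundedMeasurable

/-! ### Martingale transforms: Doob's inequality and moment growth. -/

section Transform

variable {Ω : Type*}

/-- The transform `∑_{j < n} ξ j * a j`. -/
def transform (ξ a : ℕ → Ω → ℝ) (n : ℕ) (x : Ω) : ℝ := ∑ j ∈ Finset.range n, ξ j x * a j x

/-- The running maximum of `|M k|`, `1 ≤ k ≤ n`. -/
def runningMax (M : ℕ → Ω → ℝ) : ℕ → Ω → ℝ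
  | 0 => fun _ => 0
  | n + 1 => fun x => max (runningMax M n x) |M (n + 1) x|

theorem runningMax_nonneg (M : ℕ → Ω → ℝ) (n : ℕ) (x : Ω) : 0 ≤ runningMax M n x := by
  induction n with
  | zero => exact le_rfl
  | succ n ih => exact ih.trans (le_max_left _ _)

theorem abs_transform_le_runningMax (ξ a : ℕ → Ω → ℝ) {k n : ℕ} (hkn : k ≤ n) (x : Ω) :
    |transform ξ a k x| ≤ runningMax (transform ξ a) n x := by
  induction n with
  | zero =>
    obtain rfl : k = 0 := by omega
    simp [transform, runningMax]
  | succ n ih =>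
    rcases Nat.lt_or_ge n k with h | h
    · obtain rfl : k = n + 1 := by omega
      exact le_max_right _ _
    · exact (ih h).trans (le_max_left _ _)

variable [mΩ : MeasurableSpace Ω]

/-- Bounded noise adapted to `F`, each `ξ n` orthogonal to the bounded `F n`-measurable functions. -/
structure IsCenteredNoise (P : Measure Ω) (F : ℕ → MeasurableSpace Ω) (ξ : ℕ → Ω → ℝ) : Prop where
  le : ∀ n, F n ≤ mΩ
  mono : Monotone F
  measurable : ∀ n, Measurable[F (n + 1)] (ξ n)
  abs_le : ∀ n x, |ξ n x| ≤ 1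
  integral_mul : ∀ n (h : Ω → ℝ), BoundedMeasurable (F n) h → ∫ x, ξ n x * h x ∂P = 0

variable {P : Measure Ω} {F : ℕ → MeasurableSpace Ω} {ξ a : ℕ → Ω → ℝ}
  {p : ℝ}

theorem IsCenteredNoise.boundedMeasurable (hξ : IsCenteredNoise P F ξ) (n : ℕ) :
    BoundedMeasurable (F (n + 1)) (ξ n) := ⟨hξ.measurable n, 1, hξ.abs_le n⟩

theorem IsCenteredNoise.boundedMeasurable_transform (hξ : IsCenteredNoise P F ξ)
    (ha : ∀ n, BoundedMeasurable (F n) (a n)) (n : ℕ) :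
    BoundedMeasurable (F n) (transform ξ a n) := by
  refine BoundedMeasurable.sum _ fun j hj => ?_
  have hj' : j < n := Finset.mem_range.1 hj
  exact ((hξ.boundedMeasurable j).mono (hξ.mono hj')).mul ((ha j).mono (hξ.mono hj'.le))

theorem IsCenteredNoise.boundedMeasurable_runningMax (hξ : IsCenteredNoise P F ξ)
    (ha : ∀ n, BoundedMeasurable (F n) (a n)) (n : ℕ) :
    BoundedMeasurable (F n) (runningMax (transform ξ a) n) := by
  induction n with
  | zero => exact BoundedMeasurable.const 0
  | succ n ih => exact (ih.mono (hξ.mono n.le_succ)).max (hξ.boundedMeasurable_transform ha (n + 1)).abs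

theorem abs_add_sign_mul_le (y h : ℝ) : |y| + SignType.sign y * h ≤ |y + h| := by
  rcases lt_trichotomy y 0 with hy | rfl | hy
  · rw [sign_neg hy, abs_of_neg hy]
    have := neg_abs_le (y + h)
    simp only [SignType.coe_neg_one]
    linarith
  · simp
  · rw [sign_pos hy, abs_of_pos hy]
    have := le_abs_self (y + h)
    simp only [SignType.coe_one]
    linarith

/-- Doob's `L^p` maximal inequality for transforms of centered noise. -/
theorem IsCenteredNoise.integral_runningMax_rpow_le [IsFiniteMeasure P] (hξ : IsCenteredNoise P F ξ)
    (ha : ∀ n, BoundedMeasurable (F n) (a n)) (hp : 1 < p) (n : ℕ) :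
    ∫ x, runningMax (transform ξ a) n x ^ p ∂P
      ≤ (p / (p - 1)) ^ p * ∫ x, |transform ξ a n x| ^ p ∂P := by
  set M := transform ξ a with hM
  set S := runningMax M with hS
  set q := p / (p - 1) with hq
  have hp1 : 0 < p - 1 := by linarith
  have hp0 : 0 < p := by linarith
  have hq0 : 0 < q := by positivity
  have hqp : q * (p - 1) = p := by rw [hq]; field_simp
  have hMb := fun n => hξ.boundedMeasurable_transform ha n
  have hSb := fun n => hξ.boundedMeasurable_runningMax ha n
  have hS0 : ∀ n x, 0 ≤ S n x := fun n x => runningMax_nonneg M n x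
  have hSp : ∀ n, BoundedMeasurable (F n) fun x => S n x ^ (p - 1) :=
    fun n => (hSb n).rpow (hS0 n) hp1.le
  have hU : ∀ n, BoundedMeasurable (F n) fun x => p * S n x ^ (p - 1) * (S n x - q * |M n x|) :=
    fun n => ((hSp n).const_mul p).mul ((hSb n).sub ((hMb n).abs.const_mul q))
  -- A pathwise proof of Doob's inequality: this functional of maximum and current value decreases
  -- up to a multiple of `ξ n` with an `F n`-measurable coefficient, which integrates to zero.
  have hstep : ∀ n, ∫ x, p * S n x ^ (p - 1) * (S n x - q * |M n x|) ∂P ≤ 0 := by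
    intro n
    induction n with
    | zero =>
      simp [hS, runningMax, Real.zero_rpow hp1.ne']
    | succ n ih =>
      set H : Ω → ℝ := fun x => p * q * (S n x ^ (p - 1) * (SignType.sign (M n x) * a n x))
      have hH : BoundedMeasurable (F n) H :=
        ((hSp n).mul ((BoundedMeasurable.sign (hMb n).1).mul (ha n))).const_mul (p * q)
      have hpt : ∀ x, p * S (n + 1) x ^ (p - 1) * (S (n + 1) x - q * |M (n + 1) x|)
          ≤ p * S n x ^ (p - 1) * (S n x - q * |M n x|) - ξ n x * H x := by
        intro x
        have hMs : M (n + 1) x = M n x + ξ n x * a n x := Finset.sum_range_succ _ _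
        have h1 := abs_add_sign_mul_le (M n x) (ξ n x * a n x)
        rw [← hMs] at h1
        have hSs : S (n + 1) x = max (S n x) |M (n + 1) x| := rfl
        have hs := hS0 n x
        have hsp : 0 ≤ S n x ^ (p - 1) := Real.rpow_nonneg hs _
        have hy := abs_nonneg (M (n + 1) x)
        -- Updating the maximum can only lower the functional. When a new maximum is reached, the
        -- two sides differ by `q` times the defect in Young's inequality; this uses `q (p - 1) =
        -- p`.
        have h2 : p * S (n + 1) x ^ (p - 1) * (S (n + 1) x - q * |M (n + 1) x|)
            ≤ p * S n x ^ (p - 1) * (S n x - q * |M (n + 1) x|) := by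
          rw [hSs]
          rcases le_total |M (n + 1) x| (S n x) with h | h
          · rw [max_eq_left h]
          · rw [max_eq_right h]
            set y := |M (n + 1) x|
            have hyoung := mul_rpow_sub_one_mul_le hp.le hs hy
            have e1 := rpow_sub_one_mul hp.le hy
            have e2 := rpow_sub_one_mul hp.le hs
            have e3 : p * y ^ (p - 1) * (y - q * y) = -(q * y ^ p) := by
              rw [← e1]; linear_combination (-(y ^ (p - 1) * y)) * hqp
            have e4 : p * S n x ^ (p - 1) * (S n x - q * y)
                = q * ((p - 1) * S n x ^ p - p * S n x ^ (p - 1) * y) := by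
              rw [← e2]; linear_combination (-(S n x ^ (p - 1) * S n x)) * hqp
            rw [e3, e4]
            nlinarith
        refine h2.trans ?_
        have h3 := mul_le_mul_of_nonneg_left h1 (by positivity : 0 ≤ p * q * S n x ^ (p - 1))
        simp only [H]
        linarith
      calc _ ≤ ∫ x, (p * S n x ^ (p - 1) * (S n x - q * |M n x|) - ξ n x * H x) ∂P :=
            integral_mono (((hU (n + 1)).mono (hξ.le _)).integrable P)
              ((((hU n).mono (hξ.le n)).sub (((hξ.boundedMeasurable n).mono (hξ.le _)).mul
                (hH.mono (hξ.le n)))).integrable P) hpt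
        _ = ∫ x, p * S n x ^ (p - 1) * (S n x - q * |M n x|) ∂P := by
            rw [integral_sub (((hU n).mono (hξ.le n)).integrable P)
              ((((hξ.boundedMeasurable n).mono (hξ.le _)).mul (hH.mono (hξ.le n))).integrable P),
              hξ.integral_mul n H hH, sub_zero]
        _ ≤ 0 := ih
  have hSP := (((hSb n).rpow (hS0 n) hp0.le).mono (hξ.le n)).integrable P
  have hMP := ((((hMb n).abs.rpow (fun _ => abs_nonneg _) hp0.le).const_mul (q ^ p)).mono
    (hξ.le n)).integrable P
  -- Young's inequality with `y = q |M n|` shows that the integrand lies below the functional.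
  have hfin : ∫ x, (S n x ^ p - q ^ p * |M n x| ^ p) ∂P ≤ 0 := by
    refine (integral_mono (hSP.sub hMP) (((hU n).mono (hξ.le n)).integrable P) fun x => ?_).trans
      (hstep n)
    have hs := hS0 n x
    have hy : 0 ≤ q * |M n x| := by positivity
    have hyoung := mul_rpow_sub_one_mul_le hp.le hs hy
    rw [Real.mul_rpow hq0.le (abs_nonneg _)] at hyoung
    have e2 := rpow_sub_one_mul hp.le hs
    have e3 : p * S n x ^ (p - 1) * (S n x - q * |M n x|)
        = p * S n x ^ p - p * S n x ^ (p - 1) * (q * |M n x|) := by rw [← e2]; ring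
    rw [e3]
    change S n x ^ p - q ^ p * |M n x| ^ p ≤ _
    linarith
  rw [integral_sub hSP hMP, integral_const_mul] at hfin
  linarith

/-- The linear term of the expansion of `|M + ξ a|^p` is `ξ n` times a bounded `F n`-measurable
function and integrates to zero; in the rest `|ξ| ≤ 1` removes the noise. The constant depends on
`p` only and is chosen before the noise. -/
theorem IsCenteredNoise.exists_integral_rpow_succ_le [IsFiniteMeasure P] (hp : 2 ≤ p) :
    ∃ C : ℝ, 0 < C ∧ ∀ {F : ℕ → MeasurableSpace Ω} {ξ a : ℕ → Ω → ℝ},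
      IsCenteredNoise P F ξ → (∀ n, BoundedMeasurable (F n) (a n)) → ∀ n,
      ∫ x, |transform ξ a (n + 1) x| ^ p ∂P
        ≤ ∫ x, |transform ξ a n x| ^ p ∂P
          + C * ∫ x, (|transform ξ a n x| ^ (p - 2) * a n x ^ 2
            + |a n x| ^ p) ∂P := by
  obtain ⟨C, hC0, hC⟩ := exists_abs_add_rpow_le hp
  refine ⟨C, hC0, fun {F ξ a} hξ ha n => ?_⟩
  have hp0 : 0 ≤ p := by linarith
  have hp2 : 0 ≤ p - 2 := by linarith
  set M := transform ξ a with hM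
  have hMb := fun n => hξ.boundedMeasurable_transform ha n
  have hMp := fun n => (hMb n).abs.rpow (fun _ => abs_nonneg _) hp0
  have hM2 := (hMb n).abs.rpow (fun _ => abs_nonneg _) hp2
  set H : Ω → ℝ := fun x => p * (|M n x| ^ (p - 2) * M n x) * a n x
  have hH : BoundedMeasurable (F n) H := ((hM2.mul (hMb n)).const_mul p).mul (ha n)
  have hQ : BoundedMeasurable (F n) fun x => |M n x| ^ (p - 2) * a n x ^ 2 + |a n x| ^ p :=
    (hM2.mul (ha n).sq).add ((ha n).abs.rpow (fun _ => abs_nonneg _) hp0)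
  have hξH := (((hξ.boundedMeasurable n).mono (hξ.le _)).mul (hH.mono (hξ.le n))).integrable P
  have hQi := ((hQ.const_mul C).mono (hξ.le n)).integrable P
  have hMi := ((hMp n).mono (hξ.le n)).integrable P
  calc ∫ x, |M (n + 1) x| ^ p ∂P
      ≤ ∫ x, (|M n x| ^ p + ξ n x * H x
          + C * (|M n x| ^ (p - 2) * a n x ^ 2 + |a n x| ^ p)) ∂P := by
        refine integral_mono (((hMp (n + 1)).mono (hξ.le _)).integrable P)
          ((hMi.add hξH).add hQi) fun x => ?_
        have hMs : M (n + 1) x = M n x + ξ n x * a n x := Finset.sum_range_succ _ _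
        simp only [hMs]
        refine (hC _ _).trans ?_
        have hle : |ξ n x * a n x| ≤ |a n x| := by
          rw [abs_mul]; exact mul_le_of_le_one_left (abs_nonneg _) (hξ.abs_le n x)
        have h1 : (ξ n x * a n x) ^ 2 ≤ a n x ^ 2 := sq_le_sq.2 hle
        have h2 : |ξ n x * a n x| ^ p ≤ |a n x| ^ p := Real.rpow_le_rpow (abs_nonneg _) hle hp0
        have h3 : 0 ≤ |M n x| ^ (p - 2) := Real.rpow_nonneg (abs_nonneg _) _
        have h4 := mul_le_mul_of_nonneg_left (add_le_add (mul_le_mul_of_nonneg_left h1 h3) h2)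
          hC0.le
        simp only [H]
        linarith
    _ = _ := by
        rw [integral_add (f := fun x => |M n x| ^ p + ξ n x * H x) (hMi.add hξH) hQi,
          integral_add hMi hξH, hξ.integral_mul n H hH, add_zero,
          integral_const_mul]

end Transform

/-! ### The moment recursion. -/

/-- For `p ≥ 2` and `d ≤ 1` one has `d^p ≤ d²`, so both second-order terms carry the square-summable
weight `d²`. -/
theorem rpow_sub_two_mul_sq_add_rpow_le {p : ℝ} (hp : 2 ≤ p) {C d b x a : ℝ} (hC : 0 ≤ C)
    (hd0 : 0 ≤ d) (hd1 : d ≤ 1) (hb : 0 ≤ b) (hx : 0 ≤ x) (ha : |a| ≤ C * (d * b)) :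
    x ^ (p - 2) * a ^ 2 + |a| ^ p ≤ (C ^ 2 + C ^ p) * (d ^ 2 * (x ^ p + b ^ p)) := by
  have hp0 : 0 ≤ p := by linarith
  have hx2 : 0 ≤ x ^ (p - 2) := Real.rpow_nonneg hx _
  have hxp : 0 ≤ x ^ p := Real.rpow_nonneg hx _
  have h1 : a ^ 2 ≤ C ^ 2 * d ^ 2 * b ^ 2 := by
    rw [← sq_abs]
    calc |a| ^ 2 ≤ (C * (d * b)) ^ 2 := by gcongr
      _ = _ := by ring
  have h2 : x ^ (p - 2) * a ^ 2 ≤ C ^ 2 * (d ^ 2 * (x ^ p + b ^ p)) := by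
    calc x ^ (p - 2) * a ^ 2 ≤ x ^ (p - 2) * (C ^ 2 * d ^ 2 * b ^ 2) := by gcongr
      _ = C ^ 2 * (d ^ 2 * (x ^ (p - 2) * b ^ 2)) := by ring
      _ ≤ _ := by gcongr; exact rpow_sub_two_mul_sq_le hp hx hb
  have hdp : d ^ p ≤ d ^ 2 := by
    rcases hd0.eq_or_lt with rfl | hd
    · rw [Real.zero_rpow (by linarith)]; norm_num
    · rw [← Real.rpow_two]
      exact Real.rpow_le_rpow_of_exponent_ge hd hd1 hp
  have hCp : 0 ≤ C ^ p := Real.rpow_nonneg hC p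
  have hbp : 0 ≤ b ^ p := Real.rpow_nonneg hb p
  have h3 : |a| ^ p ≤ C ^ p * (d ^ 2 * (x ^ p + b ^ p)) := by
    calc |a| ^ p ≤ (C * (d * b)) ^ p := Real.rpow_le_rpow (abs_nonneg _) ha hp0
      _ = C ^ p * (d ^ p * b ^ p) := by
          rw [Real.mul_rpow hC (by positivity), Real.mul_rpow hd0 hb]
      _ ≤ _ := by gcongr; linarith
  linarith

theorem le_mul_exp_sum_of_succ_le {w c : ℕ → ℝ} {L : ℝ} (hw : ∀ n, 0 ≤ w n)
    (h : ∀ n, w (n + 1) ≤ w n + L * c n * w n) (n : ℕ) :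
    w n ≤ w 0 * Real.exp (L * ∑ j ∈ Finset.range n, c j) := by
  induction n with
  | zero => simp
  | succ n ih =>
    calc w (n + 1) ≤ w n * (L * c n + 1) := by linarith [h n]
      _ ≤ w n * Real.exp (L * c n) :=
          mul_le_mul_of_nonneg_left (Real.add_one_le_exp _) (hw n)
      _ ≤ (w 0 * Real.exp (L * ∑ j ∈ Finset.range n, c j)) * Real.exp (L * c n) :=
          mul_le_mul_of_nonneg_right ih (Real.exp_pos _).le
      _ = _ := by rw [mul_assoc, ← Real.exp_add, Finset.sum_range_succ, mul_add]

/-- A self-improving moment bound: the coefficients of two transforms and the remainder terms are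
controlled by the size of the transforms themselves, with square-summable weights. -/
theorem IsCenteredNoise.exists_integral_max_le {Ω : Type*} [mΩ : MeasurableSpace Ω]
    (P : Measure Ω) [IsProbabilityMeasure P] {p : ℝ} (hp : 2 ≤ p) {C : ℝ} (hC : 0 ≤ C) {D : ℝ}
    (hD0 : 0 ≤ D) :
    ∃ C' : ℝ, 0 < C' ∧ ∀ {F : ℕ → MeasurableSpace Ω} {ξ : ℕ → Ω → ℝ}, IsCenteredNoise P F ξ →
      ∀ d : ℕ → ℝ, (∀ n, 0 ≤ d n) → (∀ n, d n ≤ 1) →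
      (∀ N, ∑ j ∈ Finset.range N, d j ^ 2 ≤ D) → ∀ δ : ℝ, 0 ≤ δ → ∀ a₁ a₂ r b : ℕ → Ω → ℝ,
      (∀ n, BoundedMeasurable (F n) (a₁ n)) → (∀ n, BoundedMeasurable (F n) (a₂ n)) →
      (∀ n, BoundedMeasurable mΩ (r n)) → (∀ n, BoundedMeasurable mΩ (b n)) →
      (∀ n x, 0 ≤ r n x) → (∀ n x, 0 ≤ b n x) →
      (∀ n x, |a₁ n x| ≤ C * (d n * b n x)) → (∀ n x, |a₂ n x| ≤ C * (d n * b n x)) →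
      (∀ n x, r n x ≤ C * (d n ^ 2 * b n x)) →
      (∀ n x, b n x ≤ δ + |transform ξ a₁ n x| + |transform ξ a₂ n x|
        + ∑ j ∈ Finset.range n, r j x) → ∀ N,
      ∫ x, (runningMax (transform ξ a₁) N x ^ p + runningMax (transform ξ a₂) N x ^ p
        + (∑ j ∈ Finset.range N, r j x) ^ p
        + ∑ j ∈ Finset.range N, d j ^ 2 * b j x ^ p) ∂P ≤ C' * δ ^ p := by
  have hp0 : 0 ≤ p := by linarith
  have hp1 : 1 ≤ p := by linarith
  obtain ⟨Cm, hCm0, hCm⟩ := IsCenteredNoise.exists_integral_rpow_succ_le (P := P) hp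
  obtain ⟨Cp, hCp0, hCp⟩ := exists_abs_add_rpow_le hp
  have hCpow : 0 ≤ C ^ p := Real.rpow_nonneg hC p
  -- The factor `1 + 4^p` bounds `|M n|^p + b n^p` by a multiple of `W n`. In `L` below, `2 * (Cm *
  -- K)` pays for the two transforms and the bracket for the accumulated remainder.
  set K : ℝ := (C ^ 2 + C ^ p) * (1 + 4 ^ p) with hK
  have hK0 : 0 ≤ K := by positivity
  set L : ℝ := 2 * (Cm * K) + (p * C * (1 + 4 ^ p) + Cp * K) with hL
  have hL0 : 0 ≤ L := by positivity
  set q : ℝ := (p / (p - 1)) ^ p with hq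
  have hq0 : 0 ≤ q := Real.rpow_nonneg (div_nonneg hp0 (by linarith)) _
  refine ⟨(2 * q + 1 + D * 4 ^ p) * Real.exp (L * D), by positivity, ?_⟩
  intro F ξ hξ d hd0 hd1 hD δ hδ a₁ a₂ r b ha₁ ha₂ hr hb hr0 hb0 hle₁ hle₂ hler hleb N
  set M₁ := transform ξ a₁ with hM₁
  set M₂ := transform ξ a₂ with hM₂
  set R : ℕ → Ω → ℝ := fun n x => ∑ j ∈ Finset.range n, r j x with hR
  have hR0 : ∀ n x, 0 ≤ R n x := fun n x => Finset.sum_nonneg fun j _ => hr0 j x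
  have hRb : ∀ n, BoundedMeasurable mΩ (R n) := fun n => BoundedMeasurable.sum _ fun j _ => hr j
  have hM₁b := fun n => (hξ.boundedMeasurable_transform ha₁ n).mono (hξ.le n)
  have hM₂b := fun n => (hξ.boundedMeasurable_transform ha₂ n).mono (hξ.le n)
  have b₁ := fun n => (hM₁b n).abs.rpow (fun _ => abs_nonneg _) hp0
  have b₂ := fun n => (hM₂b n).abs.rpow (fun _ => abs_nonneg _) hp0
  have bR := fun n => (hRb n).rpow (hR0 n) hp0
  have bb := fun n => (hb n).rpow (hb0 n) hp0
  have i₁ := fun n => (b₁ n).integrable P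
  have i₂ := fun n => (b₂ n).integrable P
  have iR := fun n => (bR n).integrable P
  -- Including `δ^p` makes the recursion homogeneous: `b n^p ≤ 4^p W n` without an extra source
  -- term.
  set W : ℕ → Ω → ℝ := fun n x => δ ^ p + |M₁ n x| ^ p + |M₂ n x| ^ p + R n x ^ p with hW
  have hδp : 0 ≤ δ ^ p := Real.rpow_nonneg hδ p
  have n₁ : ∀ n x, 0 ≤ |M₁ n x| ^ p := fun n x => Real.rpow_nonneg (abs_nonneg _) p
  have n₂ : ∀ n x, 0 ≤ |M₂ n x| ^ p := fun n x => Real.rpow_nonneg (abs_nonneg _) p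
  have nR : ∀ n x, 0 ≤ R n x ^ p := fun n x => Real.rpow_nonneg (hR0 n x) p
  have hW0 : ∀ n x, 0 ≤ W n x := fun n x => by
    have := n₁ n x; have := n₂ n x; have := nR n x; simp only [hW]; positivity
  have hWi : ∀ n, Integrable (W n) P := fun n =>
    ((((BoundedMeasurable.const (δ ^ p)).add (b₁ n)).add (b₂ n)).add (bR n)).integrable P
  have hbW : ∀ n x, b n x ^ p ≤ 4 ^ p * W n x := fun n x =>
    (Real.rpow_le_rpow (hb0 n x) (hleb n x) hp0).trans
      (add_four_rpow_le hp0 hδ (abs_nonneg _) (abs_nonneg _) (hR0 n x))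
  have hstepM : ∀ a : ℕ → Ω → ℝ, (∀ n, BoundedMeasurable (F n) (a n)) →
      (∀ n x, |a n x| ≤ C * (d n * b n x)) → (∀ n x, |transform ξ a n x| ^ p ≤ W n x) → ∀ n,
      ∫ x, |transform ξ a (n + 1) x| ^ p ∂P
        ≤ ∫ x, |transform ξ a n x| ^ p ∂P + Cm * K * (d n ^ 2 * ∫ x, W n x ∂P) := by
    intro a ha hle hMW n
    refine (hCm hξ ha n).trans (add_le_add_right ?_ _)
    rw [mul_assoc]
    refine mul_le_mul_of_nonneg_left ?_ hCm0.le
    rw [← integral_const_mul, ← integral_const_mul]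
    have hMb := (hξ.boundedMeasurable_transform ha n).mono (hξ.le n)
    have haΩ := (ha n).mono (hξ.le n)
    refine integral_mono ((((hMb.abs.rpow (fun _ => abs_nonneg _) (by linarith)).mul haΩ.sq).add
      (haΩ.abs.rpow (fun _ => abs_nonneg _) hp0)).integrable P)
      (((hWi n).const_mul _).const_mul _) fun x => ?_
    refine (rpow_sub_two_mul_sq_add_rpow_le hp hC (hd0 n) (hd1 n) (hb0 n x) (abs_nonneg _)
      (hle n x)).trans ?_
    have h1 : |transform ξ a n x| ^ p + b n x ^ p ≤ (1 + 4 ^ p) * W n x := by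
      linarith [hMW n x, hbW n x]
    calc _ ≤ (C ^ 2 + C ^ p) * (d n ^ 2 * ((1 + 4 ^ p) * W n x)) := by gcongr
      _ = _ := by rw [hK]; ring
  have hstepR : ∀ n, ∫ x, R (n + 1) x ^ p ∂P ≤ ∫ x, R n x ^ p ∂P
      + (p * C * (1 + 4 ^ p) + Cp * K) * (d n ^ 2 * ∫ x, W n x ∂P) := by
    intro n
    rw [← integral_const_mul, ← integral_const_mul, ← integral_add (iR n)
      (((hWi n).const_mul _).const_mul _)]
    refine integral_mono (iR (n + 1)) ((iR n).add (((hWi n).const_mul _).const_mul _))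
      fun x => ?_
    have hRs : R (n + 1) x = R n x + r n x := Finset.sum_range_succ _ _
    have h0 := hR0 n x
    have hr' := hr0 n x
    have hb' := hb0 n x
    have hd' := hd0 n
    have h := hCp (R n x) (r n x)
    rw [abs_of_nonneg (add_nonneg h0 hr'), ← hRs, abs_of_nonneg h0] at h
    have e1 : R n x ^ (p - 2) * R n x = R n x ^ (p - 1) := by
      have := Real.rpow_add_of_nonneg h0 (by linarith : 0 ≤ p - 2) zero_le_one
      rw [Real.rpow_one] at this
      rw [← this]; congr 1; ring
    have hRW : R n x ^ p ≤ W n x := by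
      have := n₁ n x; have := n₂ n x; simp only [hW]; linarith
    have h1 : R n x ^ p + b n x ^ p ≤ (1 + 4 ^ p) * W n x := by linarith [hbW n x]
    -- The linear term of the remainder does not cancel, but `r n` already carries `d n^2`.
    have h2 : p * (R n x ^ (p - 2) * R n x) * r n x
        ≤ p * C * (1 + 4 ^ p) * (d n ^ 2 * W n x) := by
      rw [e1]
      have hR1 : 0 ≤ R n x ^ (p - 1) := Real.rpow_nonneg h0 _
      calc p * R n x ^ (p - 1) * r n x ≤ p * R n x ^ (p - 1) * (C * (d n ^ 2 * b n x)) := by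
            gcongr; exact hler n x
        _ = p * C * (d n ^ 2 * (R n x ^ (p - 1) * b n x)) := by ring
        _ ≤ p * C * (d n ^ 2 * ((1 + 4 ^ p) * W n x)) := by
            have h6 := (rpow_sub_one_mul_le hp1 h0 hb').trans h1
            exact mul_le_mul_of_nonneg_left (mul_le_mul_of_nonneg_left h6 (sq_nonneg _))
              (by positivity)
        _ = _ := by ring
    have hrd : |r n x| ≤ C * (d n * b n x) := by
      rw [abs_of_nonneg hr']
      refine (hler n x).trans (mul_le_mul_of_nonneg_left ?_ hC)
      refine mul_le_mul_of_nonneg_right ?_ hb'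
      rw [sq]; exact mul_le_of_le_one_left hd' (hd1 n)
    have h3 := rpow_sub_two_mul_sq_add_rpow_le hp hC hd' (hd1 n) hb' h0 hrd
    have h4 : (C ^ 2 + C ^ p) * (d n ^ 2 * (R n x ^ p + b n x ^ p)) ≤ K * (d n ^ 2 * W n x) := by
      calc _ ≤ (C ^ 2 + C ^ p) * (d n ^ 2 * ((1 + 4 ^ p) * W n x)) := by gcongr
        _ = _ := by rw [hK]; ring
    have h5 := mul_le_mul_of_nonneg_left (h3.trans h4) hCp0.le
    simp only
    linarith
  have hsplit : ∀ n, ∫ x, W n x ∂P = δ ^ p + ∫ x, |M₁ n x| ^ p ∂P + ∫ x, |M₂ n x| ^ p ∂P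
      + ∫ x, R n x ^ p ∂P := by
    intro n
    simp only [hW]
    rw [integral_add (f := fun x => δ ^ p + |M₁ n x| ^ p + |M₂ n x| ^ p)
        (((integrable_const _).add (i₁ n)).add (i₂ n)) (iR n),
      integral_add (f := fun x => δ ^ p + |M₁ n x| ^ p) ((integrable_const _).add (i₁ n)) (i₂ n),
      integral_add (integrable_const _) (i₁ n)]
    simp [hM₁, hM₂]
  have hWstep : ∀ n, ∫ x, W (n + 1) x ∂P
      ≤ ∫ x, W n x ∂P + L * d n ^ 2 * ∫ x, W n x ∂P := by
    intro n
    have s₁ := hstepM a₁ ha₁ hle₁ (fun n x => by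
      have := n₂ n x; have := nR n x; simp only [hW]; linarith) n
    have s₂ := hstepM a₂ ha₂ hle₂ (fun n x => by
      have := n₁ n x; have := nR n x; simp only [hW]; linarith) n
    have s₃ := hstepR n
    have e : L * d n ^ 2 * ∫ x, W n x ∂P = Cm * K * (d n ^ 2 * ∫ x, W n x ∂P)
        + Cm * K * (d n ^ 2 * ∫ x, W n x ∂P)
        + (p * C * (1 + 4 ^ p) + Cp * K) * (d n ^ 2 * ∫ x, W n x ∂P) := by rw [hL]; ring
    rw [e, hsplit (n + 1)]
    have := hsplit n
    linarith
  have hW00 : ∫ x, W 0 x ∂P = δ ^ p := by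
    rw [hsplit 0]
    simp [hM₁, hM₂, hR, transform, Real.zero_rpow (by linarith : p ≠ 0)]
  have hWN : ∀ n, ∫ x, W n x ∂P ≤ Real.exp (L * D) * δ ^ p := by
    intro n
    have h := le_mul_exp_sum_of_succ_le (w := fun n => ∫ x, W n x ∂P) (c := fun n => d n ^ 2)
      (fun n => integral_nonneg (hW0 n)) hWstep n
    rw [hW00] at h
    refine h.trans ?_
    rw [mul_comm]
    refine mul_le_mul_of_nonneg_right (Real.exp_le_exp.2 ?_) hδp
    exact mul_le_mul_of_nonneg_left (hD n) hL0
  have hS₁ := hξ.integral_runningMax_rpow_le ha₁ (by linarith : 1 < p) N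
  have hS₂ := hξ.integral_runningMax_rpow_le ha₂ (by linarith : 1 < p) N
  have bS₁ := ((hξ.boundedMeasurable_runningMax ha₁ N).mono (hξ.le N)).rpow
    (runningMax_nonneg _ N) hp0
  have bS₂ := ((hξ.boundedMeasurable_runningMax ha₂ N).mono (hξ.le N)).rpow
    (runningMax_nonneg _ N) hp0
  have bSum : BoundedMeasurable mΩ fun x => ∑ j ∈ Finset.range N, d j ^ 2 * b j x ^ p :=
    BoundedMeasurable.sum _ fun j _ => (bb j).const_mul _
  rw [integral_add (f := fun x => runningMax M₁ N x ^ p + runningMax M₂ N x ^ p + R N x ^ p)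
      (((bS₁.add bS₂).add (bR N)).integrable P) (bSum.integrable P),
    integral_add (f := fun x => runningMax M₁ N x ^ p + runningMax M₂ N x ^ p)
      ((bS₁.add bS₂).integrable P) (iR N),
    integral_add (bS₁.integrable P) (bS₂.integrable P),
    integral_finsetSum _ fun j _ => ((bb j).const_mul _).integrable P]
  -- This weighted sum will dominate the excursions between integers, so no maximal inequality for
  -- `b` is needed.
  have hsum : ∑ j ∈ Finset.range N, ∫ x, d j ^ 2 * b j x ^ p ∂P
      ≤ D * (4 ^ p * (Real.exp (L * D) * δ ^ p)) := by
    calc _ ≤ ∑ j ∈ Finset.range N, d j ^ 2 * (4 ^ p * (Real.exp (L * D) * δ ^ p)) := by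
          refine Finset.sum_le_sum fun j _ => ?_
          rw [integral_const_mul]
          refine mul_le_mul_of_nonneg_left ?_ (sq_nonneg _)
          refine (integral_mono ((bb j).integrable P) ((hWi j).const_mul _) (hbW j)).trans ?_
          rw [integral_const_mul]
          exact mul_le_mul_of_nonneg_left (hWN j) (by positivity)
      _ = (∑ j ∈ Finset.range N, d j ^ 2) * (4 ^ p * (Real.exp (L * D) * δ ^ p)) :=
          (Finset.sum_mul _ _ _).symm
      _ ≤ _ := mul_le_mul_of_nonneg_right (hD N) (by positivity)
  have hN := hWN N
  have hs := hsplit N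
  have j₁ : 0 ≤ ∫ x, |M₁ N x| ^ p ∂P := integral_nonneg (n₁ N)
  have j₂ : 0 ≤ ∫ x, |M₂ N x| ^ p ∂P := integral_nonneg (n₂ N)
  have jR : 0 ≤ ∫ x, R N x ^ p ∂P := integral_nonneg (nR N)
  have k₁ : ∫ x, runningMax M₁ N x ^ p ∂P ≤ q * (Real.exp (L * D) * δ ^ p) :=
    hS₁.trans (mul_le_mul_of_nonneg_left (by linarith) hq0)
  have k₂ : ∫ x, runningMax M₂ N x ^ p ∂P ≤ q * (Real.exp (L * D) * δ ^ p) :=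
    hS₂.trans (mul_le_mul_of_nonneg_left (by linarith) hq0)
  have kR : ∫ x, R N x ^ p ∂P ≤ Real.exp (L * D) * δ ^ p := by linarith
  calc _ ≤ q * (Real.exp (L * D) * δ ^ p) + q * (Real.exp (L * D) * δ ^ p)
        + Real.exp (L * D) * δ ^ p + D * (4 ^ p * (Real.exp (L * D) * δ ^ p)) := by
        linarith
    _ = _ := by ring

/-! ### Truncated amplitudes and the square-summable weights. -/

/-- Truncation of every entry to `[-1, 1]`. -/
def clip (w : ℕ+ → ℝ) : ℕ+ → ℝ := fun j => max (-1) (min 1 (w j))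

theorem abs_clip_le (w : ℕ+ → ℝ) (j : ℕ+) : |clip w j| ≤ 1 := by
  rw [abs_le]; exact ⟨le_max_left _ _, max_le (by norm_num) (min_le_left _ _)⟩

theorem clip_eq_self {w : ℕ+ → ℝ} (h : ∀ j, |w j| ≤ 1) : clip w = w := by
  funext j
  rw [clip, min_eq_right (abs_le.1 (h j)).2, max_eq_right (abs_le.1 (h j)).1]

theorem continuous_clip : Continuous clip :=
  continuous_pi fun j => continuous_const.max (continuous_const.min (continuous_apply j))

/-- The deterministic decay `n^{-α}`, with value `0` at `n = 0`. -/
noncomputable def decay (α : ℝ) (n : ℕ) : ℝ := if 0 < n then 1 / (n : ℝ) ^ α else 0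

/-- The clipped entry of index `n`, with value `0` at `n = 0`. -/
noncomputable def entry (w : ℕ+ → ℝ) (n : ℕ) : ℝ := if h : 0 < n then clip w ⟨n, h⟩ else 0

theorem abs_entry_le (w : ℕ+ → ℝ) (n : ℕ) : |entry w n| ≤ 1 := by
  unfold entry; split_ifs
  · exact abs_clip_le _ _
  · simp

theorem continuous_entry (n : ℕ) : Continuous fun w => entry w n := by
  unfold entry; split_ifs
  · exact (continuous_apply _).comp continuous_clip
  · exact continuous_const

theorem amplitude_clip (α : ℝ) (w : ℕ+ → ℝ) (n : ℕ) :
    amplitude α (clip w) n = entry w n * decay α n := by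
  unfold amplitude entry decay; split_ifs
  · rw [div_eq_mul_one_div]
  · simp

theorem decay_nonneg (α : ℝ) (n : ℕ) : 0 ≤ decay α n := by
  unfold decay; split_ifs <;> positivity

/-- The factor `2^α` comes from `n + 1 ≤ 2 n` for `n ≥ 1`; the shift makes index `0` harmless. -/
theorem decay_le {α : ℝ} (hα : 0 ≤ α) (n : ℕ) : decay α n ≤ 2 ^ α * ((n : ℝ) + 1) ^ (-α) := by
  unfold decay; split_ifs with h
  · have hn : (1 : ℝ) ≤ n := by exact_mod_cast h
    have hn0 : (0 : ℝ) < n := by linarith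
    rw [Real.rpow_neg (by positivity), ← div_eq_mul_inv, div_le_div_iff₀ (by positivity)
      (by positivity), one_mul, ← Real.mul_rpow (by norm_num) hn0.le]
    exact Real.rpow_le_rpow (by positivity) (by linarith) hα
  · positivity

theorem decay_le_one {α : ℝ} (hα : 0 ≤ α) (n : ℕ) : decay α n ≤ 1 := by
  unfold decay; split_ifs with h
  · have hn : (1 : ℝ) ≤ n := by exact_mod_cast h
    rw [div_le_one (by positivity)]
    exact Real.one_le_rpow hn hα
  · exact zero_le_one

theorem abs_amplitude_clip_le_decay (α : ℝ) (w : ℕ+ → ℝ) (n : ℕ) :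
    |amplitude α (clip w) n| ≤ decay α n := by
  rw [amplitude_clip, abs_mul, abs_of_nonneg (decay_nonneg α n)]
  exact mul_le_of_le_one_left (decay_nonneg α n) (abs_entry_le w n)

theorem abs_amplitude_clip_le_one {α : ℝ} (hα : 0 ≤ α) (w : ℕ+ → ℝ) (n : ℕ) :
    |amplitude α (clip w) n| ≤ 1 :=
  (abs_amplitude_clip_le_decay α w n).trans (decay_le_one hα n)

/-- The weights `(n + 1)^{-β}`. -/
noncomputable def weight (β : ℝ) (n : ℕ) : ℝ := ((n : ℝ) + 1) ^ (-β)

theorem weight_nonneg (β : ℝ) (n : ℕ) : 0 ≤ weight β n := by unfold weight; positivity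

theorem weight_le_one {β : ℝ} (hβ : 0 ≤ β) (n : ℕ) : weight β n ≤ 1 :=
  Real.rpow_le_one_of_one_le_of_nonpos (by have : (0 : ℝ) ≤ n := n.cast_nonneg
                                           linarith) (by linarith)

theorem exists_sum_weight_sq_le {β : ℝ} (hβ : 1 / 2 < β) :
    ∃ D : ℝ, 0 ≤ D ∧ ∀ N, ∑ j ∈ Finset.range N, weight β j ^ 2 ≤ D := by
  have hs : Summable fun n : ℕ => weight β n ^ 2 := by
    have h := (summable_nat_add_iff 1).2
      (Real.summable_one_div_nat_rpow.2 (by linarith : 1 < 2 * β))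
    refine h.congr fun n => ?_
    have hn : (0 : ℝ) ≤ (n : ℝ) + 1 := by positivity
    rw [weight, ← Real.rpow_two, ← Real.rpow_mul hn, Nat.cast_add, Nat.cast_one, one_div,
      ← Real.rpow_neg hn]
    congr 1; ring
  exact ⟨∑' n, weight β n ^ 2, tsum_nonneg fun n => sq_nonneg _,
    fun N => hs.sum_le_tsum _ fun n _ => sq_nonneg _⟩

theorem decay_mul_rpow_le {α η : ℝ} (hα : 0 ≤ α) (n : ℕ) :
    decay α n * ((n : ℝ) + 1) ^ η ≤ 2 ^ α * weight (α - η) n := by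
  have hn : (0 : ℝ) < (n : ℝ) + 1 := by positivity
  calc decay α n * ((n : ℝ) + 1) ^ η ≤ (2 ^ α * ((n : ℝ) + 1) ^ (-α)) * ((n : ℝ) + 1) ^ η := by
        gcongr; exact decay_le hα n
    _ = 2 ^ α * weight (α - η) n := by
        rw [mul_assoc, ← Real.rpow_add hn, weight]; congr 2; ring

/-- Second-order terms lose only one factor `(n + 1)^η`; the squared weight allows for two. -/
theorem decay_sq_mul_rpow_le {α η : ℝ} (hα : 0 ≤ α) (hη : 0 ≤ η) (n : ℕ) :
    decay α n ^ 2 * ((n : ℝ) + 1) ^ η ≤ (2 ^ α) ^ 2 * weight (α - η) n ^ 2 := by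
  have h1 : decay α n ≤ 2 ^ α * weight (α - η) n := by
    refine (decay_le hα n).trans ?_
    unfold weight
    gcongr
    · have : (0 : ℝ) ≤ n := n.cast_nonneg
      linarith
    · linarith
  calc _ = decay α n * (decay α n * ((n : ℝ) + 1) ^ η) := by ring
    _ ≤ (2 ^ α * weight (α - η) n) * (2 ^ α * weight (α - η) n) :=
        mul_le_mul h1 (decay_mul_rpow_le hα n)
          (mul_nonneg (decay_nonneg _ _) (by positivity))
          (mul_nonneg (by positivity) (weight_nonneg _ _))
    _ = _ := by ring

/-- The potential with clipped amplitudes and a prescribed single-site function. -/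
noncomputable def clippedPotential (α : ℝ) (g : ℝ → ℝ) (w : ℕ+ → ℝ) : ℝ → ℝ :=
  stepPotential g (amplitude α (clip w))

/-- The remainder of the first-order expansion of the difference of `J` over a unit interval. -/
noncomputable def unitRemainder (α : ℝ) (g : ℝ → ℝ) (κ₁ κ₂ : ℝ) (w : ℕ+ → ℝ) (j : ℕ) : ℂ :=
  (J (clippedPotential α g w) j (j + 1) κ₁ - J (clippedPotential α g w) j (j + 1) κ₂)
    - (amplitude α (clip w) j : ℂ) * (unitCoefficient g (clippedPotential α g w) κ₁ j
      - unitCoefficient g (clippedPotential α g w) κ₂ j)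

/-! ### Pathwise increment bounds and adaptedness. -/

section Deterministic

variable {α : ℝ} {g : ℝ → ℝ} {K : ℝ}

theorem measurable_clippedPotential (α : ℝ) (hgm : Measurable g) (w : ℕ+ → ℝ) :
    Measurable (clippedPotential α g w) := measurable_stepPotential hgm _

theorem abs_clippedPotential_le (hα : 0 ≤ α) (hg : ∀ s, |g s| ≤ K) (w : ℕ+ → ℝ) (s : ℝ) :
    |clippedPotential α g w s| ≤ K := abs_stepPotential_le hg (abs_amplitude_clip_le_one hα w) s

theorem continuous_clippedPotential (α : ℝ) (g : ℝ → ℝ) (s : ℝ) :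
    Continuous fun w => clippedPotential α g w s :=
  ((continuous_amplitude α _).comp continuous_clip).mul continuous_const

/-- The unit-interval estimates with `G = C₀ (j + 1)^η b`, whose growth is absorbed into the decay.
The constant is uniform in the energies, the sample and `j`. -/
theorem exists_increment_bounds (hα : 0 ≤ α) (hgm : Measurable g) (hg : ∀ s, |g s| ≤ K)
    {η κmin : ℝ} (hη : 0 < η) (hη1 : η ≤ 1) (h0 : 0 < κmin) :
    ∃ C : ℝ, 0 ≤ C ∧ ∀ κ₁ κ₂ : ℝ, κmin ≤ κ₁ → κmin ≤ κ₂ → ∀ (w : ℕ+ → ℝ) (j : ℕ) (b : ℝ),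
      b = |κ₁ - κ₂| ^ η + ‖J (clippedPotential α g w) 0 j κ₁
        - J (clippedPotential α g w) 0 j κ₂‖ →
      decay α j * ‖unitCoefficient g (clippedPotential α g w) κ₁ j
          - unitCoefficient g (clippedPotential α g w) κ₂ j‖ ≤ C * (weight (α - η) j * b) ∧
      ‖unitRemainder α g κ₁ κ₂ w j‖ ≤ C * (weight (α - η) j ^ 2 * b) ∧
      ∀ t, (j : ℝ) ≤ t → t ≤ j + 1 →
        ‖J (clippedPotential α g w) j t κ₁ - J (clippedPotential α g w) j t κ₂‖
          ≤ C * (weight (α - η) j * b) := by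
  have hK0 : 0 ≤ K := (abs_nonneg _).trans (hg 0)
  obtain ⟨C₀, hC₀1, hC₀⟩ := exists_norm_circlePhase_sub_le K κmin hK0 h0
  have hC₀0 : 0 ≤ C₀ := by linarith
  set C₅ : ℝ := (6 / κmin + 2 * (1 / κmin + 1 / κmin ^ 2) + 2 / κmin) * K ^ 2 with hC₅
  have hC₅0 : 0 ≤ C₅ := by positivity
  set E : ℝ := 2 ^ α with hE
  have hE0 : 0 ≤ E := by positivity
  refine ⟨3 * K * C₀ * E + C₅ * C₀ * E ^ 2, by positivity, ?_⟩
  intro κ₁ κ₂ h₁ h₂ w j b hb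
  have hA := abs_amplitude_clip_le_one hα w
  have hd := weight_nonneg (α - η) j
  have hδ0 : 0 ≤ |κ₁ - κ₂| ^ η := by positivity
  have hb0 : 0 ≤ b := by rw [hb]; positivity
  have hδb : |κ₁ - κ₂| ^ η ≤ b := by rw [hb]; exact le_add_of_nonneg_right (norm_nonneg _)
  have hj : (0 : ℝ) ≤ j := j.cast_nonneg
  have hj1 : 1 ≤ ((j : ℝ) + 1) ^ η := Real.one_le_rpow (by linarith) hη.le
  set G : ℝ := C₀ * (((j : ℝ) + 1) ^ η * b) with hGdef
  have hG := hC₀ _ (measurable_clippedPotential α hgm w) (abs_clippedPotential_le hα hg w) κ₁ κ₂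
    h₁ h₂ η hη hη1 j
  rw [← hb, ← hGdef] at hG
  have hδ : |κ₁ - κ₂| ^ η ≤ G := by
    calc |κ₁ - κ₂| ^ η ≤ b := hδb
      _ ≤ ((j : ℝ) + 1) ^ η * b := le_mul_of_one_le_left hb0 hj1
      _ ≤ G := le_mul_of_one_le_left (by positivity) hC₀1
  have hdec := decay_nonneg α j
  have hdG : decay α j * G ≤ C₀ * E * (weight (α - η) j * b) := by
    calc decay α j * G = C₀ * (decay α j * ((j : ℝ) + 1) ^ η) * b := by rw [hGdef]; ring
      _ ≤ C₀ * (E * weight (α - η) j) * b :=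
          mul_le_mul_of_nonneg_right (mul_le_mul_of_nonneg_left (decay_mul_rpow_le hα j) hC₀0) hb0
      _ = _ := by ring
  have hd2G : decay α j ^ 2 * G ≤ C₀ * E ^ 2 * (weight (α - η) j ^ 2 * b) := by
    calc decay α j ^ 2 * G = C₀ * (decay α j ^ 2 * ((j : ℝ) + 1) ^ η) * b := by rw [hGdef]; ring
      _ ≤ C₀ * (E ^ 2 * weight (α - η) j ^ 2) * b :=
          mul_le_mul_of_nonneg_right
            (mul_le_mul_of_nonneg_left (decay_sq_mul_rpow_le hα hη.le j) hC₀0) hb0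
      _ = _ := by ring
  have hAd := abs_amplitude_clip_le_decay α w j
  have hwb : 0 ≤ weight (α - η) j * b := by positivity
  have hwb2 : 0 ≤ weight (α - η) j ^ 2 * b := by positivity
  have hG0 : 0 ≤ G := by positivity
  refine ⟨?_, ?_, ?_⟩
  · have h := norm_unitCoefficient_sub_le hgm hg hη hη1 hG hδ
    calc _ ≤ decay α j * (3 * K * G) := mul_le_mul_of_nonneg_left h hdec
      _ = 3 * K * (decay α j * G) := by ring
      _ ≤ 3 * K * (C₀ * E * (weight (α - η) j * b)) := by gcongr
      _ = 3 * K * C₀ * E * (weight (α - η) j * b) := by ring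
      _ ≤ _ := by
          refine mul_le_mul_of_nonneg_right ?_ hwb
          have : 0 ≤ C₅ * C₀ * E ^ 2 := by positivity
          linarith
  · have h := norm_J_unit_sub_unitCoefficient_le hgm hg hA h0 h₁ h₂ hη hη1 hG hδ
    calc _ ≤ C₅ * (|amplitude α (clip w) j| ^ 2 * G) := h
      _ ≤ C₅ * (decay α j ^ 2 * G) := by gcongr
      _ ≤ C₅ * (C₀ * E ^ 2 * (weight (α - η) j ^ 2 * b)) := by gcongr
      _ = C₅ * C₀ * E ^ 2 * (weight (α - η) j ^ 2 * b) := by ring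
      _ ≤ _ := by
          refine mul_le_mul_of_nonneg_right ?_ hwb2
          have : 0 ≤ 3 * K * C₀ * E := by positivity
          linarith
  · intro t hjt ht
    have h := norm_J_unit_sub_le hgm hg hA h0 h₁ h₂ hG hjt ht
    calc _ ≤ |amplitude α (clip w) j| * K * G := h
      _ ≤ decay α j * K * G := by gcongr
      _ = K * (decay α j * G) := by ring
      _ ≤ K * (C₀ * E * (weight (α - η) j * b)) := by gcongr
      _ = K * C₀ * E * (weight (α - η) j * b) := by ring
      _ ≤ _ := by
          refine mul_le_mul_of_nonneg_right ?_ hwb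
          have : 0 ≤ C₅ * C₀ * E ^ 2 := by positivity
          have : 0 ≤ K * C₀ * E := by positivity
          linarith

theorem J_self (V : ℝ → ℝ) (a κ : ℝ) : J V a a κ = 0 := by simp [J]

theorem J_sub_J_eq_sum (hα : 0 ≤ α) (hgm : Measurable g) (hg : ∀ s, |g s| ≤ K) {κ₁ κ₂ : ℝ}
    (h₁ : 0 < κ₁) (h₂ : 0 < κ₂) (w : ℕ+ → ℝ) (n : ℕ) :
    J (clippedPotential α g w) 0 n κ₁ - J (clippedPotential α g w) 0 n κ₂
      = ∑ j ∈ Finset.range n, (amplitude α (clip w) j : ℂ)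
          * (unitCoefficient g (clippedPotential α g w) κ₁ j
            - unitCoefficient g (clippedPotential α g w) κ₂ j)
        + ∑ j ∈ Finset.range n, unitRemainder α g κ₁ κ₂ w j := by
  have hV := measurable_clippedPotential α hgm w
  have hB := abs_clippedPotential_le hα hg w
  induction n with
  | zero => simp [J_self]
  | succ n ih =>
    have hn : (0 : ℝ) ≤ n := n.cast_nonneg
    have hn1 : (n : ℝ) ≤ n + 1 := by linarith
    rw [Finset.sum_range_succ, Finset.sum_range_succ, Nat.cast_add, Nat.cast_one,
      J_sub_J hV hB h₁ le_rfl hn hn1, J_sub_J hV hB h₂ le_rfl hn hn1, add_sub_add_comm, ih,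
      unitRemainder]
    ring

theorem norm_J_le (hα : 0 ≤ α) (hg : ∀ s, |g s| ≤ K) (κ : ℝ) (w : ℕ+ → ℝ) {t : ℝ} (ht : 0 ≤ t) :
    ‖J (clippedPotential α g w) 0 t κ‖ ≤ K * t := by
  rw [J_eq_integral_circlePhase _ _ le_rfl ht]
  have := intervalIntegral.norm_integral_le_of_norm_le_const (a := 0) (b := t)
    (fun s _ => norm_circlePhase_mul_le (abs_clippedPotential_le hα hg w) κ s)
  rwa [sub_zero, abs_of_nonneg ht] at this

/-- The sequence `w` with all entries of index at least `n` replaced by `0`. -/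
def truncation (n : ℕ) (w : ℕ+ → ℝ) : ℕ+ → ℝ := fun j => if (j : ℕ) < n then w j else 0

theorem measurable_truncation (n : ℕ) : Measurable (truncation n) := by
  refine measurable_pi_iff.2 fun j => ?_
  unfold truncation
  split_ifs
  · exact measurable_pi_apply j
  · exact measurable_const

theorem truncation_truncation {m n : ℕ} (h : m ≤ n) (w : ℕ+ → ℝ) :
    truncation m (truncation n w) = truncation m w := by
  funext j
  unfold truncation
  split_ifs <;> first | rfl | omega

theorem entry_truncation {m n : ℕ} (h : m < n) (w : ℕ+ → ℝ) :
    entry (truncation n w) m = entry w m := by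
  unfold entry clip truncation
  split_ifs <;> first | rfl | simp_all

/-- Adaptedness: the coefficient involves the randomness only through the phase at time `n`, which
does not anticipate. -/
theorem unitCoefficient_truncation (hα : 0 ≤ α) (hgm : Measurable g) (hg : ∀ s, |g s| ≤ K)
    {κ : ℝ} (hκ : 0 < κ) (w : ℕ+ → ℝ) (n : ℕ) :
    unitCoefficient g (clippedPotential α g (truncation n w)) κ n
      = unitCoefficient g (clippedPotential α g w) κ n := by
  have h : phase (clippedPotential α g (truncation n w)) κ n
      = phase (clippedPotential α g w) κ n := by
    refine phase_congr (measurable_clippedPotential α hgm _) (measurable_clippedPotential α hgm _)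
      (abs_clippedPotential_le hα hg _) (abs_clippedPotential_le hα hg _) hκ n.cast_nonneg
      fun s hs => ?_
    have hlt : ⌊s⌋₊ < n := (Nat.floor_lt hs.1).2 hs.2
    rw [clippedPotential, clippedPotential, stepPotential, stepPotential, amplitude_clip,
      amplitude_clip, entry_truncation hlt]
  rw [unitCoefficient, unitCoefficient, circlePhase, circlePhase, h]

theorem continuous_unitCoefficient (hα : 0 ≤ α) (hgm : Measurable g) (hg : ∀ s, |g s| ≤ K)
    {κ : ℝ} (hκ : 0 < κ) (n : ℕ) :
    Continuous fun w => unitCoefficient g (clippedPotential α g w) κ n :=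
  (continuous_circlePhase_family (measurable_clippedPotential α hgm)
    (abs_clippedPotential_le hα hg) (continuous_clippedPotential α g) hκ n.cast_nonneg).mul
    continuous_const

theorem continuous_J (hα : 0 ≤ α) (hgm : Measurable g) (hg : ∀ s, |g s| ≤ K)
    {κ : ℝ} (hκ : 0 < κ) {a t : ℝ} (ha : 0 ≤ a) (hat : a ≤ t) :
    Continuous fun w => J (clippedPotential α g w) a t κ :=
  continuous_J_family (measurable_clippedPotential α hgm)
    (abs_clippedPotential_le hα hg) (continuous_clippedPotential α g) hκ ha hat

theorem continuous_unitRemainder (hα : 0 ≤ α) (hgm : Measurable g) (hg : ∀ s, |g s| ≤ K)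
    {κ₁ κ₂ : ℝ} (h₁ : 0 < κ₁) (h₂ : 0 < κ₂) (n : ℕ) :
    Continuous fun w => unitRemainder α g κ₁ κ₂ w n := by
  have hn : (0 : ℝ) ≤ n := n.cast_nonneg
  have hn1 : (n : ℝ) ≤ n + 1 := by linarith
  exact ((continuous_J hα hgm hg h₁ hn hn1).sub (continuous_J hα hgm hg h₂ hn hn1)).sub
    ((Complex.continuous_ofReal.comp ((continuous_amplitude α n).comp continuous_clip)).mul
      ((continuous_unitCoefficient hα hgm hg h₁ n).sub (continuous_unitCoefficient hα hgm hg h₂ n)))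

end Deterministic

/-! ### The probabilistic estimate for the truncated potential. -/

/-- The `n`-th σ-algebra is generated by the variables of index below `n`. Independence factors the
integral against an `F n`-measurable function, and the truncated variable is still centred because
truncation changes nothing almost surely. -/
theorem isCenteredNoise_entry {Ω : Type*} [mΩ : MeasurableSpace Ω] (P : Measure Ω)
    [IsProbabilityMeasure P] (ω : ℕ+ → Ω → ℝ) (hmeas : ∀ j, Measurable (ω j))
    (hindep : iIndepFun ω P) (hbound : ∀ j, ∀ᵐ x ∂P, |ω j x| ≤ 1)
    (hmean : ∀ j, ∫ x, ω j x ∂P = 0) :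
    IsCenteredNoise P
      (fun n => MeasurableSpace.comap (fun x => truncation n fun j => ω j x) inferInstance)
      (fun n x => entry (fun j => ω j x) n) := by
  have hω : Measurable fun x j => ω j x := measurable_pi_iff.2 hmeas
  refine ⟨fun n => ((measurable_truncation n).comp hω).comap_le, fun m n hmn => ?_, fun n => ?_,
    fun n x => abs_entry_le _ _, fun n h hh => ?_⟩
  · have : (fun x => truncation m fun j => ω j x)
        = truncation m ∘ fun x => truncation n fun j => ω j x := by
      funext x; exact (truncation_truncation hmn _).symm
    rw [this, ← MeasurableSpace.comap_comp]
    exact MeasurableSpace.comap_mono (measurable_truncation m).comap_le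
  · have : (fun x => entry (fun j => ω j x) n)
        = (fun w => entry w n) ∘ fun x => truncation (n + 1) fun j => ω j x := by
      funext x; exact (entry_truncation n.lt_succ_self _).symm
    rw [this]
    exact (continuous_entry n).measurable.comp (comap_measurable _)
  · rcases Nat.eq_zero_or_pos n with rfl | hn
    · simp [entry]
    · set k : ℕ+ := ⟨n, hn⟩ with hk
      have hind := hindep.indepFun_finset (Finset.Iio k) {k} (by simp) hmeas
      have hind' : IndepFun (fun x => truncation n fun j => ω j x)
          (fun x => entry (fun j => ω j x) n) P := by
        have hφ : Measurable fun (v : Finset.Iio k → ℝ) (j : ℕ+) =>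
            if hj : j ∈ Finset.Iio k then v ⟨j, hj⟩ else 0 := by
          refine measurable_pi_iff.2 fun j => ?_
          split_ifs
          · exact measurable_pi_apply _
          · exact measurable_const
        have hχ : Measurable fun (v : ({k} : Finset ℕ+) → ℝ) =>
            max (-1) (min 1 (v ⟨k, Finset.mem_singleton_self k⟩)) :=
          measurable_const.max (measurable_const.min (measurable_pi_apply _))
        have h := hind.comp hφ hχ
        have e1 : (fun x => truncation n fun j => ω j x)
            = (fun (v : Finset.Iio k → ℝ) (j : ℕ+) =>
              if hj : j ∈ Finset.Iio k then v ⟨j, hj⟩ else 0)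
              ∘ fun x (i : Finset.Iio k) => ω i x := by
          funext x j
          have : j ∈ Finset.Iio k ↔ (j : ℕ) < n := by
            rw [Finset.mem_Iio, ← PNat.coe_lt_coe]; rfl
          simp only [truncation, Function.comp_apply, this]
          split_ifs <;> rfl
        have e2 : (fun x => entry (fun j => ω j x) n)
            = (fun (v : ({k} : Finset ℕ+) → ℝ) =>
              max (-1) (min 1 (v ⟨k, Finset.mem_singleton_self k⟩)))
              ∘ fun x (i : ({k} : Finset ℕ+)) => ω i x := by
          funext x
          simp only [entry, dif_pos hn, clip, Function.comp_apply, hk]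
        rw [e1, e2]
        exact h
      have hind2 : IndepFun (fun x => entry (fun j => ω j x) n) h P :=
        (IndepFun_iff_Indep _ _ _).2 (indep_of_indep_of_le_right
          ((IndepFun_iff_Indep _ _ _).1 hind'.symm) hh.1.comap_le)
      have hhm : Measurable h := hh.1.mono ((measurable_truncation n).comp hω).comap_le le_rfl
      have hem : Measurable fun x => entry (fun j => ω j x) n :=
        (continuous_entry n).measurable.comp hω
      rw [hind2.integral_fun_mul_eq_mul_integral hem.aestronglyMeasurable
        hhm.aestronglyMeasurable]
      have : ∫ x, entry (fun j => ω j x) n ∂P = 0 := by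
        rw [← hmean k]
        refine integral_congr_ae ?_
        filter_upwards [hbound k] with x hx
        simp only [entry, dif_pos hn, clip]
        rw [min_eq_right (abs_le.1 hx).2, max_eq_right (abs_le.1 hx).1]
      rw [this, zero_mul]

/-- The supremum bound over `[0, N]` in expectation, through an integrable majorant. -/
theorem exists_majorant {Ω : Type*} [mΩ : MeasurableSpace Ω] (P : Measure Ω)
    [IsProbabilityMeasure P] {α : ℝ} {g : ℝ → ℝ} {K : ℝ} (hgm : Measurable g)
    (hg : ∀ s, |g s| ≤ K) (ω : ℕ+ → Ω → ℝ) (hmeas : ∀ j, Measurable (ω j))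
    (hindep : iIndepFun ω P) (hbound : ∀ j, ∀ᵐ x ∂P, |ω j x| ≤ 1)
    (hmean : ∀ j, ∫ x, ω j x ∂P = 0) {η : ℝ} (hη : 0 < η) (hηα : η < α - 1 / 2) (hη1 : η ≤ 1)
    {p : ℝ} (hp : 2 ≤ p) {κmin : ℝ} (h0 : 0 < κmin) :
    ∃ C : ℝ, 0 < C ∧ ∀ N : ℕ, ∀ κ₁ κ₂ : ℝ, κmin ≤ κ₁ → κmin ≤ κ₂ →
      ∃ Z : Ω → ℝ, Integrable Z P ∧ (∀ x, 0 ≤ Z x) ∧ ∫ x, Z x ∂P ≤ C * |κ₁ - κ₂| ^ (p * η) ∧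
        ∀ x, ∀ t ∈ Icc (0 : ℝ) N, ‖J (clippedPotential α g fun j => ω j x) 0 t κ₁
          - J (clippedPotential α g fun j => ω j x) 0 t κ₂‖ ^ p ≤ Z x := by
  have hα0 : 0 ≤ α := by linarith
  have hp0 : 0 ≤ p := by linarith
  have hK0 : 0 ≤ K := (abs_nonneg _).trans (hg 0)
  obtain ⟨C, hC0, hC⟩ := exists_increment_bounds hα0 hgm hg hη hη1 h0
  obtain ⟨D, hD0, hD⟩ := exists_sum_weight_sq_le (by linarith : 1 / 2 < α - η)
  obtain ⟨C', hC'0, hC'⟩ := IsCenteredNoise.exists_integral_max_le P hp hC0 hD0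
  have hnoise := isCenteredNoise_entry P ω hmeas hindep hbound hmean
  have hω : Measurable fun x j => ω j x := measurable_pi_iff.2 hmeas
  have hCp : 0 ≤ C ^ p := Real.rpow_nonneg hC0 p
  refine ⟨4 ^ p * (1 + C ^ p) * C', by positivity, fun N κ₁ κ₂ h₁ h₂ => ?_⟩
  have q₁ := h0.trans_le h₁
  have q₂ := h0.trans_le h₂
  set δ : ℝ := |κ₁ - κ₂| ^ η with hδ
  have hδ0 : 0 ≤ δ := by positivity
  set U : Ω → ℝ → ℝ := fun x => clippedPotential α g fun j => ω j x with hU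
  set d : ℕ → ℝ := weight (α - η) with hd
  have hd0 : ∀ n, 0 ≤ d n := weight_nonneg _
  have hd1 : ∀ n, d n ≤ 1 := weight_le_one (by linarith)
  set u : ℕ → Ω → ℂ := fun n x => unitCoefficient g (U x) κ₁ n - unitCoefficient g (U x) κ₂ n
    with hu
  set b : ℕ → Ω → ℝ := fun n x => δ + ‖J (U x) 0 n κ₁ - J (U x) 0 n κ₂‖ with hb
  set r : ℕ → Ω → ℝ := fun n x => ‖unitRemainder α g κ₁ κ₂ (fun j => ω j x) n‖ with hr
  -- The complex martingale is split into two real transforms driven by the same noise. The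
  -- deterministic decay goes into the coefficients, so the noise stays bounded by `1`.
  set a₁ : ℕ → Ω → ℝ := fun n x => decay α n * (u n x).re with ha₁
  set a₂ : ℕ → Ω → ℝ := fun n x => decay α n * (u n x).im with ha₂
  set ξ : ℕ → Ω → ℝ := fun n x => entry (fun j => ω j x) n with hξ
  have hb0 : ∀ n x, 0 ≤ b n x := fun n x => add_nonneg hδ0 (norm_nonneg _)
  have hinc := fun n x => hC κ₁ κ₂ h₁ h₂ (fun j => ω j x) n (b n x) rfl
  have hbm : ∀ n, BoundedMeasurable mΩ (b n) := by
    intro n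
    have hn : (0 : ℝ) ≤ n := n.cast_nonneg
    refine ⟨?_, δ + (K * n + K * n), fun x => ?_⟩
    · exact ((continuous_const.add ((continuous_J hα0 hgm hg q₁ le_rfl hn).sub
        (continuous_J hα0 hgm hg q₂ le_rfl hn)).norm).measurable).comp hω
    · rw [abs_of_nonneg (hb0 n x)]
      exact add_le_add_right ((norm_sub_le _ _).trans
        (add_le_add (norm_J_le hα0 hg _ _ hn) (norm_J_le hα0 hg _ _ hn))) _
  have hb_bdd : ∀ n, ∃ B, 0 ≤ B ∧ ∀ x, b n x ≤ B := fun n => by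
    obtain ⟨B, hB⟩ := (hbm n).2
    exact ⟨|B|, abs_nonneg _, fun x => (le_abs_self _).trans ((hB x).trans (le_abs_self _))⟩
  have hu_le : ∀ n x, decay α n * ‖u n x‖ ≤ C * (d n * b n x) := fun n x => (hinc n x).1
  have hr_le : ∀ n x, r n x ≤ C * (d n ^ 2 * b n x) := fun n x => (hinc n x).2.1
  have ha₁_le : ∀ n x, |a₁ n x| ≤ C * (d n * b n x) := fun n x => by
    rw [ha₁, abs_mul, abs_of_nonneg (decay_nonneg α n)]
    exact (mul_le_mul_of_nonneg_left (Complex.abs_re_le_norm _) (decay_nonneg α n)).trans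
      (hu_le n x)
  have ha₂_le : ∀ n x, |a₂ n x| ≤ C * (d n * b n x) := fun n x => by
    rw [ha₂, abs_mul, abs_of_nonneg (decay_nonneg α n)]
    exact (mul_le_mul_of_nonneg_left (Complex.abs_im_le_norm _) (decay_nonneg α n)).trans
      (hu_le n x)
  have hbdd_of_le : ∀ n, ∃ B, ∀ x, C * (d n * b n x) ≤ B := fun n => by
    obtain ⟨B, hB0, hB⟩ := hb_bdd n
    refine ⟨C * (d n * B), fun x => ?_⟩
    have := hd0 n
    have := hB x
    gcongr
  have hu_meas : ∀ n, Measurable[MeasurableSpace.comap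
      (fun x => truncation n fun j => ω j x) inferInstance] (u n) := by
    intro n
    have e : u n = (fun w => unitCoefficient g (clippedPotential α g w) κ₁ n
        - unitCoefficient g (clippedPotential α g w) κ₂ n)
        ∘ fun x => truncation n fun j => ω j x := by
      funext x
      simp only [hu, hU, Function.comp_apply, unitCoefficient_truncation hα0 hgm hg q₁,
        unitCoefficient_truncation hα0 hgm hg q₂]
    rw [e]
    exact ((continuous_unitCoefficient hα0 hgm hg q₁ n).sub
      (continuous_unitCoefficient hα0 hgm hg q₂ n)).measurable.comp (comap_measurable _)
  have ha₁m : ∀ n, BoundedMeasurable (MeasurableSpace.comap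
      (fun x => truncation n fun j => ω j x) inferInstance) (a₁ n) := fun n => by
    obtain ⟨B, hB⟩ := hbdd_of_le n
    exact ⟨measurable_const.mul (Complex.measurable_re.comp (hu_meas n)), B,
      fun x => (ha₁_le n x).trans (hB x)⟩
  have ha₂m : ∀ n, BoundedMeasurable (MeasurableSpace.comap
      (fun x => truncation n fun j => ω j x) inferInstance) (a₂ n) := fun n => by
    obtain ⟨B, hB⟩ := hbdd_of_le n
    exact ⟨measurable_const.mul (Complex.measurable_im.comp (hu_meas n)), B,
      fun x => (ha₂_le n x).trans (hB x)⟩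
  have hr0 : ∀ n x, 0 ≤ r n x := fun n x => norm_nonneg _
  have hrm : ∀ n, BoundedMeasurable mΩ (r n) := fun n => by
    obtain ⟨B, hB0, hB⟩ := hb_bdd n
    refine ⟨(continuous_unitRemainder hα0 hgm hg q₁ q₂ n).norm.measurable.comp hω,
      C * (d n ^ 2 * B), fun x => ?_⟩
    rw [abs_of_nonneg (hr0 n x)]
    refine (hr_le n x).trans ?_
    have := hd0 n
    have := hB x
    gcongr
  set M₁ := transform ξ a₁ with hM₁
  set M₂ := transform ξ a₂ with hM₂
  have hJle : ∀ (n : ℕ) x, ‖J (U x) 0 n κ₁ - J (U x) 0 n κ₂‖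
      ≤ |M₁ n x| + |M₂ n x| + ∑ j ∈ Finset.range n, r j x := by
    intro n x
    have e := J_sub_J_eq_sum hα0 hgm hg q₁ q₂ (fun j => ω j x) n
    have e' : ∀ j, (amplitude α (clip fun j => ω j x) j : ℂ) * (unitCoefficient g (U x) κ₁ j
        - unitCoefficient g (U x) κ₂ j) = ((ξ j x * decay α j : ℝ) : ℂ) * u j x := by
      intro j; rw [amplitude_clip]
    simp only [hU] at e' ⊢
    rw [e]
    simp only [e']
    refine (norm_add_le _ _).trans (add_le_add ?_ (norm_sum_le _ _))
    refine (Complex.norm_le_abs_re_add_abs_im _).trans (le_of_eq ?_)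
    rw [Complex.re_sum, Complex.im_sum, hM₁, hM₂, transform, transform]
    simp only [Complex.re_ofReal_mul, Complex.im_ofReal_mul, ha₁, ha₂, mul_assoc]
  have hb_le : ∀ n x, b n x ≤ δ + |M₁ n x| + |M₂ n x| + ∑ j ∈ Finset.range n, r j x :=
    fun n x => by
      have := hJle n x
      simp only [hb]
      linarith
  have hmain := hC' hnoise d hd0 hd1 hD δ hδ0 a₁ a₂ r b ha₁m ha₂m hrm hbm hr0 hb0 ha₁_le ha₂_le
    hr_le hb_le N
  set Y : Ω → ℝ := fun x => runningMax M₁ N x ^ p + runningMax M₂ N x ^ p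
        + (∑ j ∈ Finset.range N, r j x) ^ p
        + ∑ j ∈ Finset.range N, d j ^ 2 * b j x ^ p with hY
  have nS₁ := fun x => runningMax_nonneg M₁ N x
  have nS₂ := fun x => runningMax_nonneg M₂ N x
  have nR : ∀ x, 0 ≤ ∑ j ∈ Finset.range N, r j x := fun x =>
    Finset.sum_nonneg fun j _ => hr0 j x
  have hYi : Integrable Y P :=
    ((((((hnoise.boundedMeasurable_runningMax ha₁m N).mono (hnoise.le N)).rpow nS₁ hp0).add
      (((hnoise.boundedMeasurable_runningMax ha₂m N).mono (hnoise.le N)).rpow nS₂ hp0)).add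
      ((BoundedMeasurable.sum _ fun j _ => hrm j).rpow nR hp0)).add
      (BoundedMeasurable.sum _ fun j _ => ((hbm j).rpow (hb0 j) hp0).const_mul _)).integrable P
  have nY₁ := fun x => Real.rpow_nonneg (nS₁ x) p
  have nY₂ := fun x => Real.rpow_nonneg (nS₂ x) p
  have nY₃ := fun x => Real.rpow_nonneg (nR x) p
  have nY₅ : ∀ x j, 0 ≤ d j ^ 2 * b j x ^ p := fun x j =>
    mul_nonneg (sq_nonneg _) (Real.rpow_nonneg (hb0 j x) p)
  have nY₄ : ∀ x, 0 ≤ ∑ j ∈ Finset.range N, d j ^ 2 * b j x ^ p := fun x =>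
    Finset.sum_nonneg fun j _ => nY₅ x j
  have hY0 : ∀ x, 0 ≤ Y x := fun x => by
    have := nY₁ x; have := nY₂ x; have := nY₃ x; have := nY₄ x
    simp only [hY]; positivity
  refine ⟨fun x => 4 ^ p * (1 + C ^ p) * Y x, hYi.const_mul _,
    fun x => mul_nonneg (by positivity) (hY0 x), ?_, ?_⟩
  · rw [integral_const_mul]
    have e : |κ₁ - κ₂| ^ (p * η) = δ ^ p := by
      rw [hδ, ← Real.rpow_mul (abs_nonneg _), mul_comm]
    rw [e, mul_assoc (4 ^ p * (1 + C ^ p))]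
    exact mul_le_mul_of_nonneg_left hmain (by positivity)
  intro x t ht
  have hV := measurable_clippedPotential α hgm fun j => ω j x
  have hB := abs_clippedPotential_le hα0 hg fun j => ω j x
  set n := ⌊t⌋₊ with hn
  have hnt : (n : ℝ) ≤ t := Nat.floor_le ht.1
  have hnt1 : t < n + 1 := Nat.lt_floor_add_one t
  have hnN : n ≤ N := by exact_mod_cast hnt.trans ht.2
  have hn0 : (0 : ℝ) ≤ n := n.cast_nonneg
  have hS₁ : |M₁ n x| ≤ runningMax M₁ N x := abs_transform_le_runningMax ξ a₁ hnN x
  have hS₂ : |M₂ n x| ≤ runningMax M₂ N x := abs_transform_le_runningMax ξ a₂ hnN x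
  have hRn : ∑ j ∈ Finset.range n, r j x ≤ ∑ j ∈ Finset.range N, r j x :=
    Finset.sum_le_sum_of_subset_of_nonneg (Finset.range_mono hnN) fun j _ _ => hr0 j x
  obtain ⟨Q, hQ0, hQ, hQp⟩ : ∃ Q : ℝ, 0 ≤ Q ∧ ‖J (U x) n t κ₁ - J (U x) n t κ₂‖ ≤ Q ∧
      Q ^ p ≤ C ^ p * ∑ j ∈ Finset.range N, d j ^ 2 * b j x ^ p := by
    rcases hnN.eq_or_lt with h | h
    · have : t = n := le_antisymm (by rw [h]; exact ht.2) hnt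
      refine ⟨0, le_rfl, ?_, ?_⟩
      · rw [this, J_self, J_self]; simp
      · rw [Real.zero_rpow (by linarith)]
        exact mul_nonneg hCp (nY₄ x)
    · have hdn := hd0 n
      have hbn := hb0 n x
      refine ⟨C * (d n * b n x), by positivity, (hinc n x).2.2 t hnt hnt1.le, ?_⟩
      rw [Real.mul_rpow hC0 (by positivity), Real.mul_rpow hdn hbn]
      refine mul_le_mul_of_nonneg_left ?_ hCp
      refine le_trans ?_ (Finset.single_le_sum (f := fun j => d j ^ 2 * b j x ^ p)
        (fun j _ => nY₅ x j) (Finset.mem_range.2 h))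
      refine mul_le_mul_of_nonneg_right ?_ (Real.rpow_nonneg hbn p)
      rcases hdn.eq_or_lt with hz | hz
      · rw [← hz, Real.zero_rpow (by linarith)]; norm_num
      · rw [← Real.rpow_two]
        exact Real.rpow_le_rpow_of_exponent_ge hz (hd1 n) hp
  have hJt : ‖J (U x) 0 t κ₁ - J (U x) 0 t κ₂‖
      ≤ runningMax M₁ N x + runningMax M₂ N x + (∑ j ∈ Finset.range N, r j x) + Q := by
    rw [J_sub_J hV hB q₁ le_rfl hn0 hnt, J_sub_J hV hB q₂ le_rfl hn0 hnt, add_sub_add_comm]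
    refine (norm_add_le _ _).trans ?_
    have := hJle n x
    simp only [hU] at this hQ
    linarith
  refine (Real.rpow_le_rpow (norm_nonneg _) hJt hp0).trans
    ((add_four_rpow_le hp0 (nS₁ x) (nS₂ x) (nR x) hQ0).trans ?_)
  change _ ≤ 4 ^ p * (1 + C ^ p) * Y x
  rw [mul_assoc]
  refine mul_le_mul_of_nonneg_left ?_ (by positivity)
  have := nY₁ x
  have := nY₂ x
  have := nY₃ x
  have := nY₄ x
  simp only [hY]
  have hx : 0 ≤ C ^ p * (runningMax M₁ N x ^ p + runningMax M₂ N x ^ p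
        + (∑ j ∈ Finset.range N, r j x) ^ p) := by positivity
  linarith

end ClockStatistics
open ClockStatistics in
theorem proposition5
    {Ω : Type*} [MeasurableSpace Ω] (P : Measure Ω) [IsProbabilityMeasure P]
    (α : ℝ) (hα : 1 / 2 < α)
    (f : ℝ → ℝ) (hf : MemLp f ⊤ volume) (hsupp : Function.support f ⊆ Set.Icc 0 1)
    (ω : ℕ+ → Ω → ℝ) (hmeas : ∀ j, Measurable (ω j))
    (hindep : iIndepFun ω P) (hident : ∀ i j, IdentDistrib (ω i) (ω j) P P)
    (hbound : ∀ j, ∀ᵐ x ∂P, |ω j x| ≤ 1)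
    (hmean : ∀ j, ∫ x, ω j x ∂P = 0) (hvar : ∀ j, 0 < ∫ x, (ω j x) ^ 2 ∂P)
    (η : ℝ) (hη : 0 < η) (hηα : η < α - 1 / 2) (hη1 : η ≤ 1)
    (p : ℝ) (hp : 2 ≤ p)
    (κmin : ℝ) (hκmin : 0 < κmin) :
    ∃ C : ℝ, 0 < C ∧ ∀ m N : ℕ, m ≤ N → ∀ κ₁ κ₂ : ℝ, κmin ≤ κ₁ → κmin ≤ κ₂ →
      AEMeasurable
        (fun x => ⨆ t ∈ Set.Icc (m : ℝ) (N : ℝ),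
          ‖J (potential α f fun j => ω j x) m t κ₁
            - J (potential α f fun j => ω j x) m t κ₂‖ₑ ^ p) P ∧
      ∫⁻ x, (⨆ t ∈ Set.Icc (m : ℝ) (N : ℝ),
          ‖J (potential α f fun j => ω j x) m t κ₁
            - J (potential α f fun j => ω j x) m t κ₂‖ₑ ^ p) ∂P
        ≤ ENNReal.ofReal (C * |κ₁ - κ₂| ^ (p * η)) := by
  obtain ⟨g, K, -, hgm, hg, hfg⟩ := exists_measurable_bounded_ae_eq hf
  obtain ⟨C, hC0, hC⟩ := exists_majorant P hgm hg ω hmeas hindep hbound hmean hη hηα hη1 hp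
    hκmin
  have hα0 : 0 ≤ α := by linarith
  have hp0 : 0 ≤ p := by linarith
  have hω : Measurable fun x j => ω j x := measurable_pi_iff.2 hmeas
  refine ⟨2 ^ p * C, by positivity, fun m N hmN κ₁ κ₂ h₁ h₂ => ?_⟩
  have q₁ := hκmin.trans_le h₁
  have q₂ := hκmin.trans_le h₂
  have hm0 : (0 : ℝ) ≤ m := m.cast_nonneg
  have hJ : ∀ᵐ x ∂P, ∀ t ∈ Set.Icc (m : ℝ) (N : ℝ), ∀ κ,
      J (potential α f fun j => ω j x) m t κ
        = J (clippedPotential α g fun j => ω j x) m t κ := by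
    filter_upwards [ae_all_iff.2 hbound] with x hx t ht κ
    refine J_congr ?_ κ hm0 ht.1
    have := potential_ae_eq_stepPotential α hsupp hfg fun j => ω j x
    rwa [clippedPotential, clip_eq_self hx]
  have hsup : ∀ᵐ x ∂P, (⨆ t ∈ Set.Icc (m : ℝ) (N : ℝ),
      ‖J (potential α f fun j => ω j x) m t κ₁
        - J (potential α f fun j => ω j x) m t κ₂‖ₑ ^ p)
      = ⨆ t ∈ Set.Icc (m : ℝ) (N : ℝ),
        ‖J (clippedPotential α g fun j => ω j x) m t κ₁
          - J (clippedPotential α g fun j => ω j x) m t κ₂‖ₑ ^ p := by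
    filter_upwards [hJ] with x hx
    refine iSup_congr fun t => iSup_congr fun ht => ?_
    rw [hx t ht, hx t ht]
  have hmeasurable : Measurable fun w : ℕ+ → ℝ => ⨆ t ∈ Set.Icc (m : ℝ) (N : ℝ),
      ‖J (clippedPotential α g w) m t κ₁ - J (clippedPotential α g w) m t κ₂‖ₑ ^ p := by
    refine LowerSemicontinuous.measurable (lowerSemicontinuous_biSup fun t ht => ?_)
    exact (ENNReal.continuous_rpow_const.comp ((continuous_J hα0 hgm hg q₁ hm0 ht.1).sub
      (continuous_J hα0 hgm hg q₂ hm0 ht.1)).enorm).lowerSemicontinuous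
  refine ⟨⟨_, hmeasurable.comp hω, hsup⟩, ?_⟩
  obtain ⟨Z, hZi, hZ0, hZ, hZle⟩ := hC N κ₁ κ₂ h₁ h₂
  rw [lintegral_congr_ae hsup]
  calc _ ≤ ∫⁻ x, ENNReal.ofReal (2 ^ p * Z x) ∂P := by
        refine lintegral_mono fun x => iSup₂_le fun t ht => ?_
        have hV := measurable_clippedPotential α hgm fun j => ω j x
        have hB := abs_clippedPotential_le hα0 hg fun j => ω j x
        rw [← ofReal_norm, ENNReal.ofReal_rpow_of_nonneg (norm_nonneg _) hp0]
        refine ENNReal.ofReal_le_ofReal ?_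
        have e₁ := J_sub_J hV hB q₁ le_rfl hm0 ht.1
        have e₂ := J_sub_J hV hB q₂ le_rfl hm0 ht.1
        have hzt := hZle x t ⟨hm0.trans ht.1, ht.2⟩
        have hzm := hZle x m ⟨hm0, by exact_mod_cast hmN⟩
        set A := J (clippedPotential α g fun j => ω j x) 0 t κ₁
          - J (clippedPotential α g fun j => ω j x) 0 t κ₂
        set B := J (clippedPotential α g fun j => ω j x) 0 m κ₁
          - J (clippedPotential α g fun j => ω j x) 0 m κ₂
        have e : J (clippedPotential α g fun j => ω j x) m t κ₁
            - J (clippedPotential α g fun j => ω j x) m t κ₂ = A - B := by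
          simp only [A, B, e₁, e₂]; ring
        rw [e]
        have hle : ‖A - B‖ ≤ 2 * max ‖A‖ ‖B‖ := by
          have := norm_sub_le A B
          have := le_max_left ‖A‖ ‖B‖
          have := le_max_right ‖A‖ ‖B‖
          linarith
        calc ‖A - B‖ ^ p ≤ (2 * max ‖A‖ ‖B‖) ^ p :=
              Real.rpow_le_rpow (norm_nonneg _) hle hp0
          _ = 2 ^ p * max ‖A‖ ‖B‖ ^ p :=
              Real.mul_rpow (by norm_num) ((norm_nonneg _).trans (le_max_left _ _))
          _ ≤ 2 ^ p * Z x := by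
              refine mul_le_mul_of_nonneg_left ?_ (by positivity)
              rcases max_choice ‖A‖ ‖B‖ with h | h <;> rw [h] <;> assumption
    _ = ENNReal.ofReal (∫ x, 2 ^ p * Z x ∂P) :=
        (ofReal_integral_eq_lintegral_ofReal (hZi.const_mul _)
          (Filter.Eventually.of_forall fun x => mul_nonneg (by positivity) (hZ0 x))).symm
    _ ≤ _ := by
        refine ENNReal.ofReal_le_ofReal ?_
        rw [integral_const_mul, mul_assoc]
        exact mul_le_mul_of_nonneg_left hZ (by positivity)
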